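/- Throughout, $\mathbb C\{x,y\}\subseteq\mathbb C[[x,y]]$ is the algebra of power series that converge absolutely in a neighbourhood of the origin. Two series in $\mathbb C[[x,y]]$ (respectively in $\mathbb C\{x,y\}$) are called formally right equivalent (respectively right equivalent) if some $\mathbb C$-algebra automorphism of $\mathbb C[[x,y]]$ (respectively of $\mathbb C\{x,y\}$) takes the first to the second. The Newton polyhedron of $g\in\mathbb C[[x,y]]$ is the convex hull in $\mathbb R^2$ of the union of the sets $(i,j)+(\mathbb R_{\ge 0})^2$ over all $(i,j)$ such that $x^iy^j$ has a non-zero coefficient in $g$; its facets are its one-dimensional faces. Let $g\neq 0$ and let $\Delta$ be a facet of its Newton polyhedron. Let $w=(w_x,w_y)$ be the unique normal vector of $\Delta$ with non-negative integer entries and $\gcd(w_x,w_y)=1$. Let $g_w$ be the $w$-weighted-homogeneous leading term of $g$, that is, the sum of the terms $c_{ij}x^iy^j$ of $g$ of minimal weight $iw_x+jw_y$ among those with $c_{ij}\ne0$. Let $a,b$ be the greatest non-negative integers such that $x^ay^b$ divides $g_w$ in $\mathbb C[[x,y]]$, and let $d$ be the greatest non-negative integer such that the $d$-th power of some irreducible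 power series divides $g_w/(x^ay^b)$. The series $g$ is called normalised with respect to $\Delta$ if one of the following holds: 1. $w_x=0$ or $w_y=0$; 2. $w_x=1$, $w_y=1$ and $d\le\min(a,b)$; 3. $w_x=1$, $w_y>1$ and $d\le b$; 4. $w_x>1$, $w_y=1$ and $d\le a$; 5. $w_x>1$ and $w_y>1$. **Proposition.** Every formal power series $f\in\mathbb C[[x,y]]$ is formally right equivalent to a formal power series $g\in\mathbb C[[x,y]]$ which is normalised with respect to each compact facet of its Newton polyhedron. If $f\in\mathbb C\{x,y\}$ defines an isolated singularity (that is, $f(0,0)=0$ and there is a neighbourhood $U$ of the origin such that $f$, $\partial f/\partial x$ and $\partial f/\partial y$ have no common zero in $U\setminus\{(0,0)\}$), then $f$ is right equivalent to a polynomial $g\in\mathbb C[x,y]$ which is normalised with respect to each compact facet of its Newton polyhedron. -/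

import Mathlib

open Filter Topology

namespace NewtonPolyhedron

noncomputable section

/-! ### Formal and convergent power series -/

/-- The value at `z` of the monomial `x ^ n`. -/
def monomialValue {σ : Type*} (z : σ → ℂ) (n : σ →₀ ℕ) : ℂ :=
  n.prod fun i k => z i ^ k

theorem monomialValue_add {σ : Type*} (z : σ → ℂ) (m n : σ →₀ ℕ) :
    monomialValue z (m + n) = monomialValue z m * monomialValue z n := by
  classical
  exact Finsupp.prod_add_index' (fun _ => pow_zero _) (fun _ _ _ => pow_add _ _ _)

/-- A power series is convergent if it converges absolutely at all points of a neighbourhood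
of the origin. -/
def IsConvergent {σ : Type*} (f : MvPowerSeries σ ℂ) : Prop :=
  ∀ᶠ z : σ → ℂ in 𝓝 0, Summable fun n : σ →₀ ℕ => ‖MvPowerSeries.coeff n f * monomialValue z n‖

theorem IsConvergent.add {σ : Type*} {f g : MvPowerSeries σ ℂ} (hf : IsConvergent f)
    (hg : IsConvergent g) : IsConvergent (f + g) := by
  filter_upwards [hf, hg] with z h1 h2
  rw [summable_norm_iff] at h1 h2 ⊢
  simpa only [map_add, add_mul] using h1.add h2

theorem IsConvergent.mul {σ : Type*} {f g : MvPowerSeries σ ℂ} (hf : IsConvergent f)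
    (hg : IsConvergent g) : IsConvergent (f * g) := by
  classical
  filter_upwards [hf, hg] with z h1 h2
  have h := summable_sum_mul_antidiagonal_of_summable_mul (summable_mul_of_summable_norm h1 h2)
  rw [summable_norm_iff]
  refine h.congr fun n => ?_
  rw [MvPowerSeries.coeff_mul, Finset.sum_mul]
  refine Finset.sum_congr rfl fun p hp => ?_
  rw [← Finset.HasAntidiagonal.mem_antidiagonal.mp hp, monomialValue_add]
  ring

theorem isConvergent_C {σ : Type*} (a : ℂ) : IsConvergent (MvPowerSeries.C (σ := σ) a) := by
  classical
  refine Eventually.of_forall fun z => ?_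
  refine summable_of_ne_finset_zero (s := {0}) fun n hn => ?_
  rw [Finset.mem_singleton] at hn
  rw [MvPowerSeries.coeff_C, if_neg hn, zero_mul, norm_zero]

/-- The algebra `ℂ{x_i | i ∈ σ}` of convergent power series. -/
def convergentPowerSeries (σ : Type*) : Subalgebra ℂ (MvPowerSeries σ ℂ) where
  carrier := {f | IsConvergent f}
  add_mem' := IsConvergent.add
  mul_mem' := IsConvergent.mul
  algebraMap_mem' a := isConvergent_C a

/-- Formal power series `f`, `g` are formally right equivalent if some `ℂ`-algebra automorphism
of the ring of formal power series takes `f` to `g`. -/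
def FormallyRightEquivalent {σ : Type*} (f g : MvPowerSeries σ ℂ) : Prop :=
  ∃ Φ : MvPowerSeries σ ℂ ≃ₐ[ℂ] MvPowerSeries σ ℂ, Φ f = g

/-- Convergent power series `f`, `g` are right equivalent if some `ℂ`-algebra automorphism
of the ring of convergent power series takes `f` to `g`. -/
def RightEquivalent {σ : Type*} (f g : convergentPowerSeries σ) : Prop :=
  ∃ Φ : convergentPowerSeries σ ≃ₐ[ℂ] convergentPowerSeries σ, Φ f = g

/-- The sum of the series `f` at the point `z` (meaningful where `f` converges absolutely). -/
def evalAt {σ : Type*} (f : MvPowerSeries σ ℂ) (z : σ → ℂ) : ℂ :=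
  ∑' n : σ →₀ ℕ, MvPowerSeries.coeff n f * monomialValue z n

/-- `f` defines an isolated singularity: the hypersurface germ `V(f)` contains the origin and,
in a punctured neighbourhood of the origin, there is no point at which `f` and all its partial
derivatives vanish. (A smooth germ is allowed, as is customary.) -/
def DefinesIsolatedSingularity {σ : Type*} (f : convergentPowerSeries σ) : Prop :=
  MvPowerSeries.constantCoeff (f : MvPowerSeries σ ℂ) = 0 ∧
    ∀ᶠ z : σ → ℂ in 𝓝[≠] 0,
      ¬ (evalAt (f : MvPowerSeries σ ℂ) z = 0 ∧
        ∀ i, evalAt (MvPowerSeries.pderiv ℂ i (f : MvPowerSeries σ ℂ)) z = 0)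

/-! ### Leading terms and saturation -/

/-- The `w`-weighted-homogeneous leading term `f_w`. -/
def leadingTerm {σ : Type*} (w : σ → ℕ) (f : MvPowerSeries σ ℂ) : MvPowerSeries σ ℂ :=
  MvPowerSeries.weightedHomogeneousComponent w (f.weightedOrder w).toNat f

/-- The exponent of the largest monomial dividing `f` (for `f ≠ 0`). -/
def monomialExponent {σ : Type*} [Finite σ] (f : MvPowerSeries σ ℂ) : σ →₀ ℕ :=
  Finsupp.equivFunOnFinite.symm fun i => multiplicity (MvPowerSeries.X i) f

/-- The saturation `sat f`: the quotient of `f` by the largest monomial dividing it. -/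
def saturation {σ : Type*} [Finite σ] (f : MvPowerSeries σ ℂ) : MvPowerSeries σ ℂ :=
  fun n => MvPowerSeries.coeff (n + monomialExponent f) f

theorem monomial_mul_saturation {σ : Type*} [Finite σ] (f : MvPowerSeries σ ℂ) :
    MvPowerSeries.monomial (monomialExponent f) 1 * saturation f = f := by
  classical
  ext n
  rw [MvPowerSeries.coeff_monomial_mul]
  split_ifs with h
  · rw [one_mul, MvPowerSeries.coeff_apply, saturation, tsub_add_cancel_of_le h]
  · rw [Finsupp.le_def, not_forall] at h
    obtain ⟨i, hi⟩ := h
    exact (MvPowerSeries.X_pow_dvd_iff.mp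
      (pow_multiplicity_dvd (MvPowerSeries.X i) f) n (not_le.mp hi)).symm

/-- The greatest `d` such that the `d`-th power of an irreducible power series divides `h`. -/
def maxMultiplicity {σ : Type*} (h : MvPowerSeries σ ℂ) : ℕ∞ :=
  ⨆ p : {p : MvPowerSeries σ ℂ // Irreducible p}, emultiplicity (p : MvPowerSeries σ ℂ) h

/-! ### The Newton polyhedron and its facets -/

/-- The Newton polyhedron of `f`. -/
def newtonPolyhedron {σ : Type*} (f : MvPowerSeries σ ℂ) : Set (σ → ℝ) :=
  convexHull ℝ (⋃ n ∈ {n : σ →₀ ℕ | MvPowerSeries.coeff n f ≠ 0}, {v | ∀ i, (n i : ℝ) ≤ v i})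

/-- `Δ` is a facet of the convex set `P` in `ℝ^σ`: a face of dimension `|σ| - 1`. -/
def IsFacet {σ : Type*} [Fintype σ] (P Δ : Set (σ → ℝ)) : Prop :=
  Δ.Nonempty ∧ IsExposed ℝ P Δ ∧ Module.finrank ℝ (vectorSpan ℝ Δ) + 1 = Fintype.card σ

/-- `w = (w_x, w_y)` is a normal vector of `Δ`, with `w_x`, `w_y` coprime non-negative
integers. -/
def IsPrimitiveNormal (w : Fin 2 → ℕ) (Δ : Set (Fin 2 → ℝ)) : Prop :=
  Nat.gcd (w 0) (w 1) = 1 ∧ ∀ u ∈ Δ, ∀ v ∈ Δ, ∑ i, (w i : ℝ) * (u i - v i) = 0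

/-- `f ∈ ℂ[[x, y]]` is normalised with respect to the facet `Δ` of its Newton polyhedron. Here
`x`, `y` are the variables `0`, `1`, `w` is the primitive non-negative normal vector of `Δ`,
`x ^ a * y ^ b` is the largest monomial dividing `f_w`, and `d` is the largest multiplicity of
an irreducible factor of `sat f_w`. -/
def IsNormalised (f : MvPowerSeries (Fin 2) ℂ) (Δ : Set (Fin 2 → ℝ)) : Prop :=
  ∃ w : Fin 2 → ℕ, IsPrimitiveNormal w Δ ∧
    let a : ℕ := monomialExponent (leadingTerm w f) 0
    let b : ℕ := monomialExponent (leadingTerm w f) 1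
    let d : ℕ∞ := maxMultiplicity (saturation (leadingTerm w f))
    (w 0 = 0 ∨ w 1 = 0) ∨
    (w 0 = 1 ∧ w 1 = 1 ∧ d ≤ (min a b : ℕ)) ∨
    (w 0 = 1 ∧ 1 < w 1 ∧ d ≤ b) ∨
    (1 < w 0 ∧ w 1 = 1 ∧ d ≤ a) ∨
    (1 < w 0 ∧ 1 < w 1)

/-- `f` is normalised with respect to each compact facet of its Newton polyhedron. -/
def IsNormalisedAtCompactFacets (f : MvPowerSeries (Fin 2) ℂ) : Prop :=
  ∀ Δ : Set (Fin 2 → ℝ), IsFacet (newtonPolyhedron f) Δ → IsCompact Δ → IsNormalised f Δ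

end

end NewtonPolyhedron

/-! A compact facet has a normal vector with positive entries, so only weights that give some `x_j`
weight 1 and the other variable `x_i` weight `n ≥ 1` impose a condition. For such a weight the
leading term is, over `ℂ`, a constant times `x_j ^ r * ∏ (x_i - c * x_j ^ n)`. It therefore suffices
that 0 has the largest multiplicity among the roots `c` of the dehomogenised leading term. This is
`IsBalanced`, and it is achieved for both variables and all `n ≥ 1` at once, without reference to
the facets that occur (`exists_isApproximable_isBalanced`,
`isNormalisedAtCompactFacets_of_isBalanced`).

Balancing uses shears `x_i ↦ x_i + ∑ a_k * x_j ^ k`. At weight `n` the coefficient `a_n` translates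
the roots, the `a_k` with `k > n` have no effect, and those with `k < n` are already fixed; so the
`a_n` can be chosen recursively, each moving a root of maximal multiplicity to 0. Terms with `k ≥ 2`
do not disturb the weights belonging to the other variable. For `n = 1` both variables share one
weight, and a double maximisation over automorphisms settles both conditions.

The recursion yields formal series only. For an isolated singularity the Jacobian ideal contains
powers of the variables (`exists_pow_eq_sum_pderiv`), hence `f` is finitely determined
(`exists_determinacy`). The formal automorphism is replaced by a convergent approximation and the
balanced series by a truncation of high degree, which stays balanced for all `n` simultaneously
(`exists_isBalanced_of_coeff_eq`).

Determinacy rests on an implicit function theorem, proved by a fixed point argument with weighted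
`ℓ¹` norms. Powers of the variables in the Jacobian ideal come from Weierstrass division: a common
factor `h` of both partial derivatives would force `f` to be constant, hence zero, on `h = 0`
(`dvd_sub_C_of_dvd_bracket`), while in two variables a zero set is never an isolated point. -/

namespace NewtonPolyhedron

noncomputable section

open MvPowerSeries
open scoped ENNReal NNReal

/-! ### Weighted `ℓ¹` norms of power series -/

/-- The power series with given coefficients. -/
def ofCoeff {σ : Type*} (c : (σ →₀ ℕ) → ℂ) : MvPowerSeries σ ℂ := c

@[simp] theorem coeff_ofCoeff {σ : Type*} (c : (σ →₀ ℕ) → ℂ) (n : σ →₀ ℕ) :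
    coeff n (ofCoeff c) = c n := rfl

/-- The value of the monomial with exponent `n` at the polyradius `r`. -/
def radiusMonomial {σ : Type*} (r : σ → ℝ≥0∞) (n : σ →₀ ℕ) : ℝ≥0∞ :=
  n.prod fun i k => r i ^ k

theorem radiusMonomial_add {σ : Type*} (r : σ → ℝ≥0∞) (m n : σ →₀ ℕ) :
    radiusMonomial r (m + n) = radiusMonomial r m * radiusMonomial r n := by
  classical
  exact Finsupp.prod_add_index' (fun _ => pow_zero _) (fun _ _ _ => pow_add _ _ _)

@[simp] theorem radiusMonomial_zero {σ : Type*} (r : σ → ℝ≥0∞) : radiusMonomial r 0 = 1 :=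
  Finsupp.prod_zero_index

@[simp] theorem radiusMonomial_single {σ : Type*} (r : σ → ℝ≥0∞) (i : σ) (k : ℕ) :
    radiusMonomial r (Finsupp.single i k) = r i ^ k :=
  Finsupp.prod_single_index (pow_zero _)

theorem radiusMonomial_mono {σ : Type*} {r s : σ → ℝ≥0∞} (h : ∀ i, r i ≤ s i) (n : σ →₀ ℕ) :
    radiusMonomial r n ≤ radiusMonomial s n :=
  Finset.prod_le_prod' fun i _ => pow_le_pow_left' (h i) _

theorem radiusMonomial_ne_top {σ : Type*} {r : σ → ℝ≥0∞} (h : ∀ i, r i ≠ ⊤) (n : σ →₀ ℕ) :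
    radiusMonomial r n ≠ ⊤ :=
  ENNReal.prod_ne_top fun i _ => ENNReal.pow_ne_top (h i)

theorem radiusMonomial_ne_zero {σ : Type*} {r : σ → ℝ≥0∞} (h : ∀ i, r i ≠ 0) (n : σ →₀ ℕ) :
    radiusMonomial r n ≠ 0 :=
  Finset.prod_ne_zero_iff.mpr fun i _ => pow_ne_zero _ (h i)

theorem radiusMonomial_const {σ : Type*} (ρ : ℝ≥0∞) (n : σ →₀ ℕ) :
    radiusMonomial (fun _ => ρ) n = ρ ^ n.degree := by
  rw [radiusMonomial, Finsupp.prod, Finset.prod_pow_eq_pow_sum, Finsupp.degree_apply]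

theorem radiusMonomial_scale {σ : Type*} (t : ℝ≥0∞) (w : σ → ℕ) (r : σ → ℝ≥0∞) (n : σ →₀ ℕ) :
    radiusMonomial (fun i => t ^ w i * r i) n
      = t ^ Finsupp.weight w n * radiusMonomial r n := by
  simp only [radiusMonomial, Finsupp.prod, mul_pow, Finset.prod_mul_distrib, Finsupp.weight_apply,
    Finsupp.sum, ← pow_mul, Finset.prod_pow_eq_pow_sum, smul_eq_mul]
  simp only [mul_comm]

/-- The weighted `ℓ¹` norm of a power series for the polyradius `r`. -/
def radiusNorm {σ : Type*} (r : σ → ℝ≥0∞) (f : MvPowerSeries σ ℂ) : ℝ≥0∞ :=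
  ∑' n : σ →₀ ℕ, ‖coeff n f‖ₑ * radiusMonomial r n

theorem radiusNorm_mono {σ : Type*} {r s : σ → ℝ≥0∞} (h : ∀ i, r i ≤ s i)
    (f : MvPowerSeries σ ℂ) : radiusNorm r f ≤ radiusNorm s f :=
  ENNReal.tsum_le_tsum fun n => mul_le_mul_right (radiusMonomial_mono h n) _

theorem radiusNorm_le_of_coeff {σ : Type*} (r : σ → ℝ≥0∞) {f g : MvPowerSeries σ ℂ}
    (h : ∀ n, ‖coeff n f‖ₑ ≤ ‖coeff n g‖ₑ) : radiusNorm r f ≤ radiusNorm r g :=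
  ENNReal.tsum_le_tsum fun n => mul_le_mul_left (h n) _

theorem radiusNorm_add_le {σ : Type*} (r : σ → ℝ≥0∞) (f g : MvPowerSeries σ ℂ) :
    radiusNorm r (f + g) ≤ radiusNorm r f + radiusNorm r g := by
  rw [radiusNorm, radiusNorm, radiusNorm, ← ENNReal.tsum_add]
  refine ENNReal.tsum_le_tsum fun n => ?_
  rw [← add_mul, map_add]
  exact mul_le_mul_left (enorm_add_le _ _) _

@[simp] theorem radiusNorm_zero {σ : Type*} (r : σ → ℝ≥0∞) : radiusNorm r 0 = 0 := by
  simp [radiusNorm]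

@[simp] theorem radiusNorm_neg {σ : Type*} (r : σ → ℝ≥0∞) (f : MvPowerSeries σ ℂ) :
    radiusNorm r (-f) = radiusNorm r f := by
  simp [radiusNorm]

theorem radiusNorm_sub_le {σ : Type*} (r : σ → ℝ≥0∞) (f g : MvPowerSeries σ ℂ) :
    radiusNorm r (f - g) ≤ radiusNorm r f + radiusNorm r g := by
  simpa [sub_eq_add_neg] using radiusNorm_add_le r f (-g)

theorem radiusNorm_monomial {σ : Type*} (r : σ → ℝ≥0∞) (n : σ →₀ ℕ) (a : ℂ) :
    radiusNorm r (monomial n a) = ‖a‖ₑ * radiusMonomial r n := by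
  classical
  rw [radiusNorm, tsum_eq_single n]
  · simp
  · intro m hm
    simp [coeff_monomial, hm]

@[simp] theorem radiusNorm_one {σ : Type*} (r : σ → ℝ≥0∞) : radiusNorm r 1 = 1 := by
  simpa using radiusNorm_monomial r 0 1

@[simp] theorem radiusNorm_X {σ : Type*} (r : σ → ℝ≥0∞) (i : σ) :
    radiusNorm r (X i) = r i := by
  simpa [X] using radiusNorm_monomial r (Finsupp.single i 1) 1

theorem radiusNorm_mul_le {σ : Type*} (r : σ → ℝ≥0∞) (f g : MvPowerSeries σ ℂ) :
    radiusNorm r (f * g) ≤ radiusNorm r f * radiusNorm r g := by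
  classical
  have h : radiusNorm r f * radiusNorm r g = ∑' n : σ →₀ ℕ, ∑ p ∈ Finset.HasAntidiagonal.antidiagonal n,
      (‖coeff p.1 f‖ₑ * radiusMonomial r p.1) * (‖coeff p.2 g‖ₑ * radiusMonomial r p.2) := by
    rw [radiusNorm, radiusNorm, ← ENNReal.tsum_mul_right]
    simp_rw [← ENNReal.tsum_mul_left]
    rw [← ENNReal.tsum_prod
      (f := fun m n => (‖coeff m f‖ₑ * radiusMonomial r m) * (‖coeff n g‖ₑ * radiusMonomial r n)),
      ← Finset.HasAntidiagonal.sigmaAntidiagonalEquivProd.tsum_eq, ENNReal.tsum_sigma']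
    refine tsum_congr fun n => ?_
    rw [tsum_fintype, ← Finset.sum_coe_sort (Finset.HasAntidiagonal.antidiagonal n)]
    rfl
  rw [h]
  refine ENNReal.tsum_le_tsum fun n => ?_
  rw [coeff_mul]
  refine (mul_le_mul_left (enorm_sum_le _ _) _).trans ?_
  rw [Finset.sum_mul]
  refine Finset.sum_le_sum fun p hp => ?_
  rw [← Finset.HasAntidiagonal.mem_antidiagonal.mp hp, radiusMonomial_add, enorm_mul]
  exact le_of_eq (by ring)

theorem radiusNorm_pow_le {σ : Type*} (r : σ → ℝ≥0∞) (f : MvPowerSeries σ ℂ) (k : ℕ) :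
    radiusNorm r (f ^ k) ≤ radiusNorm r f ^ k := by
  induction k with
  | zero => simp
  | succ k ih =>
    rw [pow_succ, pow_succ]
    exact (radiusNorm_mul_le r _ _).trans (mul_le_mul_left ih _)

theorem radiusNorm_prod_le {σ ι : Type*} (r : σ → ℝ≥0∞) (s : Finset ι)
    (f : ι → MvPowerSeries σ ℂ) :
    radiusNorm r (∏ i ∈ s, f i) ≤ ∏ i ∈ s, radiusNorm r (f i) := by
  classical
  induction s using Finset.induction_on with
  | empty => simp
  | insert i s hi ih =>
    rw [Finset.prod_insert hi, Finset.prod_insert hi]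
    exact (radiusNorm_mul_le r _ _).trans (mul_le_mul_right ih _)

theorem radiusNorm_coe_ne_top {σ : Type*} {r : σ → ℝ≥0∞} (hr : ∀ i, r i ≠ ⊤)
    (p : MvPolynomial σ ℂ) : radiusNorm r (p : MvPowerSeries σ ℂ) ≠ ⊤ := by
  rw [radiusNorm, tsum_eq_sum (s := p.support)]
  · exact ENNReal.sum_ne_top.mpr fun n _ => ENNReal.mul_ne_top enorm_ne_top
      (radiusMonomial_ne_top hr n)
  · intro n hn
    simp [MvPolynomial.notMem_support_iff.mp hn]

/-- Triangle inequality over the monomials of `f`, then submultiplicativity on each monomial. With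
values in `ℝ≥0∞` the sums may be exchanged freely. -/
theorem radiusNorm_subst_le {σ τ : Type*} (r : τ → ℝ≥0∞) {a : σ → MvPowerSeries τ ℂ}
    (ha : HasSubst a) (f : MvPowerSeries σ ℂ) :
    radiusNorm r (subst a f) ≤ radiusNorm (fun i => radiusNorm r (a i)) f := by
  have h1 : ∀ e, ‖coeff e (subst a f)‖ₑ ≤
      ∑' d : σ →₀ ℕ, ‖coeff d f‖ₑ * ‖coeff e (d.prod fun s k => a s ^ k)‖ₑ := by
    intro e
    rw [coeff_subst ha, finsum_eq_sum _ (coeff_subst_finite ha f e)]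
    refine (enorm_sum_le _ _).trans ?_
    simp_rw [smul_eq_mul, enorm_mul]
    exact ENNReal.sum_le_tsum _
  calc radiusNorm r (subst a f)
      ≤ ∑' e, (∑' d : σ →₀ ℕ, ‖coeff d f‖ₑ * ‖coeff e (d.prod fun s k => a s ^ k)‖ₑ)
          * radiusMonomial r e := ENNReal.tsum_le_tsum fun e => mul_le_mul_left (h1 e) _
    _ = ∑' d : σ →₀ ℕ, ‖coeff d f‖ₑ * radiusNorm r (d.prod fun s k => a s ^ k) := by
        simp_rw [← ENNReal.tsum_mul_right]
        rw [ENNReal.tsum_comm]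
        simp_rw [radiusNorm, ← ENNReal.tsum_mul_left, mul_assoc]
    _ ≤ _ := ENNReal.tsum_le_tsum fun d => mul_le_mul_right
        ((radiusNorm_prod_le r _ _).trans
          (Finset.prod_le_prod' fun i _ => radiusNorm_pow_le r _ _)) _

/-- The source of smallness in the fixed point arguments: shrinking the radii by powers of `t`
according to the weights gains `t ^ k` on a series starting in weight `k`. -/
theorem radiusNorm_scale_le {σ : Type*} {t : ℝ≥0∞} (ht : t ≤ 1) (w : σ → ℕ) (r : σ → ℝ≥0∞)
    {f : MvPowerSeries σ ℂ} {k : ℕ} (hf : ∀ n, Finsupp.weight w n < k → coeff n f = 0) :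
    radiusNorm (fun i => t ^ w i * r i) f ≤ t ^ k * radiusNorm r f := by
  rw [radiusNorm, radiusNorm, ← ENNReal.tsum_mul_left]
  refine ENNReal.tsum_le_tsum fun n => ?_
  rw [radiusMonomial_scale]
  rcases lt_or_ge (Finsupp.weight w n) k with h | h
  · simp [hf n h]
  · rw [← mul_assoc, mul_comm ‖_‖ₑ, mul_assoc]
    exact mul_le_mul_left (pow_le_pow_right_of_le_one' ht h) _

/-- The norm is a supremum of finite partial sums, hence lower semicontinuous for coefficientwise
convergence. This passes norm bounds to the limit of an iteration. -/
theorem radiusNorm_le_of_forall_finset {σ : Type*} (r : σ → ℝ≥0∞) (f : MvPowerSeries σ ℂ)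
    {C : ℝ≥0∞} (h : ∀ s : Finset (σ →₀ ℕ), ∃ g, radiusNorm r g ≤ C ∧
      ∀ n ∈ s, coeff n g = coeff n f) : radiusNorm r f ≤ C := by
  rw [radiusNorm, ENNReal.tsum_eq_iSup_sum]
  refine iSup_le fun s => ?_
  obtain ⟨g, hg, hs⟩ := h s
  refine le_trans ?_ hg
  rw [Finset.sum_congr rfl fun n hn => by rw [← hs n hn]]
  exact ENNReal.sum_le_tsum _

theorem radiusNorm_shift_mul_le {σ : Type*} (r : σ → ℝ≥0∞) (m : σ →₀ ℕ)
    {f g : MvPowerSeries σ ℂ} (h : ∀ n, ‖coeff n g‖ₑ ≤ ‖coeff (n + m) f‖ₑ) :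
    radiusNorm r g * radiusMonomial r m ≤ radiusNorm r f := by
  rw [radiusNorm, radiusNorm, ← ENNReal.tsum_mul_right]
  refine le_trans (ENNReal.tsum_le_tsum fun n => ?_)
    (ENNReal.tsum_comp_le_tsum_of_injective (add_left_injective m)
      (fun n => ‖coeff n f‖ₑ * radiusMonomial r n))
  rw [mul_assoc, ← radiusMonomial_add]
  exact mul_le_mul_left (h n) _

/-- The factor `n_i + 1` produced by differentiation is at most `2` to the total degree, so doubling
the radii absorbs it. -/
theorem radiusNorm_pderiv_mul_le {σ : Type*} (r : σ → ℝ≥0∞) (i : σ) (f : MvPowerSeries σ ℂ) :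
    radiusNorm r (pderiv ℂ i f) * r i ≤ radiusNorm (fun j => 2 * r j) f := by
  have h2 : ∀ n : σ →₀ ℕ, radiusMonomial (fun j => 2 * r j) n
      = 2 ^ n.degree * radiusMonomial r n := by
    intro n
    simpa [← Finsupp.degree_eq_weight_one] using radiusMonomial_scale 2 (fun _ => 1) r n
  rw [radiusNorm, radiusNorm, ← ENNReal.tsum_mul_right]
  refine le_trans (ENNReal.tsum_le_tsum fun n => ?_)
    (ENNReal.tsum_comp_le_tsum_of_injective (add_left_injective (Finsupp.single i 1))
      (fun n => ‖coeff n f‖ₑ * radiusMonomial (fun j => 2 * r j) n))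
  rw [coeff_pderiv, h2, radiusMonomial_add, radiusMonomial_single, pow_one, enorm_mul]
  have h3 : ‖((n i : ℂ) + 1)‖ₑ ≤ 2 ^ (n + Finsupp.single i 1).degree := by
    have : ((n i : ℂ) + 1) = ((n i + 1 : ℕ) : ℂ) := by push_cast; rfl
    rw [this, ← ofReal_norm, Complex.norm_natCast, ENNReal.ofReal_natCast]
    have h4 : n i + 1 ≤ 2 ^ (n + Finsupp.single i 1).degree := by
      have h5 : n i + 1 ≤ (n + Finsupp.single i 1).degree := by
        have := Finsupp.le_degree i (n + Finsupp.single i 1)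
        rwa [Finsupp.add_apply, Finsupp.single_eq_same] at this
      exact h5.trans Nat.lt_two_pow_self.le
    exact_mod_cast h4
  calc _ = ‖coeff (n + Finsupp.single i 1) f‖ₑ * (‖((n i : ℂ) + 1)‖ₑ *
          (radiusMonomial r n * r i)) := by ring
    _ ≤ _ := mul_le_mul_right (mul_le_mul_left h3 _) _

/-- Absolute convergence at `z` is finiteness of the norm at the polyradius `|z_i|`; with finitely
many variables one common radius suffices. -/
theorem isConvergent_iff {σ : Type*} [Finite σ] {f : MvPowerSeries σ ℂ} :
    IsConvergent f ↔ ∃ ρ : ℝ≥0, 0 < ρ ∧ radiusNorm (fun _ => (ρ : ℝ≥0∞)) f ≠ ⊤ := by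
  cases nonempty_fintype σ
  have key : ∀ (z : σ → ℂ), (∑' n : σ →₀ ℕ, (‖coeff n f * monomialValue z n‖ₑ))
      = radiusNorm (fun i => ‖z i‖ₑ) f := by
    intro z
    refine tsum_congr fun n => ?_
    rw [enorm_mul]
    congr 1
    simp only [monomialValue, radiusMonomial, Finsupp.prod]
    rw [← ofReal_norm, norm_prod, ENNReal.ofReal_prod_of_nonneg fun _ _ => norm_nonneg _]
    exact Finset.prod_congr rfl fun i _ => by rw [ofReal_norm, enorm_pow]
  have key2 : ∀ z : σ → ℂ, Summable (fun n : σ →₀ ℕ => ‖coeff n f * monomialValue z n‖) ↔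
      radiusNorm (fun i => ‖z i‖ₑ) f ≠ ⊤ := by
    intro z
    rw [← key]
    simp only [enorm]
    rw [ENNReal.tsum_coe_ne_top_iff_summable, ← NNReal.summable_coe]
    simp only [coe_nnnorm]
  constructor
  · intro h
    obtain ⟨ε, hε, hb⟩ := Metric.eventually_nhds_iff_ball.mp h
    have hz : (fun _ : σ => ((ε / 2 : ℝ) : ℂ)) ∈ Metric.ball (0 : σ → ℂ) ε := by
      rw [mem_ball_zero_iff, pi_norm_lt_iff hε]
      intro i
      simp only [Complex.norm_real, Real.norm_eq_abs, abs_of_pos (half_pos hε)]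
      linarith
    refine ⟨⟨ε / 2, by positivity⟩, by exact_mod_cast half_pos hε, ?_⟩
    have h2 := (key2 _).mp (hb _ hz)
    convert h2 using 3
    rw [← ofReal_norm, Complex.norm_real, Real.norm_eq_abs, abs_of_pos (half_pos hε),
      ENNReal.ofReal, Real.toNNReal_of_nonneg (half_pos hε).le]
    rfl
  · rintro ⟨ρ, hρ, h⟩
    filter_upwards [Metric.ball_mem_nhds (0 : σ → ℂ) (show (0 : ℝ) < ρ by exact_mod_cast hρ)]
      with z hz
    rw [key2]
    refine ne_top_of_le_ne_top h (radiusNorm_mono (fun i => ?_) f)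
    rw [mem_ball_zero_iff] at hz
    have := (norm_le_pi_norm z i).trans hz.le
    exact_mod_cast this

theorem IsConvergent.exists_radius {σ ι : Type*} [Finite σ] [Finite ι]
    {f : ι → MvPowerSeries σ ℂ} (h : ∀ i, IsConvergent (f i)) :
    ∃ ρ : ℝ≥0, 0 < ρ ∧ ∀ i, radiusNorm (fun _ => (ρ : ℝ≥0∞)) (f i) ≠ ⊤ := by
  cases nonempty_fintype ι
  choose ρ h1 h2 using fun i => isConvergent_iff.mp (h i)
  by_cases hι : Nonempty ι
  · refine ⟨Finset.univ.inf' Finset.univ_nonempty ρ, (Finset.lt_inf'_iff _).mpr fun i _ => h1 i,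
      fun i => ne_top_of_le_ne_top (h2 i) (radiusNorm_mono (fun _ => ?_) _)⟩
    exact_mod_cast Finset.inf'_le ρ (Finset.mem_univ i)
  · exact ⟨1, one_pos, fun i => (hι ⟨i⟩).elim⟩

theorem isConvergent_of_radiusNorm {σ : Type*} [Finite σ] {f : MvPowerSeries σ ℂ}
    {r : σ → ℝ≥0∞} (hr : ∀ i, r i ≠ 0) (h : radiusNorm r f ≠ ⊤) : IsConvergent f := by
  cases nonempty_fintype σ
  by_cases hσ : Nonempty σ
  · have h0 : 0 < Finset.univ.inf' Finset.univ_nonempty r :=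
      (Finset.lt_inf'_iff _).mpr fun i _ => pos_iff_ne_zero.mpr (hr i)
    obtain ⟨ρ, h1, h2⟩ := ENNReal.lt_iff_exists_nnreal_btwn.mp h0
    refine isConvergent_iff.mpr ⟨ρ, by exact_mod_cast h1, ne_top_of_le_ne_top h
      (radiusNorm_mono (fun i => h2.le.trans (Finset.inf'_le r (Finset.mem_univ i))) f)⟩
  · refine isConvergent_iff.mpr ⟨1, one_pos, ?_⟩
    convert h
    exact (hσ ⟨‹σ›⟩).elim

theorem isConvergent_coe {σ : Type*} [Finite σ] (p : MvPolynomial σ ℂ) :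
    IsConvergent (p : MvPowerSeries σ ℂ) :=
  isConvergent_iff.mpr ⟨1, one_pos, radiusNorm_coe_ne_top (by simp) p⟩

theorem isConvergent_X {σ : Type*} [Finite σ] (i : σ) : IsConvergent (X i : MvPowerSeries σ ℂ) := by
  simpa using isConvergent_coe (MvPolynomial.X i)

theorem IsConvergent.pderiv {σ : Type*} [Finite σ] {f : MvPowerSeries σ ℂ} (hf : IsConvergent f)
    (i : σ) : IsConvergent (MvPowerSeries.pderiv ℂ i f) := by
  obtain ⟨ρ, h1, h2⟩ := isConvergent_iff.mp hf
  have h := radiusNorm_pderiv_mul_le (fun _ => ((ρ / 2 : ℝ≥0) : ℝ≥0∞)) i f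
  have h3 : (2 : ℝ≥0∞) * ((ρ / 2 : ℝ≥0) : ℝ≥0∞) = ρ := by
    rw [← ENNReal.coe_ofNat, ← ENNReal.coe_mul, mul_div_cancel₀ _ two_ne_zero]
  simp only [h3] at h
  refine isConvergent_iff.mpr ⟨ρ / 2, half_pos h1, fun h4 => ?_⟩
  rw [h4, ENNReal.top_mul (by simpa using h1.ne')] at h
  exact h2 (top_le_iff.mp h)

/-- A coefficientwise contraction that preserves a product of norm balls has a fixed point there. -/
theorem exists_fixedPoint {σ ι : Type*} (wt : (σ →₀ ℕ) → ℕ) (r : σ → ℝ≥0∞) (C : ι → ℝ≥0∞)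
    (T : (ι → MvPowerSeries σ ℂ) → ι → MvPowerSeries σ ℂ)
    (hT : ∀ k u v, (∀ i n, wt n < k → coeff n (u i) = coeff n (v i)) →
      ∀ i n, wt n < k + 1 → coeff n (T u i) = coeff n (T v i))
    (hC : ∀ u, (∀ i, radiusNorm r (u i) ≤ C i) → ∀ i, radiusNorm r (T u i) ≤ C i) :
    ∃ u, T u = u ∧ ∀ i, radiusNorm r (u i) ≤ C i := by
  have h1 : ∀ k i n, wt n < k → coeff n (T^[k] 0 i) = coeff n (T^[k + 1] 0 i) := by
    intro k
    induction k with
    | zero => intro i n h; omega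
    | succ k ih =>
      intro i n h
      rw [Function.iterate_succ_apply', Function.iterate_succ_apply']
      exact hT k _ _ ih i n h
  have h2 : ∀ k l i n, wt n < k → k ≤ l → coeff n (T^[k] 0 i) = coeff n (T^[l] 0 i) := by
    intro k l i n h hl
    induction l, hl using Nat.le_induction with
    | base => rfl
    | succ l hl ih => rw [ih, h1 l i n (h.trans_le hl)]
  -- The coefficient at `n` no longer changes after `wt n + 1` iterations, so the limit exists
  -- coefficientwise.
  let u : ι → MvPowerSeries σ ℂ := fun i => ofCoeff fun n => coeff n (T^[wt n + 1] 0 i)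
  have hu : ∀ k i n, wt n < k → coeff n (u i) = coeff n (T^[k] 0 i) := fun k i n h =>
    h2 (wt n + 1) k i n (Nat.lt_succ_self _) h
  have hN : ∀ k i, radiusNorm r (T^[k] 0 i) ≤ C i := by
    intro k
    induction k with
    | zero => simp
    | succ k ih => rw [Function.iterate_succ_apply']; exact hC _ ih
  refine ⟨u, ?_, fun i => ?_⟩
  · ext i n
    rw [hu (wt n + 2) i n (by omega), Function.iterate_succ_apply']
    exact hT (wt n + 1) _ _ (fun i m hm => hu _ i m hm) i n (by omega)
  · refine radiusNorm_le_of_forall_finset r _ fun s => ?_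
    refine ⟨T^[s.sup wt + 1] 0 i, hN _ i, fun n hn => ?_⟩
    exact (hu _ i n (Nat.lt_succ_of_le (Finset.le_sup hn))).symm

/-- Decomposition of a series all of whose monomials are divisible by one of finitely many. -/
theorem exists_sum_monomial_mul {σ ι : Type*} [Fintype ι] (m : ι → σ →₀ ℕ)
    (f : MvPowerSeries σ ℂ) (h : ∀ n, coeff n f ≠ 0 → ∃ i, m i ≤ n) :
    ∃ A : ι → MvPowerSeries σ ℂ, f = ∑ i, monomial (m i) 1 * A i ∧
      ∀ i n, coeff n (A i) = 0 ∨ coeff n (A i) = coeff (n + m i) f := by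
  classical
  rcases isEmpty_or_nonempty ι with hι | hι
  · refine ⟨fun _ => 0, ?_, fun i => (hι.false i).elim⟩
    ext n
    by_contra hn
    obtain ⟨i, -⟩ := h n (by simpa using hn)
    exact hι.false i
  have h' : ∀ n, ∃ i, coeff n f ≠ 0 → m i ≤ n := by
    intro n
    by_cases hn : coeff n f = 0
    · exact ⟨Classical.arbitrary ι, fun h => (h hn).elim⟩
    · obtain ⟨i, hi⟩ := h n hn
      exact ⟨i, fun _ => hi⟩
  -- One divisor is selected for each exponent, so every term of `f` is counted in exactly one
  -- summand.
  choose p hp using h'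
  refine ⟨fun i => ofCoeff fun n => if p (n + m i) = i then coeff (n + m i) f else 0, ?_,
    fun i n => ?_⟩
  · ext n
    rw [map_sum]
    simp only [coeff_monomial_mul, one_mul, coeff_ofCoeff]
    by_cases hn : coeff n f = 0
    · rw [hn, eq_comm]
      refine Finset.sum_eq_zero fun i _ => ?_
      by_cases h1 : m i ≤ n
      · simp only [tsub_add_cancel_of_le h1, hn, ite_self]
      · rw [if_neg h1]
    · rw [Finset.sum_eq_single_of_mem (p n) (Finset.mem_univ _)]
      · rw [if_pos (hp n hn), tsub_add_cancel_of_le (hp n hn), if_pos rfl]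
      · intro i _ hi
        by_cases h1 : m i ≤ n
        · rw [if_pos h1, tsub_add_cancel_of_le h1, if_neg hi.symm]
        · rw [if_neg h1]
  · by_cases h1 : p (n + m i) = i
    · exact Or.inr (by simp [h1])
    · exact Or.inl (by simp [h1])

theorem IsConvergent.of_shift {σ : Type*} [Finite σ] {f g : MvPowerSeries σ ℂ} {m : σ →₀ ℕ}
    (hf : IsConvergent f) (h : ∀ n, coeff n g = 0 ∨ coeff n g = coeff (n + m) f) :
    IsConvergent g := by
  obtain ⟨ρ, h1, h2⟩ := isConvergent_iff.mp hf
  refine isConvergent_iff.mpr ⟨ρ, h1, fun h3 => ?_⟩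
  have h4 := radiusNorm_shift_mul_le (fun _ => (ρ : ℝ≥0∞)) m (f := f) (g := g) fun n => by
    rcases h n with h | h <;> simp [h]
  rw [h3, ENNReal.top_mul (radiusMonomial_ne_zero (fun _ => by simpa using h1.ne') _)] at h4
  exact h2 (top_le_iff.mp h4)

end

end NewtonPolyhedron

namespace NewtonPolyhedron

noncomputable section

open MvPowerSeries
open scoped ENNReal NNReal

/-! ### The implicit function theorem and automorphisms tangent to the identity -/

theorem le_order_add_of_le {σ : Type*} {k : ℕ∞} {f g : MvPowerSeries σ ℂ} (hf : k ≤ f.order)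
    (hg : k ≤ g.order) : k ≤ (f + g).order :=
  (le_min hf hg).trans min_order_le_add

theorem coeff_eq_of_le_order_sub {σ : Type*} {k : ℕ} {f g : MvPowerSeries σ ℂ}
    (h : (k : ℕ∞) ≤ (f - g).order) {n : σ →₀ ℕ} (hn : n.degree < k) : coeff n f = coeff n g := by
  have := coeff_of_lt_order (f := f - g) (d := n) (lt_of_lt_of_le (by exact_mod_cast hn) h)
  rwa [map_sub, sub_eq_zero] at this

theorem le_order_sub_of_coeff {σ : Type*} {k : ℕ} {f g : MvPowerSeries σ ℂ}
    (h : ∀ n : σ →₀ ℕ, n.degree < k → coeff n f = coeff n g) : (k : ℕ∞) ≤ (f - g).order :=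
  nat_le_order fun d hd => by rw [map_sub, h d hd, sub_self]

theorem degree_le_order_prod {σ τ : Type*} {a : σ → MvPowerSeries τ ℂ}
    (ha : ∀ s, 1 ≤ (a s).order) (d : σ →₀ ℕ) :
    (d.degree : ℕ∞) ≤ (d.prod fun s k => a s ^ k).order := by
  refine le_trans ?_ (le_order_prod _ _)
  rw [Finsupp.degree_apply, Nat.cast_sum]
  refine Finset.sum_le_sum fun s _ => le_trans ?_ (le_order_pow _)
  simpa using mul_le_mul_right (ha s) (d s : ℕ∞)

theorem prod_add_single {σ τ : Type*} (a : σ → MvPowerSeries τ ℂ) (d : σ →₀ ℕ) (s : σ) :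
    ((d + Finsupp.single s 1).prod fun s k => a s ^ k) = (d.prod fun s k => a s ^ k) * a s := by
  classical
  rw [Finsupp.prod_add_index' (h := fun s k => a s ^ k) (fun _ => pow_zero _)
    (fun _ _ _ => pow_add _ _ _), Finsupp.prod_single_index (h := fun s k => a s ^ k) (pow_zero _),
    pow_one]

theorem exists_eq_add_single {σ : Type*} {d : σ →₀ ℕ} (hd : d ≠ 0) :
    ∃ (e : σ →₀ ℕ) (s : σ), d = e + Finsupp.single s 1 := by
  obtain ⟨s, hs⟩ := Finsupp.ne_iff.mp hd
  refine ⟨d - Finsupp.single s 1, s, (tsub_add_cancel_of_le ?_).symm⟩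
  rw [Finsupp.single_le_iff]
  exact Nat.one_le_iff_ne_zero.mpr hs

theorem exists_eq_single_of_degree_eq_one {σ : Type*} {d : σ →₀ ℕ} (hd : d.degree = 1) :
    ∃ s, d = Finsupp.single s 1 := by
  obtain ⟨e, s, rfl⟩ := exists_eq_add_single (d := d) (by rintro rfl; simp at hd)
  have he : e.degree = 0 := by simpa using hd
  exact ⟨s, by rw [(Finsupp.degree_eq_zero_iff e).mp he, zero_add]⟩

/-- Telescoping: replacing one factor at a time leaves a difference of order `k` times `m` further
factors of order at least 1. For monomials of degree at least 2 this gains an order, which makes the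
implicit equation a contraction. -/
theorem le_order_prod_sub_prod {σ τ : Type*} {a b : σ → MvPowerSeries τ ℂ} {k : ℕ}
    (ha : ∀ s, 1 ≤ (a s).order) (hb : ∀ s, 1 ≤ (b s).order)
    (hk : ∀ s, (k : ℕ∞) ≤ (a s - b s).order) (m : ℕ) :
    ∀ d : σ →₀ ℕ, d.degree = m + 1 →
      ((k + m : ℕ) : ℕ∞) ≤
        ((d.prod fun s k => a s ^ k) - d.prod fun s k => b s ^ k).order := by
  induction m with
  | zero =>
    intro d hd
    obtain ⟨s, rfl⟩ := exists_eq_single_of_degree_eq_one hd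
    simpa [Finsupp.prod_single_index] using hk s
  | succ m ih =>
    intro d hd
    obtain ⟨e, s, rfl⟩ := exists_eq_add_single (d := d) (by rintro rfl; simp at hd)
    have he : e.degree = m + 1 := by simpa using hd
    rw [prod_add_single, prod_add_single]
    have : ∀ p q x y : MvPowerSeries τ ℂ, p * x - q * y = (p - q) * x + q * (x - y) := by
      intros; ring
    rw [this]
    refine le_order_add_of_le (le_trans ?_ le_order_mul) (le_trans ?_ le_order_mul)
    · have := add_le_add (ih e he) (ha s)
      exact le_trans (by push_cast; rw [add_assoc]) this
    · have := add_le_add (degree_le_order_prod hb e) (hk s)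
      refine le_trans ?_ this
      rw [he]
      push_cast
      rw [add_comm]

theorem one_le_order_of_constantCoeff {σ : Type*} {f : MvPowerSeries σ ℂ}
    (h : constantCoeff f = 0) : 1 ≤ f.order :=
  one_le_order_iff_constCoeff_eq_zero.mpr h

/-- The equation `u = G(x, u)` is solved by iteration. With weight 2 on `x` and 1 on `u`, order at
least 2 excludes exactly constant terms and terms linear in `u` alone, so the iteration contracts
the order and, on small polydiscs, maps a norm ball to itself. -/
theorem exists_implicit {σ τ : Type*} [Finite σ] [Finite τ] (G : τ → MvPowerSeries (σ ⊕ τ) ℂ)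
    (hc : ∀ j, IsConvergent (G j))
    (hG : ∀ j, 2 ≤ (G j).weightedOrder (Sum.elim (fun _ => 2) (fun _ => 1))) :
    ∃ u : τ → MvPowerSeries σ ℂ, (∀ j, IsConvergent (u j)) ∧ (∀ j, constantCoeff (u j) = 0) ∧
      ∀ j, subst (Sum.elim X u) (G j) = u j := by
  cases nonempty_fintype τ
  set w : σ ⊕ τ → ℕ := Sum.elim (fun _ => 2) (fun _ => 1) with hw
  have hG' : ∀ j n, Finsupp.weight w n < 2 → coeff n (G j) = 0 := fun j n hn =>
    coeff_eq_zero_of_lt_weightedOrder w (lt_of_lt_of_le (by exact_mod_cast hn) (hG j))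
  obtain ⟨R, hR, hRG⟩ := IsConvergent.exists_radius hc
  -- Removing the constant term makes the substitution legitimate for every candidate; the solution
  -- has no constant term, so it is unaffected.
  let red : MvPowerSeries σ ℂ → MvPowerSeries σ ℂ := fun f => f - C (constantCoeff f)
  have hred0 : ∀ f, constantCoeff (red f) = 0 := fun f => by simp [red]
  have hredN : ∀ (r : σ → ℝ≥0∞) f, radiusNorm r (red f) ≤ radiusNorm r f := by
    classical
    intro r f
    refine radiusNorm_le_of_coeff r fun n => ?_
    by_cases hn : n = 0 <;> simp [red, coeff_C, hn]
  let A : (τ → MvPowerSeries σ ℂ) → σ ⊕ τ → MvPowerSeries σ ℂ :=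
    fun u => Sum.elim X fun j => red (u j)
  have hA0 : ∀ u s, constantCoeff (A u s) = 0 := by
    rintro u (i | j)
    · simp [A]
    · simpa [A] using hred0 (u j)
  have hA1 : ∀ u s, 1 ≤ (A u s).order := fun u s => one_le_order_of_constantCoeff (hA0 u s)
  have hAs : ∀ u, HasSubst (A u) := fun u => hasSubst_of_constantCoeff_zero (hA0 u)
  let M : ℝ≥0 := ∑ j, (radiusNorm (fun _ => (R : ℝ≥0∞)) (G j)).toNNReal + 1
  have hM : ∀ j, radiusNorm (fun _ => (R : ℝ≥0∞)) (G j) ≤ M := by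
    intro j
    rw [← ENNReal.coe_toNNReal (hRG j)]
    exact ENNReal.coe_le_coe.mpr ((Finset.single_le_sum_of_canonicallyOrdered
      (f := fun j => (radiusNorm _ (G j)).toNNReal) (Finset.mem_univ j)).trans
      (le_add_of_nonneg_right zero_le_one))
  have hMpos : 0 < M := by positivity
  -- With radius `t ^ 2 * R` for `x` and bound `t * R` for `u`, the series `G` has norm at most `t ^
  -- 2 * M`, and `t * M ≤ R` brings this back below `t * R`.
  let t : ℝ≥0 := min 1 (R / M)
  have ht0 : 0 < t := lt_min one_pos (div_pos hR hMpos)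
  have ht1 : t ≤ 1 := min_le_left _ _
  have htM : t * M ≤ R := (le_div_iff₀ hMpos).mp (min_le_right _ _)
  have hT : ∀ (k : ℕ) (u v : τ → MvPowerSeries σ ℂ),
      (∀ i n, n.degree < k → coeff n (u i) = coeff n (v i)) → ∀ (i : τ) (n : σ →₀ ℕ),
      n.degree < k + 1 → coeff n (subst (A u) (G i)) = coeff n (subst (A v) (G i)) := by
    intro k u v huv j n hn
    have hdiff : ∀ s, (k : ℕ∞) ≤ (A u s - A v s).order := by
      rintro (i | j)
      · simp [A]
      · refine le_order_sub_of_coeff fun n hn => ?_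
        classical
        simp only [A, Sum.elim_inr, red, map_sub, coeff_C]
        rw [huv j n hn]
        split_ifs with h0
        · rw [← coeff_zero_eq_constantCoeff_apply, ← coeff_zero_eq_constantCoeff_apply,
            huv j 0 (by rw [← h0]; exact hn)]
        · rfl
    rw [coeff_subst (hAs u), coeff_subst (hAs v)]
    refine finsum_congr fun d => ?_
    by_cases hd : coeff d (G j) = 0
    · simp [hd]
    have hd2 : 2 ≤ Finsupp.weight w d := not_lt.mp fun h => hd (hG' j d h)
    congr 1
    rcases Nat.lt_or_ge d.degree 2 with h2 | h2
    · rcases Nat.lt_or_ge d.degree 1 with h1 | h1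
      · have : d = 0 := (Finsupp.degree_eq_zero_iff d).mp (by omega)
        simp [this]
      · obtain ⟨s, rfl⟩ := exists_eq_single_of_degree_eq_one (d := d) (by omega)
        -- A linear monomial in `x` is the same for both candidates; one in `u` has weight 1 and
        -- does not occur in `G`.
        rcases s with i | j
        · simp [Finsupp.prod_single_index, A]
        · simp [Finsupp.weight_single, hw] at hd2
    · have := le_order_prod_sub_prod (hA1 u) (hA1 v) hdiff (d.degree - 1) d (by omega)
      exact coeff_eq_of_le_order_sub this (by omega)
  have hC : ∀ u : τ → MvPowerSeries σ ℂ,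
      (∀ i, radiusNorm (fun _ => ((t ^ 2 * R : ℝ≥0) : ℝ≥0∞)) (u i) ≤ ((t * R : ℝ≥0) : ℝ≥0∞)) →
      ∀ i, radiusNorm (fun _ => ((t ^ 2 * R : ℝ≥0) : ℝ≥0∞)) (subst (A u) (G i))
        ≤ ((t * R : ℝ≥0) : ℝ≥0∞) := by
    intro u hu j
    have hscale := radiusNorm_scale_le (t := (t : ℝ≥0∞)) (by exact_mod_cast ht1) w
      (fun _ => (R : ℝ≥0∞)) (hG' j)
    calc radiusNorm _ (subst (A u) (G j))
        ≤ radiusNorm (fun i => (t : ℝ≥0∞) ^ w i * R) (G j) := by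
          refine (radiusNorm_subst_le _ (hAs u) _).trans (radiusNorm_mono ?_ _)
          rintro (i | j)
          · simp [A, hw]
          · refine (hredN _ _).trans ((hu j).trans ?_)
            simp [hw]
      _ ≤ (t : ℝ≥0∞) ^ 2 * radiusNorm (fun _ => (R : ℝ≥0∞)) (G j) := hscale
      _ ≤ (t : ℝ≥0∞) ^ 2 * M := mul_le_mul_right (hM j) _
      _ ≤ ((t * R : ℝ≥0) : ℝ≥0∞) := by
          have : t ^ 2 * M ≤ t * R := by
            rw [pow_two, mul_assoc]
            exact mul_le_mul_right htM t
          exact_mod_cast this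
  obtain ⟨u, hu, huN⟩ := exists_fixedPoint (fun n => n.degree) _ _
    (fun u j => subst (A u) (G j)) hT hC
  have hu0 : ∀ j, constantCoeff (u j) = 0 := by
    intro j
    have h1 : 1 ≤ (G j).order := by
      refine one_le_order_of_constantCoeff ?_
      rw [← coeff_zero_eq_constantCoeff_apply]
      exact hG' j 0 (by simp)
    rw [← hu]
    exact constantCoeff_subst_eq_zero (hAs u) (hA0 u)
      (one_le_order_iff_constCoeff_eq_zero.mp h1)
  refine ⟨u, fun j => ?_, hu0, fun j => ?_⟩
  · refine isConvergent_of_radiusNorm (r := fun _ => ((t ^ 2 * R : ℝ≥0) : ℝ≥0∞)) (fun _ => ?_)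
      (ne_top_of_le_ne_top ENNReal.coe_ne_top (huN j))
    exact_mod_cast (by positivity : t ^ 2 * R ≠ 0)
  · have : Sum.elim X u = A u := by
      funext s
      rcases s with i | j
      · rfl
      · simp [A, red, hu0]
    rw [this]
    exact congrFun hu j
-- Since the substituted series have no constant term, their norms become smaller than a radius of
-- convergence of `f` once the radii are scaled by a small `t`.
theorem IsConvergent.subst {σ τ : Type*} [Finite σ] [Finite τ] {a : σ → MvPowerSeries τ ℂ}
    (ha : ∀ i, IsConvergent (a i)) (ha0 : ∀ i, constantCoeff (a i) = 0) {f : MvPowerSeries σ ℂ}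
    (hf : IsConvergent f) : IsConvergent (MvPowerSeries.subst a f) := by
  cases nonempty_fintype σ
  obtain ⟨R, hR, hRf⟩ := isConvergent_iff.mp hf
  obtain ⟨S, hS, hSa⟩ := IsConvergent.exists_radius ha
  let M : ℝ≥0 := ∑ j, (radiusNorm (fun _ => (S : ℝ≥0∞)) (a j)).toNNReal + 1
  have hM : ∀ j, radiusNorm (fun _ => (S : ℝ≥0∞)) (a j) ≤ M := by
    intro j
    rw [← ENNReal.coe_toNNReal (hSa j)]
    exact ENNReal.coe_le_coe.mpr ((Finset.single_le_sum_of_canonicallyOrdered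
      (f := fun j => (radiusNorm _ (a j)).toNNReal) (Finset.mem_univ j)).trans
      (le_add_of_nonneg_right zero_le_one))
  have hMpos : 0 < M := by positivity
  let t : ℝ≥0 := min 1 (R / M)
  have ht0 : 0 < t := lt_min one_pos (div_pos hR hMpos)
  have ht1 : t ≤ 1 := min_le_left _ _
  have htM : t * M ≤ R := (le_div_iff₀ hMpos).mp (min_le_right _ _)
  refine isConvergent_of_radiusNorm (r := fun _ => (t : ℝ≥0∞) ^ 1 * (S : ℝ≥0∞)) (fun _ => ?_)
    (ne_top_of_le_ne_top hRf ((radiusNorm_subst_le _ (hasSubst_of_constantCoeff_zero ha0) _).trans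
      (radiusNorm_mono (fun i => ?_) _)))
  · rw [pow_one]
    exact_mod_cast (by positivity : t * S ≠ 0)
  · refine (radiusNorm_scale_le (t := (t : ℝ≥0∞)) (by exact_mod_cast ht1) (fun _ => 1)
      (fun _ => (S : ℝ≥0∞)) (k := 1) fun n hn => ?_).trans ?_
    · have : n = 0 := by
        rw [← Finsupp.degree_eq_zero_iff, Finsupp.degree_eq_weight_one]
        exact Nat.lt_one_iff.mp hn
      rw [this, coeff_zero_eq_constantCoeff_apply, ha0]
    · rw [pow_one]
      refine (mul_le_mul_right (hM i) _).trans ?_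
      exact_mod_cast htM

end

end NewtonPolyhedron

namespace NewtonPolyhedron

noncomputable section

open MvPowerSeries
open scoped ENNReal NNReal

/-! ### Orders under substitution, and automorphisms tangent to the identity -/

theorem le_weightedOrder_sum {σ ι : Type*} (w : σ → ℕ) {k : ℕ∞} (s : Finset ι)
    {f : ι → MvPowerSeries σ ℂ} (h : ∀ i ∈ s, k ≤ (f i).weightedOrder w) :
    k ≤ (∑ i ∈ s, f i).weightedOrder w := by
  refine le_weightedOrder w fun d hd => ?_
  rw [map_sum]
  exact Finset.sum_eq_zero fun i hi => coeff_eq_zero_of_lt_weightedOrder w (hd.trans_le (h i hi))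

theorem le_weightedOrder_add_of_le {σ : Type*} (w : σ → ℕ) {k : ℕ∞} {f g : MvPowerSeries σ ℂ}
    (hf : k ≤ f.weightedOrder w) (hg : k ≤ g.weightedOrder w) :
    k ≤ (f + g).weightedOrder w :=
  (le_min hf hg).trans (min_weightedOrder_le_add w)

theorem order_le_weightedOrder {σ : Type*} (w : σ → ℕ) (hw : ∀ i, 1 ≤ w i)
    (f : MvPowerSeries σ ℂ) : f.order ≤ f.weightedOrder w := by
  refine le_weightedOrder w fun d hd => coeff_of_lt_order (lt_of_le_of_lt ?_ hd)
  rw [Finsupp.degree_apply, Finsupp.weight_apply, Finsupp.sum]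
  exact_mod_cast Finset.sum_le_sum fun i _ => Nat.le_mul_of_pos_right (d i) (hw i)

theorem order_le_order_subst {σ τ : Type*} [Finite σ] {a : σ → MvPowerSeries τ ℂ}
    (ha : ∀ i, constantCoeff (a i) = 0) (f : MvPowerSeries σ ℂ) :
    f.order ≤ (subst a f).order := by
  refine le_trans ?_ (le_order_subst (hasSubst_of_constantCoeff_zero ha) f)
  have h : (1 : ℕ∞) ≤ ⨅ i, (a i).order := le_iInf fun i => one_le_order_of_constantCoeff (ha i)
  simpa using mul_le_mul_left h f.order

theorem le_order_pderiv {σ : Type*} {k : ℕ} {f : MvPowerSeries σ ℂ} (i : σ)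
    (h : ((k + 1 : ℕ) : ℕ∞) ≤ f.order) : (k : ℕ∞) ≤ (pderiv ℂ i f).order := by
  refine nat_le_order fun d hd => ?_
  rw [coeff_pderiv, coeff_of_lt_order (lt_of_lt_of_le ?_ h), zero_mul]
  exact_mod_cast (by simpa using hd : (d + Finsupp.single i 1).degree < k + 1)

theorem subst_comp_eq {σ τ υ : Type*} [Finite σ] [Finite τ] {a : σ → MvPowerSeries τ ℂ}
    {b : τ → MvPowerSeries υ ℂ} (ha : ∀ i, constantCoeff (a i) = 0)
    (hb : ∀ i, constantCoeff (b i) = 0) (f : MvPowerSeries σ ℂ) :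
    subst b (subst a f) = subst (fun i => subst b (a i)) f :=
  subst_comp_subst_apply (hasSubst_of_constantCoeff_zero ha) (hasSubst_of_constantCoeff_zero hb) f

theorem subst_X_eq {σ : Type*} (f : MvPowerSeries σ ℂ) : subst (X : σ → MvPowerSeries σ ℂ) f = f :=
  congrFun subst_self f

/-- Substitution of convergent power series without constant term into convergent power series. -/
def convergentSubst {σ τ : Type*} [Finite σ] [Finite τ] (a : σ → MvPowerSeries τ ℂ)
    (ha : ∀ i, IsConvergent (a i)) (ha0 : ∀ i, constantCoeff (a i) = 0) :
    convergentPowerSeries σ →ₐ[ℂ] convergentPowerSeries τ :=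
  ((substAlgHom (R := ℂ) (hasSubst_of_constantCoeff_zero ha0)).comp
    (convergentPowerSeries σ).val).codRestrict (convergentPowerSeries τ) fun f => by
      rw [AlgHom.comp_apply, coe_substAlgHom]
      exact IsConvergent.subst ha ha0 f.2

theorem coe_convergentSubst {σ τ : Type*} [Finite σ] [Finite τ] (a : σ → MvPowerSeries τ ℂ)
    (ha : ∀ i, IsConvergent (a i)) (ha0 : ∀ i, constantCoeff (a i) = 0)
    (f : convergentPowerSeries σ) :
    (convergentSubst a ha ha0 f : MvPowerSeries τ ℂ) = subst a (f : MvPowerSeries σ ℂ) := by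
  simp [convergentSubst, coe_substAlgHom]

theorem exists_convergent_algEquiv {σ τ : Type*} [Finite σ] [Finite τ] {a : σ → MvPowerSeries τ ℂ}
    {b : τ → MvPowerSeries σ ℂ} (ha : ∀ i, IsConvergent (a i)) (ha0 : ∀ i, constantCoeff (a i) = 0)
    (hb : ∀ i, IsConvergent (b i)) (hb0 : ∀ i, constantCoeff (b i) = 0)
    (hab : ∀ f, subst b (subst a f) = f) (hba : ∀ f, subst a (subst b f) = f) :
    ∃ Φ : convergentPowerSeries σ ≃ₐ[ℂ] convergentPowerSeries τ,
      ∀ f, (Φ f : MvPowerSeries τ ℂ) = subst a (f : MvPowerSeries σ ℂ) := by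
  refine ⟨AlgEquiv.ofAlgHom (convergentSubst a ha ha0) (convergentSubst b hb hb0) ?_ ?_,
    coe_convergentSubst a ha ha0⟩
  · ext f : 1
    refine Subtype.ext ?_
    simp only [AlgHom.comp_apply, AlgHom.id_apply, coe_convergentSubst, hba]
  · ext f : 1
    refine Subtype.ext ?_
    simp only [AlgHom.comp_apply, AlgHom.id_apply, coe_convergentSubst, hab]

theorem constantCoeff_X_add {σ : Type*} {h : σ → MvPowerSeries σ ℂ} (ho : ∀ i, 2 ≤ (h i).order)
    (i : σ) : constantCoeff (X i + h i) = 0 := by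
  rw [map_add, constantCoeff_X, zero_add]
  exact one_le_order_iff_constCoeff_eq_zero.mp (le_trans (by norm_num) (ho i))

/-- The inverse `x + v` must satisfy `v = -h(x + v)`, an instance of `exists_implicit` because `h`
has order at least 2. -/
theorem exists_tangent_leftInverse {σ : Type*} [Finite σ] {h : σ → MvPowerSeries σ ℂ}
    (hc : ∀ i, IsConvergent (h i)) (ho : ∀ i, 2 ≤ (h i).order) :
    ∃ v : σ → MvPowerSeries σ ℂ, (∀ i, IsConvergent (v i)) ∧ (∀ i, 2 ≤ (v i).order) ∧
      ∀ f, subst (fun i => X i + v i) (subst (fun i => X i + h i) f : MvPowerSeries σ ℂ) = f := by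
  let a : σ → MvPowerSeries (σ ⊕ σ) ℂ := fun i => X (Sum.inl i) + X (Sum.inr i)
  have ha0 : ∀ i, constantCoeff (a i) = 0 := fun i => by simp [a]
  have hac : ∀ i, IsConvergent (a i) := fun i => (isConvergent_X _).add (isConvergent_X _)
  obtain ⟨v, hv1, hv2, hv3⟩ := exists_implicit (fun j => -subst a (h j))
    (fun j => (convergentPowerSeries (σ ⊕ σ)).neg_mem (IsConvergent.subst hac ha0 (hc j)))
    (fun j => by
      rw [weightedOrder_neg]
      refine le_trans ((ho j).trans (order_le_order_subst ha0 _)) (order_le_weightedOrder _ ?_ _)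
      rintro (i | i) <;> simp)
  have hb0 : ∀ s, constantCoeff (Sum.elim X v s : MvPowerSeries σ ℂ) = 0 := by
    rintro (i | i)
    · simp
    · simpa using hv2 i
  have hxv0 : ∀ i, constantCoeff (X i + v i) = 0 := fun i => by simp [hv2]
  have key : ∀ j, v j = -subst (fun i => X i + v i) (h j) := by
    intro j
    rw [← hv3 j, ← coe_substAlgHom (hasSubst_of_constantCoeff_zero hb0), map_neg,
      coe_substAlgHom, subst_comp_eq ha0 hb0]
    congr 2
    funext i
    rw [subst_add (hasSubst_of_constantCoeff_zero hb0), subst_X (hasSubst_of_constantCoeff_zero hb0),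
      subst_X (hasSubst_of_constantCoeff_zero hb0), Sum.elim_inl, Sum.elim_inr]
  refine ⟨v, hv1, fun j => ?_, fun f => ?_⟩
  · rw [key, order_neg]
    exact (ho j).trans (order_le_order_subst hxv0 _)
  · rw [subst_comp_eq (constantCoeff_X_add ho) hxv0]
    convert subst_X_eq f using 2
    funext i
    rw [← coe_substAlgHom (hasSubst_of_constantCoeff_zero hxv0), map_add, substAlgHom_X,
      coe_substAlgHom]
    have := key i
    linear_combination this

/-- The left inverse is again tangent to the identity, so it has a left inverse too; associativity
identifies the latter with the original substitution, and the inverse is two-sided. -/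
theorem exists_tangent_algEquiv {σ : Type*} [Finite σ] {h : σ → MvPowerSeries σ ℂ}
    (hc : ∀ i, IsConvergent (h i)) (ho : ∀ i, 2 ≤ (h i).order) :
    ∃ Φ : convergentPowerSeries σ ≃ₐ[ℂ] convergentPowerSeries σ,
      ∀ f, (Φ f : MvPowerSeries σ ℂ) = subst (fun i => X i + h i) (f : MvPowerSeries σ ℂ) := by
  obtain ⟨v, hvc, hvo, hv⟩ := exists_tangent_leftInverse hc ho
  obtain ⟨t, -, -, ht⟩ := exists_tangent_leftInverse hvc hvo
  have key : ∀ f : MvPowerSeries σ ℂ, subst (fun i => X i + h i) f = subst (fun i => X i + t i) f := by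
    intro f
    conv_rhs => rw [← hv f]
    rw [ht]
  exact exists_convergent_algEquiv (fun i => (isConvergent_X i).add (hc i))
    (constantCoeff_X_add ho) (fun i => (isConvergent_X i).add (hvc i)) (constantCoeff_X_add hvo) hv
    (fun f => by rw [key, ht])

/-! ### Taylor expansion and finite determinacy -/

/-- The remainder of the first order Taylor expansion of `f (x + h)`, a series in `x` and `h`. -/
def taylorRemainder {σ : Type*} [Fintype σ] (f : MvPowerSeries σ ℂ) : MvPowerSeries (σ ⊕ σ) ℂ :=
  subst (fun i => X (Sum.inl i) + X (Sum.inr i) : σ → MvPowerSeries (σ ⊕ σ) ℂ) f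
    - subst (fun i => X (Sum.inl i) : σ → MvPowerSeries (σ ⊕ σ) ℂ) f
    - ∑ i, subst (fun i => X (Sum.inl i) : σ → MvPowerSeries (σ ⊕ σ) ℂ) (pderiv ℂ i f)
      * X (Sum.inr i)

theorem hasSubst_X_add_X {σ : Type*} [Finite σ] :
    HasSubst (fun i => X (Sum.inl i) + X (Sum.inr i) : σ → MvPowerSeries (σ ⊕ σ) ℂ) :=
  hasSubst_of_constantCoeff_zero fun i => by simp

theorem hasSubst_X_inl {σ τ : Type*} [Finite σ] :
    HasSubst (fun i => X (Sum.inl i) : σ → MvPowerSeries (σ ⊕ τ) ℂ) :=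
  hasSubst_of_constantCoeff_zero fun i => by simp

theorem taylorRemainder_add {σ : Type*} [Fintype σ] (f g : MvPowerSeries σ ℂ) :
    taylorRemainder (f + g) = taylorRemainder f + taylorRemainder g := by
  simp only [taylorRemainder, ← coe_substAlgHom hasSubst_X_add_X, ← coe_substAlgHom hasSubst_X_inl,
    map_add, add_mul, Finset.sum_add_distrib]
  ring

theorem taylorRemainder_C {σ : Type*} [Fintype σ] (c : ℂ) :
    taylorRemainder (C c : MvPowerSeries σ ℂ) = 0 := by
  have h : ∀ {a : σ → MvPowerSeries (σ ⊕ σ) ℂ} (ha : HasSubst a),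
      substAlgHom (R := ℂ) ha (C c) = C c := fun ha => (substAlgHom ha).commutes c
  simp only [taylorRemainder, ← coe_substAlgHom hasSubst_X_add_X, ← coe_substAlgHom hasSubst_X_inl,
    h, pderiv_C, map_zero, zero_mul, Finset.sum_const_zero, sub_self]

/-- The Leibniz rule for remainders, which drives the induction showing that a remainder is
quadratic in the increments. -/
theorem taylorRemainder_mul_X {σ : Type*} [Fintype σ] (f : MvPowerSeries σ ℂ) (j : σ) :
    taylorRemainder (f * X j) = taylorRemainder f * (X (Sum.inl j) + X (Sum.inr j)) +
      (∑ i, subst (fun i => X (Sum.inl i) : σ → MvPowerSeries (σ ⊕ σ) ℂ) (pderiv ℂ i f)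
        * X (Sum.inr i)) * X (Sum.inr j) := by
  classical
  have h1 : ∀ i, pderiv ℂ i (f * X j) = f * (if i = j then 1 else 0) + X j * pderiv ℂ i f := by
    intro i
    rw [Derivation.leibniz, pderiv_X]
    simp [Pi.single_apply, eq_comm]
  simp only [taylorRemainder, ← coe_substAlgHom hasSubst_X_add_X, ← coe_substAlgHom hasSubst_X_inl,
    h1, map_add, map_mul, substAlgHom_X, add_mul, Finset.sum_add_distrib]
  have h2 : ∑ i, substAlgHom (R := ℂ) (hasSubst_X_inl (σ := σ) (τ := σ)) f *
      substAlgHom (R := ℂ) (hasSubst_X_inl (σ := σ) (τ := σ)) (if i = j then 1 else 0)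
        * X (Sum.inr i) = substAlgHom (R := ℂ) (hasSubst_X_inl (σ := σ) (τ := σ)) f
          * X (Sum.inr j) := by
    rw [Finset.sum_eq_single j]
    · rw [if_pos rfl, map_one, mul_one]
    · intro i _ hi
      rw [if_neg hi, map_zero, mul_zero, zero_mul]
    · exact fun h => (h (Finset.mem_univ j)).elim
  have h3 : ∑ i, X (Sum.inl j) * substAlgHom (R := ℂ) (hasSubst_X_inl (σ := σ) (τ := σ))
      (pderiv ℂ i f) * X (Sum.inr i) = X (Sum.inl j) * ∑ i, substAlgHom (R := ℂ)
        (hasSubst_X_inl (σ := σ) (τ := σ)) (pderiv ℂ i f) * X (Sum.inr i) := by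
    rw [Finset.mul_sum]
    exact Finset.sum_congr rfl fun i _ => by ring
  rw [h2, h3]
  ring

/-- For polynomials this is an induction on products with variables. A fixed coefficient of the
remainder depends only on a truncation of `f`, so the general case follows. -/
theorem le_weightedOrder_taylorRemainder {σ : Type*} [Fintype σ] (f : MvPowerSeries σ ℂ) :
    2 ≤ (taylorRemainder f).weightedOrder (Sum.elim (fun _ => 0) (fun _ => 1)) := by
  classical
  set w : σ ⊕ σ → ℕ := Sum.elim (fun _ => 0) (fun _ => 1) with hw
  have hX : ∀ i : σ, 1 ≤ (X (Sum.inr i) : MvPowerSeries (σ ⊕ σ) ℂ).weightedOrder w := by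
    intro i
    rw [X, weightedOrder_monomial_of_ne_zero _ one_ne_zero]
    simp [Finsupp.weight_single, hw]
  have hpoly : ∀ p : MvPolynomial σ ℂ,
      2 ≤ (taylorRemainder (p : MvPowerSeries σ ℂ)).weightedOrder w := by
    intro p
    induction p using MvPolynomial.induction_on with
    | C a => simp [taylorRemainder_C]
    | add p q hp hq =>
      rw [MvPolynomial.coe_add, taylorRemainder_add]
      exact le_weightedOrder_add_of_le w hp hq
    | mul_X p j hp =>
      rw [MvPolynomial.coe_mul, MvPolynomial.coe_X, taylorRemainder_mul_X]
      refine le_weightedOrder_add_of_le w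
        ((hp.trans le_self_add).trans (le_weightedOrder_mul w)) ?_
      refine le_trans ?_ (le_weightedOrder_mul w)
      have : (2 : ℕ∞) = 1 + 1 := by norm_num
      rw [this]
      refine add_le_add (le_weightedOrder_sum w _ fun i _ => ?_) (hX j)
      exact ((hX i).trans le_add_self).trans (le_weightedOrder_mul w)
  refine nat_le_weightedOrder w fun n hn => ?_
  -- Truncating at `n.degree + 2` rather than `n.degree + 1` allows for the order lost by
  -- differentiating the tail.
  obtain ⟨g, hg⟩ : ∃ g, f = (truncTotal (n.degree + 2) f : MvPolynomial σ ℂ) + g :=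
    ⟨_, (add_sub_cancel _ _).symm⟩
  have hgo : ((n.degree + 1 + 1 : ℕ) : ℕ∞) ≤ g.order := by
    refine nat_le_order fun d hd => ?_
    have h1 : coeff d g = coeff d f - coeff d (truncTotal (n.degree + 2) f : MvPowerSeries σ ℂ) := by
      rw [eq_sub_iff_add_eq, ← map_add, add_comm, ← hg]
    rw [h1, MvPolynomial.coeff_coe, coeff_truncTotal _ hd, sub_self]
  have hgo1 : ((n.degree + 1 : ℕ) : ℕ∞) ≤ g.order := le_trans (by exact_mod_cast Nat.le_succ _) hgo
  have hR : ((n.degree + 1 : ℕ) : ℕ∞) ≤ (taylorRemainder g).order := by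
    rw [taylorRemainder, sub_sub, sub_eq_add_neg]
    refine le_order_add_of_le (hgo1.trans (order_le_order_subst (fun i => by simp) _)) ?_
    rw [order_neg]
    refine le_order_add_of_le (hgo1.trans (order_le_order_subst (fun i => by simp) _)) ?_
    refine le_weightedOrder_sum _ _ fun i _ => ?_
    refine le_trans ?_ le_order_mul
    exact ((le_order_pderiv i hgo).trans (order_le_order_subst (fun i => by simp) _)).trans
      le_self_add
  rw [hg, taylorRemainder_add, map_add,
    coeff_eq_zero_of_lt_weightedOrder w (lt_of_lt_of_le (by exact_mod_cast hn) (hpoly _)),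
    coeff_of_lt_order (lt_of_lt_of_le (by exact_mod_cast Nat.lt_succ_self _) hR), add_zero]

end

end NewtonPolyhedron

namespace NewtonPolyhedron

noncomputable section

open MvPowerSeries
open scoped ENNReal NNReal

/-! ### The quadratic remainder and perturbations inside the squared Jacobian ideal -/

theorem IsConvergent.sum {σ ι : Type*} (s : Finset ι) {f : ι → MvPowerSeries σ ℂ}
    (h : ∀ i ∈ s, IsConvergent (f i)) : IsConvergent (∑ i ∈ s, f i) :=
  (convergentPowerSeries σ).sum_mem h

theorem IsConvergent.sub {σ : Type*} {f g : MvPowerSeries σ ℂ} (hf : IsConvergent f)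
    (hg : IsConvergent g) : IsConvergent (f - g) :=
  (convergentPowerSeries σ).sub_mem hf hg

theorem IsConvergent.taylorRemainder {σ : Type*} [Fintype σ] {f : MvPowerSeries σ ℂ}
    (hf : IsConvergent f) : IsConvergent (taylorRemainder f) := by
  have h1 : ∀ g : MvPowerSeries σ ℂ, IsConvergent g → IsConvergent
      (MvPowerSeries.subst (fun i => X (Sum.inl i) : σ → MvPowerSeries (σ ⊕ σ) ℂ) g) :=
    fun g hg => IsConvergent.subst (fun i => isConvergent_X _) (fun i => by simp) hg
  exact ((IsConvergent.subst (fun i => (isConvergent_X _).add (isConvergent_X _))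
    (fun i => by simp) hf).sub (h1 f hf)).sub
      (IsConvergent.sum _ fun i _ => (h1 _ (hf.pderiv i)).mul (isConvergent_X _))

theorem exists_inr_of_weight_ne_zero {σ : Type*} {n : σ ⊕ σ →₀ ℕ}
    (h : Finsupp.weight (Sum.elim (fun _ : σ => 0) (fun _ : σ => 1)) n ≠ 0) :
    ∃ i, Finsupp.single (Sum.inr i) 1 ≤ n := by
  by_contra! hn
  refine h ?_
  rw [Finsupp.weight_apply, Finsupp.sum]
  refine Finset.sum_eq_zero fun s _ => ?_
  rcases s with i | i
  · simp
  · have := hn i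
    rw [Finsupp.single_le_iff] at this
    simp only [Sum.elim_inr, smul_eq_mul, mul_one]
    omega

/-- Weight at least 2 in the increments means that every monomial is divisible by a product of two
of them, and division by monomials preserves convergence. -/
theorem exists_taylorRemainder_eq {σ : Type*} [Fintype σ] {f : MvPowerSeries σ ℂ}
    (hf : IsConvergent f) : ∃ R : σ × σ → MvPowerSeries (σ ⊕ σ) ℂ, (∀ p, IsConvergent (R p)) ∧
      taylorRemainder f = ∑ p : σ × σ, X (Sum.inr p.1) * X (Sum.inr p.2) * R p := by
  have hdvd : ∀ n, coeff n (taylorRemainder f) ≠ 0 → ∃ p : σ × σ,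
      Finsupp.single (Sum.inr p.1 : σ ⊕ σ) 1 + Finsupp.single (Sum.inr p.2) 1 ≤ n := by
    intro n hn
    set w : σ ⊕ σ → ℕ := Sum.elim (fun _ => 0) (fun _ => 1) with hw
    have h2 : 2 ≤ Finsupp.weight w n := by
      by_contra h
      refine hn (coeff_eq_zero_of_lt_weightedOrder w
        (lt_of_lt_of_le ?_ (le_weightedOrder_taylorRemainder f)))
      exact_mod_cast not_le.mp h
    obtain ⟨i, hi⟩ := exists_inr_of_weight_ne_zero (n := n) (by rw [← hw]; omega)
    have h3 : Finsupp.weight w n = Finsupp.weight w (n - Finsupp.single (Sum.inr i) 1) + 1 := by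
      conv_lhs => rw [← tsub_add_cancel_of_le hi]
      simp [Finsupp.weight_single, hw]
    obtain ⟨j, hj⟩ := exists_inr_of_weight_ne_zero (n := n - Finsupp.single (Sum.inr i) 1)
      (by rw [← hw]; omega)
    exact ⟨(j, i), (le_tsub_iff_right hi).mp hj⟩
  obtain ⟨R, h1, h2⟩ := exists_sum_monomial_mul
    (fun p : σ × σ => Finsupp.single (Sum.inr p.1 : σ ⊕ σ) 1 + Finsupp.single (Sum.inr p.2) 1)
    (taylorRemainder f) hdvd
  refine ⟨R, fun p => hf.taylorRemainder.of_shift (h2 p), h1.trans ?_⟩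
  refine Finset.sum_congr rfl fun p _ => ?_
  rw [X, X, monomial_mul_monomial, one_mul]

theorem subst_X_add_eq_taylor {σ : Type*} [Fintype σ] {f : MvPowerSeries σ ℂ}
    {h : σ → MvPowerSeries σ ℂ} (h0 : ∀ i, constantCoeff (h i) = 0) :
    subst (fun i => X i + h i) f =
      f + ∑ i, pderiv ℂ i f * h i + subst (Sum.elim X h) (taylorRemainder f) := by
  have hb0 : ∀ s, constantCoeff (Sum.elim X h s : MvPowerSeries σ ℂ) = 0 := by
    rintro (i | i)
    · simp
    · simpa using h0 i
  have hb := hasSubst_of_constantCoeff_zero hb0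
  have hinl : ∀ g : MvPowerSeries σ ℂ, subst (Sum.elim X h)
      (subst (fun i => X (Sum.inl i) : σ → MvPowerSeries (σ ⊕ σ) ℂ) g) = g := by
    intro g
    rw [subst_comp_eq (fun i => by simp) hb0]
    convert subst_X_eq g using 2
    funext i
    rw [subst_X hb, Sum.elim_inl]
  have hadd : subst (Sum.elim X h)
      (subst (fun i => X (Sum.inl i) + X (Sum.inr i) : σ → MvPowerSeries (σ ⊕ σ) ℂ) f) =
        subst (fun i => X i + h i) f := by
    rw [subst_comp_eq (fun i => by simp) hb0]
    congr 1
    funext i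
    rw [subst_add hb, subst_X hb, subst_X hb, Sum.elim_inl, Sum.elim_inr]
  rw [taylorRemainder, subst_sub hb, subst_sub hb, hinl, hadd]
  have hsum : subst (Sum.elim X h) (∑ i, subst
      (fun i => X (Sum.inl i) : σ → MvPowerSeries (σ ⊕ σ) ℂ) (pderiv ℂ i f) * X (Sum.inr i)) =
        ∑ i, pderiv ℂ i f * h i := by
    rw [← coe_substAlgHom hb, map_sum]
    refine Finset.sum_congr rfl fun i _ => ?_
    rw [coe_substAlgHom, subst_mul hb, hinl, subst_X hb, Sum.elim_inr]
  rw [hsum]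
  ring

/-- Perturbing `f` by an element of `𝔪² J(f)²` does not change its right equivalence class. -/
theorem exists_algEquiv_add_sum {σ : Type*} [Fintype σ] (f : convergentPowerSeries σ)
    {m : σ × σ → MvPowerSeries σ ℂ} (hm : ∀ p, IsConvergent (m p)) (hmo : ∀ p, 2 ≤ (m p).order) :
    ∃ Φ : convergentPowerSeries σ ≃ₐ[ℂ] convergentPowerSeries σ,
      (Φ f : MvPowerSeries σ ℂ) = f + ∑ p : σ × σ, pderiv ℂ p.1 (f : MvPowerSeries σ ℂ) *
        pderiv ℂ p.2 (f : MvPowerSeries σ ℂ) * m p := by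
  obtain ⟨f, hf⟩ := f
  replace hf : IsConvergent f := hf
  obtain ⟨R, hR, hRf⟩ := exists_taylorRemainder_eq hf
  let ι : MvPowerSeries σ ℂ → MvPowerSeries (σ ⊕ σ × σ) ℂ :=
    subst (fun i => X (Sum.inl i) : σ → MvPowerSeries (σ ⊕ σ × σ) ℂ)
  have hι : ∀ g, IsConvergent g → IsConvergent (ι g) := fun g hg =>
    IsConvergent.subst (fun i => isConvergent_X _) (fun i => by simp) hg
  -- The increments are sought in the form `h_i = ∑ f_j * u_ij`, where `f_j` is the `j`-th partial
  -- derivative; the unknown `u_ij` are extra variables. Both the linear and the quadratic Taylor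
  -- terms then become combinations of the products `f_i * f_j`.
  let H : σ → MvPowerSeries (σ ⊕ σ × σ) ℂ := fun i => ∑ j, ι (pderiv ℂ j f) * X (Sum.inr (i, j))
  have hHc : ∀ i, IsConvergent (H i) := fun i =>
    IsConvergent.sum _ fun j _ => (hι _ (hf.pderiv j)).mul (isConvergent_X _)
  let b : σ ⊕ σ → MvPowerSeries (σ ⊕ σ × σ) ℂ := Sum.elim (fun i => X (Sum.inl i)) H
  have hb0 : ∀ s, constantCoeff (b s) = 0 := by
    rintro (i | i)
    · simp [b]
    · simp [b, H]
  have hbc : ∀ s, IsConvergent (b s) := by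
    rintro (i | i)
    · exact isConvergent_X _
    · exact hHc i
  let w : σ ⊕ σ × σ → ℕ := Sum.elim (fun _ => 2) (fun _ => 1)
  have hw1 : ∀ s, 1 ≤ w s := by rintro (i | i) <;> simp [w]
  have hX : ∀ p : σ × σ, 1 ≤ (X (Sum.inr p) : MvPowerSeries (σ ⊕ σ × σ) ℂ).weightedOrder w := by
    intro i
    rw [X, weightedOrder_monomial_of_ne_zero _ one_ne_zero]
    simp [Finsupp.weight_single, w]
  -- Comparing the coefficients of `f_i * f_j` in the Taylor expansion leads to `u_q = m_q - ∑
  -- u_(p.1, q.1) * u_(p.2, q.2) * R_p(x, h)`. The correction is quadratic in `u`, and `m_q` has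
  -- order at least 2.
  obtain ⟨u, huc, hu0, hu⟩ := exists_implicit (fun q : σ × σ => ι (m q) - ∑ p : σ × σ,
      X (Sum.inr (p.1, q.1)) * X (Sum.inr (p.2, q.2)) * subst b (R p))
    (fun q => (hι _ (hm q)).sub (IsConvergent.sum _ fun p _ =>
      ((isConvergent_X _).mul (isConvergent_X _)).mul (IsConvergent.subst hbc hb0 (hR p))))
    (fun q => by
      rw [sub_eq_add_neg]
      refine le_weightedOrder_add_of_le w ?_ ?_
      · exact ((hmo q).trans (order_le_order_subst (fun i => by simp) _)).trans
          (order_le_weightedOrder w hw1 _)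
      · rw [weightedOrder_neg]
        refine le_weightedOrder_sum w _ fun p _ => ?_
        refine le_trans ?_ ((le_self_add).trans (le_weightedOrder_mul w))
        refine le_trans ?_ (le_weightedOrder_mul w)
        have : (2 : ℕ∞) = 1 + 1 := by norm_num
        rw [this]
        exact add_le_add (hX _) (hX _))
  have hc0 : ∀ s, constantCoeff (Sum.elim X u s : MvPowerSeries σ ℂ) = 0 := by
    rintro (i | i)
    · simp
    · simpa using hu0 i
  have hc := hasSubst_of_constantCoeff_zero hc0
  let h : σ → MvPowerSeries σ ℂ := fun i => ∑ j, pderiv ℂ j f * u (i, j)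
  have hιc : ∀ g : MvPowerSeries σ ℂ, subst (Sum.elim X u) (ι g) = g := by
    intro g
    rw [subst_comp_eq (fun i => by simp) hc0]
    convert subst_X_eq g using 2
    funext i
    rw [subst_X hc, Sum.elim_inl]
  have hH : ∀ i, subst (Sum.elim X u) (H i) = h i := by
    intro i
    simp only [H, h]
    rw [← coe_substAlgHom hc, map_sum]
    refine Finset.sum_congr rfl fun j _ => ?_
    rw [coe_substAlgHom, subst_mul hc, hιc, subst_X hc, Sum.elim_inr]
  have hbcomp : ∀ g : MvPowerSeries (σ ⊕ σ) ℂ, subst (Sum.elim X u) (subst b g) = subst (Sum.elim X h) g := by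
    intro g
    rw [subst_comp_eq hb0 hc0]
    congr 1
    funext s
    rcases s with i | i
    · simp only [b, Sum.elim_inl]
      rw [subst_X hc, Sum.elim_inl]
    · exact hH i
  have hu' : ∀ q : σ × σ, u q = m q - ∑ p : σ × σ, u (p.1, q.1) * u (p.2, q.2) *
      subst (Sum.elim X h) (R p) := by
    intro q
    rw [← hu q, subst_sub hc, hιc]
    congr 1
    rw [← coe_substAlgHom hc, map_sum]
    refine Finset.sum_congr rfl fun p _ => ?_
    rw [coe_substAlgHom, subst_mul hc, subst_mul hc, hbcomp, subst_X hc, subst_X hc, Sum.elim_inr,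
      Sum.elim_inr]
  have hu1 : ∀ q, 1 ≤ (u q).order := fun q => one_le_order_of_constantCoeff (hu0 q)
  have huo : ∀ q, 2 ≤ (u q).order := by
    intro q
    rw [hu', sub_eq_add_neg]
    refine le_order_add_of_le (hmo q) ?_
    rw [order_neg]
    refine le_weightedOrder_sum _ _ fun p _ => ?_
    refine le_trans ?_ ((le_self_add).trans le_order_mul)
    refine le_trans ?_ le_order_mul
    have : (2 : ℕ∞) = 1 + 1 := by norm_num
    rw [this]
    exact add_le_add (hu1 _) (hu1 _)
  have hho : ∀ i, 2 ≤ (h i).order := fun i => le_weightedOrder_sum _ _ fun j _ =>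
    ((huo (i, j)).trans le_add_self).trans le_order_mul
  have hhc : ∀ i, IsConvergent (h i) := fun i =>
    IsConvergent.sum _ fun j _ => (hf.pderiv j).mul (huc _)
  have hh0 : ∀ i, constantCoeff (h i) = 0 := fun i =>
    one_le_order_iff_constCoeff_eq_zero.mp (le_trans (by norm_num) (hho i))
  have hd0 : ∀ s, constantCoeff (Sum.elim X h s : MvPowerSeries σ ℂ) = 0 := by
    rintro (i | i)
    · simp
    · simpa using hh0 i
  have hd := hasSubst_of_constantCoeff_zero hd0
  obtain ⟨Φ, hΦ⟩ := exists_tangent_algEquiv hhc hho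
  refine ⟨Φ, ?_⟩
  rw [hΦ, subst_X_add_eq_taylor hh0, add_assoc]
  congr 1
  have h1 : subst (Sum.elim X h) (taylorRemainder f) = ∑ q : σ × σ, pderiv ℂ q.1 f *
      pderiv ℂ q.2 f * ∑ p : σ × σ, u (p.1, q.1) * u (p.2, q.2) * subst (Sum.elim X h) (R p) := by
    rw [hRf, ← coe_substAlgHom hd, map_sum]
    simp_rw [Finset.mul_sum]
    rw [Finset.sum_comm]
    refine Finset.sum_congr rfl fun p _ => ?_
    rw [coe_substAlgHom, subst_mul hd, subst_mul hd, subst_X hd, subst_X hd, Sum.elim_inr,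
      Sum.elim_inr, Finset.sum_mul_sum, ← Finset.sum_product', Finset.univ_product_univ,
      Finset.sum_mul]
    exact Finset.sum_congr rfl fun q _ => by ring
  have h2 : ∑ i, pderiv ℂ i f * h i = ∑ q : σ × σ, pderiv ℂ q.1 f * pderiv ℂ q.2 f * u q := by
    rw [← Finset.univ_product_univ, Finset.sum_product]
    refine Finset.sum_congr rfl fun i _ => ?_
    simp only [h]
    rw [Finset.mul_sum]
    exact Finset.sum_congr rfl fun j _ => by ring
  rw [h1, h2, ← Finset.sum_add_distrib]
  refine Finset.sum_congr rfl fun q _ => ?_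
  have := hu' q
  linear_combination (pderiv ℂ q.1 f * pderiv ℂ q.2 f) * this

/-- A convergent power series whose Jacobian ideal contains powers of all the variables is finitely
determined. -/
theorem exists_determinacy {σ : Type*} [Fintype σ] (f : convergentPowerSeries σ) (K : ℕ)
    (α : σ → σ → MvPowerSeries σ ℂ) (hα : ∀ i j, IsConvergent (α i j))
    (hJ : ∀ i, (X i : MvPowerSeries σ ℂ) ^ K = ∑ j, α i j * pderiv ℂ j (f : MvPowerSeries σ ℂ)) :
    ∃ N, ∀ q : convergentPowerSeries σ, (∀ n : σ →₀ ℕ, n.degree ≤ N →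
      coeff n (q : MvPowerSeries σ ℂ) = coeff n (f : MvPowerSeries σ ℂ)) →
        RightEquivalent f q := by
  -- A monomial of degree above `card σ * (2 * K)` has an exponent at least `2 * K`; the additional
  -- `2 * K + 2` leaves order at least 2 after division by that power.
  refine ⟨Fintype.card σ * (2 * K) + 2 * K + 2, fun q hq => ?_⟩
  set r : MvPowerSeries σ ℂ := q - f with hr
  have hrc : IsConvergent r := IsConvergent.sub q.2 f.2
  have hr0 : ∀ n : σ →₀ ℕ, n.degree ≤ Fintype.card σ * (2 * K) + 2 * K + 2 → coeff n r = 0 := by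
    intro n hn
    rw [hr, map_sub, hq n hn, sub_self]
  have hdvd : ∀ n, coeff n r ≠ 0 → ∃ i : σ, Finsupp.single i (2 * K) ≤ n := by
    intro n hn
    by_contra! h
    refine hn (hr0 n ?_)
    have h1 : n.degree ≤ Fintype.card σ * (2 * K) := by
      rw [Finsupp.degree_eq_sum, ← smul_eq_mul, ← Finset.card_univ, ← Finset.sum_const]
      refine Finset.sum_le_sum fun i _ => ?_
      have := h i
      rw [Finsupp.single_le_iff] at this
      omega
    omega
  obtain ⟨A, hA1, hA2⟩ := exists_sum_monomial_mul (fun i : σ => Finsupp.single i (2 * K)) r hdvd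
  have hAc : ∀ i, IsConvergent (A i) := fun i => hrc.of_shift (hA2 i)
  have hAo : ∀ i, 2 ≤ (A i).order := by
    intro i
    refine nat_le_order (n := 2) fun d hd => ?_
    rcases hA2 i d with h | h
    · exact h
    · rw [h, hr0]
      rw [map_add, Finsupp.degree_single]
      omega
  obtain ⟨Φ, hΦ⟩ := exists_algEquiv_add_sum f
    (m := fun p => ∑ i, α i p.1 * α i p.2 * A i)
    (fun p => IsConvergent.sum _ fun i _ => ((hα _ _).mul (hα _ _)).mul (hAc i))
    (fun p => le_weightedOrder_sum _ _ fun i _ => ((hAo i).trans le_add_self).trans le_order_mul)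
  refine ⟨Φ, Subtype.ext ?_⟩
  rw [hΦ]
  suffices h : ∑ p : σ × σ, pderiv ℂ p.1 (f : MvPowerSeries σ ℂ) *
      pderiv ℂ p.2 (f : MvPowerSeries σ ℂ) * ∑ i, α i p.1 * α i p.2 * A i = r by
    rw [h, hr, add_sub_cancel]
  conv_rhs => rw [hA1]
  simp_rw [Finset.mul_sum]
  rw [Finset.sum_comm]
  refine Finset.sum_congr rfl fun i _ => ?_
  -- Splitting `x_i ^ (2 * K)` as a square and inserting the Jacobian expression for `x_i ^ K` in
  -- both factors puts the perturbation into the squared Jacobian ideal.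
  have h1 : monomial (Finsupp.single i (2 * K)) (1 : ℂ) = (X i ^ K) * (X i ^ K) := by
    rw [← pow_add, ← two_mul, X_pow_eq]
  rw [h1, hJ, Finset.sum_mul_sum, ← Finset.sum_product', Finset.univ_product_univ,
    Finset.sum_mul]
  exact Finset.sum_congr rfl fun q _ => by ring

end

end NewtonPolyhedron

namespace NewtonPolyhedron

noncomputable section

open MvPowerSeries
open scoped ENNReal NNReal

/-! ### Values of convergent power series -/

theorem enorm_monomialValue {σ : Type*} (z : σ → ℂ) (n : σ →₀ ℕ) :
    ‖monomialValue z n‖ₑ = radiusMonomial (fun i => ‖z i‖ₑ) n := by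
  simp only [monomialValue, radiusMonomial, Finsupp.prod]
  rw [← ofReal_norm, norm_prod, ENNReal.ofReal_prod_of_nonneg fun _ _ => norm_nonneg _]
  exact Finset.prod_congr rfl fun i _ => by rw [ofReal_norm, enorm_pow]

theorem norm_monomialValue_le {σ : Type*} [Fintype σ] {ρ : ℝ≥0} {z : σ → ℂ} (hz : ‖z‖ ≤ ρ)
    (n : σ →₀ ℕ) : ‖monomialValue z n‖ ≤ (ρ : ℝ) ^ n.degree := by
  have h : ‖monomialValue z n‖ₑ ≤ ((ρ ^ n.degree : ℝ≥0) : ℝ≥0∞) := by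
    rw [enorm_monomialValue, ENNReal.coe_pow, ← radiusMonomial_const]
    refine radiusMonomial_mono (fun i => ?_) n
    have := (norm_le_pi_norm z i).trans hz
    exact_mod_cast this
  exact_mod_cast h

theorem summable_of_radiusNorm {σ : Type*} {ρ : ℝ≥0} {f : MvPowerSeries σ ℂ}
    (h : radiusNorm (fun _ => (ρ : ℝ≥0∞)) f ≠ ⊤) :
    Summable fun n : σ →₀ ℕ => ‖coeff n f‖ * (ρ : ℝ) ^ n.degree := by
  have h1 : radiusNorm (fun _ => (ρ : ℝ≥0∞)) f =
      ∑' n : σ →₀ ℕ, ((‖coeff n f‖₊ * ρ ^ n.degree : ℝ≥0) : ℝ≥0∞) := by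
    refine tsum_congr fun n => ?_
    rw [radiusMonomial_const]
    push_cast
    rfl
  rw [h1, ENNReal.tsum_coe_ne_top_iff_summable, ← NNReal.summable_coe] at h
  simpa using h

theorem continuousOn_evalAt {σ : Type*} [Fintype σ] {ρ : ℝ≥0} {f : MvPowerSeries σ ℂ}
    (h : radiusNorm (fun _ => (ρ : ℝ≥0∞)) f ≠ ⊤) :
    ContinuousOn (evalAt f) {z | ‖z‖ ≤ ρ} := by
  refine continuousOn_tsum (fun n => ?_) (summable_of_radiusNorm h) fun n z hz => ?_
  · refine Continuous.continuousOn (continuous_const.mul ?_)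
    unfold monomialValue Finsupp.prod
    fun_prop
  · rw [norm_mul]
    exact mul_le_mul_of_nonneg_left (norm_monomialValue_le hz n) (norm_nonneg _)

theorem evalAt_mul {σ : Type*} {f g : MvPowerSeries σ ℂ} {z : σ → ℂ}
    (hf : Summable fun n : σ →₀ ℕ => ‖coeff n f * monomialValue z n‖)
    (hg : Summable fun n : σ →₀ ℕ => ‖coeff n g * monomialValue z n‖) :
    evalAt (f * g) z = evalAt f z * evalAt g z := by
  classical
  have hfg := summable_mul_of_summable_norm hf hg
  have h := Summable.tsum_mul_tsum_eq_tsum_sum_antidiagonal hf.of_norm hg.of_norm hfg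
  rw [evalAt, evalAt, evalAt, h]
  refine tsum_congr fun n => ?_
  rw [coeff_mul, Finset.sum_mul]
  refine Finset.sum_congr rfl fun p hp => ?_
  rw [← Finset.HasAntidiagonal.mem_antidiagonal.mp hp, monomialValue_add]
  ring

theorem evalAt_zero {σ : Type*} (f : MvPowerSeries σ ℂ) : evalAt f 0 = constantCoeff f := by
  rw [evalAt, tsum_eq_single 0]
  · simp [monomialValue]
  · intro n hn
    obtain ⟨i, hi⟩ := Finsupp.ne_iff.mp hn
    have : monomialValue (0 : σ → ℂ) n = 0 :=
      Finset.prod_eq_zero (Finsupp.mem_support_iff.mpr hi) (zero_pow (M₀ := ℂ) hi)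
    rw [this, mul_zero]

theorem differentiableOn_evalAt_slice {ρ : ℝ≥0} {f : MvPowerSeries (Fin 2) ℂ}
    (h : radiusNorm (fun _ => (ρ : ℝ≥0∞)) f ≠ ⊤) {x : ℂ} (hx : ‖x‖ ≤ ρ) :
    DifferentiableOn ℂ (fun y => evalAt f ![x, y]) (Metric.ball 0 ρ) := by
  refine Complex.differentiableOn_tsum_of_summable_norm (summable_of_radiusNorm h) (fun n => ?_)
    Metric.isOpen_ball fun n y hy => ?_
  · have : (fun y => coeff n f * monomialValue ![x, y] n) =
        fun y => coeff n f * (x ^ n 0 * y ^ n 1) := by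
      funext y
      rw [monomialValue, Finsupp.prod_fintype _ _ (fun i => pow_zero _), Fin.prod_univ_two]
      rfl
    rw [this]
    fun_prop
  · rw [norm_mul]
    refine mul_le_mul_of_nonneg_left (norm_monomialValue_le ?_ n) (norm_nonneg _)
    refine (pi_norm_le_iff_of_nonneg ρ.2).mpr fun i => ?_
    fin_cases i
    · exact hx
    · simpa using (mem_ball_zero_iff.mp hy).le

/-- In two variables, the zero set of a convergent non-unit has no isolated points. -/
theorem not_eventually_evalAt_ne_zero {f : MvPowerSeries (Fin 2) ℂ} (hf : IsConvergent f)
    (h0 : constantCoeff f = 0) : ¬ ∀ᶠ z : Fin 2 → ℂ in 𝓝[≠] 0, evalAt f z ≠ 0 := by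
  intro hne
  obtain ⟨ρ, hρ, hN⟩ := isConvergent_iff.mp hf
  rw [eventually_nhdsWithin_iff, Metric.eventually_nhds_iff_ball] at hne
  obtain ⟨δ, hδ, hne⟩ := hne
  obtain ⟨ε, hε, hεδ⟩ : ∃ ε : ℝ, 0 < ε ∧ ε < min δ ρ :=
    exists_between (lt_min hδ (by exact_mod_cast hρ))
  have hεδ' := hεδ.trans_le (min_le_left _ _)
  have hερ := hεδ.trans_le (min_le_right _ _)
  have hnorm : ∀ x y : ℂ, ‖x‖ ≤ ε → ‖y‖ ≤ ε → ‖![x, y]‖ ≤ ε := fun x y hx hy => by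
    refine (pi_norm_le_iff_of_nonneg hε.le).mpr fun i => ?_
    fin_cases i
    · exact hx
    · exact hy
  have hnz : ∀ x y : ℂ, ‖x‖ ≤ ε → ‖y‖ ≤ ε → (x ≠ 0 ∨ y ≠ 0) → evalAt f ![x, y] ≠ 0 := by
    intro x y hx hy hxy
    refine hne _ (mem_ball_zero_iff.mpr ((hnorm x y hx hy).trans_lt hεδ')) ?_
    intro h
    have h1 := congrFun h 0
    have h2 := congrFun h 1
    rcases hxy with h3 | h3
    · exact h3 h1
    · exact h3 h2
  have hcont : ContinuousOn (evalAt f) {z | ‖z‖ ≤ ρ} := continuousOn_evalAt hN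
  have hpair : Continuous fun p : ℂ × ℂ => (![p.1, p.2] : Fin 2 → ℂ) := by
    refine continuous_pi fun i => ?_
    fin_cases i
    · exact continuous_fst
    · exact continuous_snd
  have hcont2 : ContinuousOn (fun p : ℂ × ℂ => evalAt f ![p.1, p.2])
      (Metric.closedBall 0 ε ×ˢ Metric.closedBall 0 ε) := by
    refine hcont.comp hpair.continuousOn fun p hp => ?_
    rw [Set.mem_prod, mem_closedBall_zero_iff, mem_closedBall_zero_iff] at hp
    exact (hnorm _ _ hp.1 hp.2).trans hερ.le
  have hK : IsCompact (Metric.closedBall (0 : ℂ) ε ×ˢ Metric.sphere (0 : ℂ) ε) :=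
    (isCompact_closedBall _ _).prod (isCompact_sphere _ _)
  have hKne : (Metric.closedBall (0 : ℂ) ε ×ˢ Metric.sphere (0 : ℂ) ε).Nonempty :=
    ⟨(0, (ε : ℂ)), by simp [hε.le, abs_of_pos hε]⟩
  obtain ⟨p, hpK, hp⟩ := hK.exists_isMinOn hKne
    ((hcont2.mono (Set.prod_mono_right Metric.sphere_subset_closedBall)).norm)
  -- The minimum of `|f|` over `|x| ≤ ε`, `|y| = ε`, positive because the origin is the only
  -- possible zero nearby.
  set m := ‖evalAt f ![p.1, p.2]‖ with hm
  have hmpos : 0 < m := by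
    rw [Set.mem_prod, mem_closedBall_zero_iff, mem_sphere_zero_iff_norm] at hpK
    refine norm_pos_iff.mpr (hnz _ _ hpK.1 hpK.2.le (Or.inr ?_))
    rw [← norm_pos_iff, hpK.2]
    exact hε
  -- For `x ≠ 0` the slice `f(x, ·)` has no zero on the closed disc, so the maximum principle
  -- applies to its reciprocal and bounds `|f(x, 0)|` below by `m`.
  have hlow : ∀ x : ℂ, x ≠ 0 → ‖x‖ ≤ ε → m ≤ ‖evalAt f ![x, 0]‖ := by
    intro x hx0 hx
    have hd : DiffContOnCl ℂ (fun y => (evalAt f ![x, y])⁻¹) (Metric.ball 0 ε) := by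
      refine DifferentiableOn.diffContOnCl_ball (U := Metric.closedBall 0 ε) ?_ le_rfl
      refine DifferentiableOn.inv ((differentiableOn_evalAt_slice hN (hx.trans hερ.le)).mono
        (Metric.closedBall_subset_ball hερ)) fun y hy => ?_
      exact hnz x y hx (mem_closedBall_zero_iff.mp hy) (Or.inl hx0)
    have h1 := Complex.norm_le_of_forall_mem_frontier_norm_le (C := m⁻¹) Metric.isBounded_ball hd
      (fun y hy => by
        rw [frontier_ball _ hε.ne'] at hy
        rw [norm_inv]
        refine inv_anti₀ hmpos ?_
        exact isMinOn_iff.mp hp (x, y) (Set.mk_mem_prod (mem_closedBall_zero_iff.mpr hx) hy))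
      (subset_closure (Metric.mem_ball_self hε))
    rw [norm_inv] at h1
    exact (inv_le_inv₀ (norm_pos_iff.mpr (hnz x 0 hx (by simpa using hε.le) (Or.inl hx0)))
      hmpos).mp h1
  have hc0 : ContinuousAt (fun x : ℂ => evalAt f ![x, 0]) 0 := by
    have h1 : ContinuousAt (evalAt f) ![0, 0] := by
      refine hcont.continuousAt ?_
      filter_upwards [Metric.closedBall_mem_nhds ![0, 0] (show (0 : ℝ) < ρ by exact_mod_cast hρ)]
        with z hz
      have : (![0, 0] : Fin 2 → ℂ) = 0 := by ext i; fin_cases i <;> rfl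
      rw [this] at hz
      exact mem_closedBall_zero_iff.mp hz
    exact ContinuousAt.comp (f := fun x : ℂ => ![x, 0]) h1
      (hpair.comp (continuous_id.prodMk continuous_const)).continuousAt
  have hv0 : evalAt f ![0, 0] = 0 := by
    have : (![0, 0] : Fin 2 → ℂ) = 0 := by ext i; fin_cases i <;> rfl
    rw [this, evalAt_zero, h0]
  -- Continuity and `f(0, 0) = 0` contradict the uniform lower bound.
  have hlt : ∀ᶠ x : ℂ in 𝓝 0, ‖evalAt f ![x, 0]‖ < m := by
    have h1 := hc0.norm
    have h2 : ‖evalAt f ![0, 0]‖ < m := by rw [hv0, norm_zero]; exact hmpos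
    exact h1.eventually_lt_const h2
  have hsmall : ∀ᶠ x : ℂ in 𝓝 0, ‖x‖ ≤ ε := by
    filter_upwards [Metric.closedBall_mem_nhds (0 : ℂ) hε] with x hx
    exact mem_closedBall_zero_iff.mp hx
  obtain ⟨x, ⟨h1, h2⟩, h3⟩ := (((hlt.and hsmall).filter_mono nhdsWithin_le_nhds).and
    (self_mem_nhdsWithin (a := (0 : ℂ)) (s := {0}ᶜ))).exists
  exact absurd (hlow x h3 h2) (not_le.mpr h1)

/-- Near the origin, every zero of a common factor `h` of `f` and its partial derivatives is a
singular point of `f = 0`. If `h` vanished at the origin, the origin would be an isolated zero of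
`h`, which is impossible in two variables. -/
theorem eventually_evalAt_ne_zero_of_isolated {f : convergentPowerSeries (Fin 2)}
    (hf : DefinesIsolatedSingularity f) {h : MvPowerSeries (Fin 2) ℂ} (hh : IsConvergent h)
    {a : MvPowerSeries (Fin 2) ℂ} (ha : IsConvergent a)
    (hfa : (f : MvPowerSeries (Fin 2) ℂ) = h * a) {b : Fin 2 → MvPowerSeries (Fin 2) ℂ}
    (hb : ∀ i, IsConvergent (b i))
    (hfb : ∀ i, pderiv ℂ i (f : MvPowerSeries (Fin 2) ℂ) = h * b i) :
    constantCoeff h ≠ 0 := by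
  intro h0
  refine not_eventually_evalAt_ne_zero hh h0 ?_
  have hb' : ∀ᶠ z : Fin 2 → ℂ in 𝓝 0, ∀ i, Summable fun n : Fin 2 →₀ ℕ =>
      ‖coeff n (b i) * monomialValue z n‖ := eventually_all.mpr hb
  filter_upwards [hf.2, hh.filter_mono nhdsWithin_le_nhds, ha.filter_mono nhdsWithin_le_nhds,
    hb'.filter_mono nhdsWithin_le_nhds] with z h1 h2 h3 h4 h5
  refine h1 ⟨?_, fun i => ?_⟩
  · rw [hfa, evalAt_mul h2 h3, h5, zero_mul]
  · rw [hfb, evalAt_mul h2 (h4 i), h5, zero_mul]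

end

end NewtonPolyhedron

namespace NewtonPolyhedron

noncomputable section

open MvPowerSeries
open scoped ENNReal NNReal

/-! ### Units and the Weierstrass division theorem -/

/-- After scaling, `f` is `1 + g` with `g` vanishing at 0; its inverse `1 + u` is found from `u = -g
* (1 + u)`. -/
theorem IsConvergent.exists_mul_eq_one {σ : Type*} [Finite σ] {f : MvPowerSeries σ ℂ}
    (hf : IsConvergent f) (h0 : constantCoeff f ≠ 0) : ∃ g, IsConvergent g ∧ f * g = 1 := by
  set c := constantCoeff f with hc
  let g : MvPowerSeries σ ℂ := C c⁻¹ * f - 1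
  have hg0 : constantCoeff g = 0 := by simp [g, ← hc, h0]
  have hgc : IsConvergent g := ((isConvergent_C _).mul hf).sub (convergentPowerSeries σ).one_mem
  let ι : MvPowerSeries σ ℂ → MvPowerSeries (σ ⊕ Unit) ℂ :=
    MvPowerSeries.subst (fun i => X (Sum.inl i) : σ → MvPowerSeries (σ ⊕ Unit) ℂ)
  have hι : IsConvergent (ι g) :=
    IsConvergent.subst (fun i => isConvergent_X _) (fun i => by simp) hgc
  set w : σ ⊕ Unit → ℕ := Sum.elim (fun _ => 2) (fun _ => 1) with hw
  have hιo : 2 ≤ (ι g).weightedOrder w := by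
    refine le_trans (le_iInf₂ fun d hd => ?_) (le_weightedOrder_subst w hasSubst_X_inl g)
    obtain ⟨e, s, rfl⟩ := exists_eq_add_single (d := d) (by
      rintro rfl
      exact hd hg0)
    rw [map_add, Finsupp.weight_single]
    refine le_trans ?_ le_add_self
    simp only [Function.comp_apply]
    rw [X, weightedOrder_monomial_of_ne_zero _ one_ne_zero]
    simp [Finsupp.weight_single, hw]
  obtain ⟨u, hu1, hu0', hu2⟩ := exists_implicit (fun _ : Unit => -(ι g * (1 + X (Sum.inr ()))))
    (fun _ => (convergentPowerSeries _).neg_mem (hι.mul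
      (IsConvergent.add (convergentPowerSeries _).one_mem (isConvergent_X _))))
    (fun _ => by
      rw [weightedOrder_neg]
      exact (hιo.trans le_self_add).trans (le_weightedOrder_mul w))
  have hu0 : constantCoeff (u ()) = 0 := hu0' ()
  have hb0 : ∀ s, constantCoeff (Sum.elim X u s : MvPowerSeries σ ℂ) = 0 := by
    rintro (i | i)
    · simp
    · exact hu0
  have hb := hasSubst_of_constantCoeff_zero hb0
  have key : u () = -(g * (1 + u ())) := by
    conv_lhs => rw [← hu2 ()]
    rw [← coe_substAlgHom hb, map_neg, map_mul, map_add, map_one, substAlgHom_X, coe_substAlgHom,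
      subst_comp_eq (fun i => by simp) hb0, Sum.elim_inr]
    congr 2
    convert subst_X_eq g using 2
    funext i
    rw [subst_X hb, Sum.elim_inl]
  refine ⟨C c⁻¹ * (1 + u ()), (isConvergent_C _).mul
    (IsConvergent.add (convergentPowerSeries _).one_mem (hu1 _)), ?_⟩
  simp only [g] at key
  linear_combination key

/-- The weight for which the weight of `x ^ i * y ^ j` is `i`. -/
def xWeight : Fin 2 → ℕ := ![1, 0]

theorem weight_fin_two (w : Fin 2 → ℕ) (n : Fin 2 →₀ ℕ) :
    Finsupp.weight w n = n 0 * w 0 + n 1 * w 1 := by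
  rw [Finsupp.weight_apply, Finsupp.sum_fintype _ _ (fun i => by simp), Fin.sum_univ_two]
  simp

@[simp] theorem weight_xWeight (n : Fin 2 →₀ ℕ) : Finsupp.weight xWeight n = n 0 := by
  simp [weight_fin_two, xWeight]

theorem fin_two_ext {m n : Fin 2 →₀ ℕ} (h0 : m 0 = n 0) (h1 : m 1 = n 1) : m = n := by
  ext i
  fin_cases i
  · exact h0
  · exact h1

/-- The quotient of a series by `y ^ d`, discarding the terms not divisible by `y ^ d`. -/
def yQuotient (d : ℕ) (f : MvPowerSeries (Fin 2) ℂ) : MvPowerSeries (Fin 2) ℂ :=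
  ofCoeff fun n => coeff (n + Finsupp.single 1 d) f

@[simp] theorem coeff_yQuotient (d : ℕ) (f : MvPowerSeries (Fin 2) ℂ) (n : Fin 2 →₀ ℕ) :
    coeff n (yQuotient d f) = coeff (n + Finsupp.single 1 d) f := rfl

theorem IsConvergent.yQuotient {f : MvPowerSeries (Fin 2) ℂ} (hf : IsConvergent f) (d : ℕ) :
    IsConvergent (yQuotient d f) :=
  hf.of_shift fun _ => Or.inr rfl

theorem yQuotient_add (d : ℕ) (f g : MvPowerSeries (Fin 2) ℂ) :
    yQuotient d (f + g) = yQuotient d f + yQuotient d g := by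
  ext n; simp

theorem yQuotient_sub (d : ℕ) (f g : MvPowerSeries (Fin 2) ℂ) :
    yQuotient d (f - g) = yQuotient d f - yQuotient d g := by
  ext n; simp

theorem yQuotient_X_pow_mul (d : ℕ) (f : MvPowerSeries (Fin 2) ℂ) :
    yQuotient d (X 1 ^ d * f) = f := by
  ext n
  rw [coeff_yQuotient, X_pow_eq, add_comm, coeff_add_monomial_mul, one_mul]

theorem weightedOrder_le_yQuotient (d : ℕ) (f : MvPowerSeries (Fin 2) ℂ) :
    f.weightedOrder xWeight ≤ (yQuotient d f).weightedOrder xWeight := by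
  refine le_weightedOrder xWeight fun n hn => ?_
  rw [coeff_yQuotient]
  refine coeff_eq_zero_of_lt_weightedOrder xWeight ?_
  simpa using hn

/-- The core of Weierstrass division as a fixed point problem. Multiplication by `B`, which is
divisible by `x`, raises the `x`-order, so the iteration converges coefficientwise. -/
theorem exists_eq_yQuotient_sub {B g : MvPowerSeries (Fin 2) ℂ} (hB : IsConvergent B)
    (hBo : 1 ≤ B.weightedOrder xWeight) (hg : IsConvergent g) (d : ℕ) :
    ∃ Q, IsConvergent Q ∧ Q = yQuotient d g - yQuotient d (Q * B) := by
  obtain ⟨R, hR, hRN⟩ := IsConvergent.exists_radius (f := ![B, g]) (fun i => by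
    fin_cases i
    · exact hB
    · exact hg)
  have hRB : radiusNorm (fun _ => (R : ℝ≥0∞)) B ≠ ⊤ := hRN 0
  have hRg : radiusNorm (fun _ => (R : ℝ≥0∞)) g ≠ ⊤ := hRN 1
  set b : ℝ≥0 := (radiusNorm (fun _ => (R : ℝ≥0∞)) B).toNNReal + 1 with hb
  have hbB : radiusNorm (fun _ => (R : ℝ≥0∞)) B ≤ b := by
    rw [← ENNReal.coe_toNNReal hRB]
    exact ENNReal.coe_le_coe.mpr (le_add_of_nonneg_right zero_le_one)
  have hbpos : 0 < b := by positivity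
  -- Only the `x`-radius is shrunk, by `t`: then `B` has norm at most `t * b`, while division by `y
  -- ^ d` costs `R ^ d`. The choice makes `Q ↦ yQuotient d (Q * B)` at most halve norms, hence the
  -- ball of radius `2 * ‖yQuotient d g‖`.
  let t : ℝ≥0 := min 1 (R ^ d / (2 * b))
  have ht0 : 0 < t := lt_min one_pos (div_pos (pow_pos hR d) (by positivity))
  have ht1 : t ≤ 1 := min_le_left _ _
  have htb : t * (2 * b) ≤ R ^ d := (le_div_iff₀ (by positivity)).mp (min_le_right _ _)
  let r : Fin 2 → ℝ≥0∞ := fun i => (t : ℝ≥0∞) ^ xWeight i * R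
  have hr1 : r 1 = R := by simp [r, xWeight]
  have hr0 : ∀ i, r i ≠ 0 := by
    intro i
    exact mul_ne_zero (pow_ne_zero _ (by exact_mod_cast ht0.ne')) (by exact_mod_cast hR.ne')
  have hrR : ∀ i, r i ≤ R := fun i => by
    have : (t : ℝ≥0∞) ^ xWeight i ≤ 1 := pow_le_one' (by exact_mod_cast ht1) _
    simpa using mul_le_mul_left this (R : ℝ≥0∞)
  have hrB : radiusNorm r B ≤ t * b := by
    refine (radiusNorm_scale_le (by exact_mod_cast ht1) xWeight (fun _ => (R : ℝ≥0∞)) (k := 1)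
      fun n hn => coeff_eq_zero_of_lt_weightedOrder xWeight
        (lt_of_lt_of_le (by exact_mod_cast hn) hBo)).trans ?_
    rw [pow_one]
    exact mul_le_mul_right hbB _
  have hRd0 : (R : ℝ≥0∞) ^ d ≠ 0 := pow_ne_zero _ (by exact_mod_cast hR.ne')
  have hRdt : (R : ℝ≥0∞) ^ d ≠ ⊤ := ENNReal.pow_ne_top ENNReal.coe_ne_top
  have hq : ∀ f, radiusNorm r (yQuotient d f) * (R : ℝ≥0∞) ^ d ≤ radiusNorm r f := by
    intro f
    have := radiusNorm_shift_mul_le r (Finsupp.single 1 d) (f := f) (g := yQuotient d f)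
      fun n => le_rfl
    rwa [radiusMonomial_single, hr1] at this
  have hG : radiusNorm r (yQuotient d g) ≠ ⊤ := by
    intro h
    have h1 := (hq g).trans (radiusNorm_mono hrR g)
    rw [h, ENNReal.top_mul hRd0] at h1
    exact hRg (top_le_iff.mp h1)
  obtain ⟨Q, hQ, hQN⟩ := exists_fixedPoint (fun n : Fin 2 →₀ ℕ => n 0) r
    (fun _ : Unit => 2 * radiusNorm r (yQuotient d g))
    (fun u _ => yQuotient d g - yQuotient d (u () * B))
    (fun k u v huv _ n hn => by
      have h1 : (k : ℕ∞) ≤ (u () - v ()).weightedOrder xWeight :=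
        nat_le_weightedOrder xWeight fun m hm => by
          rw [map_sub, huv () m (by simpa using hm), sub_self]
      have h2 : ((k + 1 : ℕ) : ℕ∞) ≤ (yQuotient d ((u () - v ()) * B)).weightedOrder xWeight := by
        refine le_trans ?_ (weightedOrder_le_yQuotient d _)
        refine le_trans ?_ (le_weightedOrder_mul xWeight)
        push_cast
        exact add_le_add h1 hBo
      have h3 := coeff_eq_zero_of_lt_weightedOrder xWeight (d := n)
        (lt_of_lt_of_le (by simpa using (by exact_mod_cast hn : (n 0 : ℕ∞) < (k + 1 : ℕ))) h2)
      rw [sub_mul, yQuotient_sub, map_sub, sub_eq_zero] at h3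
      rw [map_sub, map_sub, h3])
    (fun u hu _ => by
      refine (radiusNorm_sub_le r _ _).trans ?_
      rw [two_mul]
      refine add_le_add le_rfl ?_
      rw [← ENNReal.mul_le_mul_iff_left hRd0 hRdt]
      refine (hq _).trans ((radiusNorm_mul_le r _ _).trans ?_)
      refine (mul_le_mul' (hu ()) hrB).trans ?_
      calc 2 * radiusNorm r (yQuotient d g) * (t * b)
          = radiusNorm r (yQuotient d g) * ((t * (2 * b) : ℝ≥0) : ℝ≥0∞) := by
            push_cast; ring
        _ ≤ _ := by
            refine mul_le_mul_right ?_ _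
            exact_mod_cast htb)
  refine ⟨Q (), isConvergent_of_radiusNorm hr0 (ne_top_of_le_ne_top
    (ENNReal.mul_ne_top (by norm_num) hG) (hQN ())), (congrFun hQ ()).symm⟩

/-- `f` is regular of order `d` in `y`: the series `f (0, y)` has order `d`. -/
def IsYRegular (f : MvPowerSeries (Fin 2) ℂ) (d : ℕ) : Prop :=
  (∀ j < d, coeff (Finsupp.single 1 j) f = 0) ∧ coeff (Finsupp.single 1 d) f ≠ 0

/-- The part of `P` divisible by `y ^ d` is `y ^ d` times a unit, and by regularity every remaining
term involves `x`. Multiplying by the inverse unit turns `P` into `y ^ d` plus a multiple of `x`. -/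
theorem IsYRegular.exists_decomposition {P : MvPowerSeries (Fin 2) ℂ} {d : ℕ}
    (hP : IsYRegular P d) (hc : IsConvergent P) :
    ∃ U V B : MvPowerSeries (Fin 2) ℂ, IsConvergent U ∧ IsConvergent B ∧ U * V = 1 ∧
      1 ≤ B.weightedOrder xWeight ∧ U * P = X 1 ^ d + B := by
  obtain ⟨U, hU, hUV⟩ := (hc.yQuotient d).exists_mul_eq_one (by
    rw [← coeff_zero_eq_constantCoeff_apply, coeff_yQuotient, zero_add]
    exact hP.2)
  have hlow : 1 ≤ (P - X 1 ^ d * yQuotient d P).weightedOrder xWeight := by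
    refine nat_le_weightedOrder (n := 1) xWeight fun n hn => ?_
    rw [weight_xWeight, Nat.lt_one_iff] at hn
    rw [map_sub, X_pow_eq, coeff_monomial_mul]
    split_ifs with h
    · rw [one_mul, coeff_yQuotient, tsub_add_cancel_of_le h, sub_self]
    · rw [Finsupp.single_le_iff, not_le] at h
      have : n = Finsupp.single 1 (n 1) := fin_two_ext (by simpa using hn) (by simp)
      rw [this, hP.1 _ h, sub_zero]
  refine ⟨U, yQuotient d P, U * (P - X 1 ^ d * yQuotient d P), hU, hU.mul (hc.sub
    (((convergentPowerSeries _).pow_mem (isConvergent_X 1) d).mul (hc.yQuotient d))),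
    by rw [mul_comm, hUV], ?_, ?_⟩
  · exact (hlow.trans le_add_self).trans (le_weightedOrder_mul xWeight)
  · linear_combination (X 1 ^ d) * hUV

/-- Weierstrass division for convergent power series in two variables. -/
theorem IsYRegular.exists_division {P g : MvPowerSeries (Fin 2) ℂ} {d : ℕ}
    (hP : IsYRegular P d) (hc : IsConvergent P) (hg : IsConvergent g) :
    ∃ q r, IsConvergent q ∧ IsConvergent r ∧ g = q * P + r ∧ yQuotient d r = 0 := by
  obtain ⟨U, V, B, hU, hB, -, hBo, hUP⟩ := hP.exists_decomposition hc
  obtain ⟨Q, hQ, hQe⟩ := exists_eq_yQuotient_sub hB hBo hg d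
  refine ⟨Q * U, g - Q * U * P, hQ.mul hU, hg.sub ((hQ.mul hU).mul hc), by ring, ?_⟩
  have h1 : g - Q * U * P = g - Q * B - X 1 ^ d * Q := by
    rw [mul_assoc, hUP]; ring
  rw [h1, yQuotient_sub, yQuotient_sub, yQuotient_X_pow_mul, ← hQe, sub_self]

/-- Uniqueness in Weierstrass division: the hypothesis expresses `q * V` through its product with
`B`, so a non-zero `q * V` would have an `x`-order exceeding itself. -/
theorem IsYRegular.eq_zero_of_yQuotient_mul {P q : MvPowerSeries (Fin 2) ℂ} {d : ℕ}
    (hP : IsYRegular P d) (hc : IsConvergent P) (h : yQuotient d (q * P) = 0) : q = 0 := by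
  obtain ⟨U, V, B, hU, hB, hUV, hBo, hUP⟩ := hP.exists_decomposition hc
  have h1 : q * P = X 1 ^ d * (q * V) + q * V * B := by
    linear_combination (q * V) * hUP - q * P * hUV
  rw [h1, yQuotient_add, yQuotient_X_pow_mul] at h
  have h2 : q * V = -yQuotient d (q * V * B) := eq_neg_of_add_eq_zero_left h
  have h3 : q * V = 0 := by
    by_contra hne
    have h4 : (q * V).weightedOrder xWeight + 1 ≤ (q * V).weightedOrder xWeight := by
      conv_rhs => rw [h2, weightedOrder_neg]
      refine le_trans ?_ (weightedOrder_le_yQuotient d _)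
      exact (add_le_add le_rfl hBo).trans (le_weightedOrder_mul xWeight)
    have h5 := (ne_zero_iff_weightedOrder_finite xWeight).mp hne
    rw [← h5] at h4
    have h6 : ((q * V).weightedOrder xWeight).toNat + 1 ≤
      ((q * V).weightedOrder xWeight).toNat := by exact_mod_cast h4
    omega
  calc q = q * V * U := by linear_combination (-q) * hUV
    _ = 0 := by rw [h3, zero_mul]

end

end NewtonPolyhedron

namespace NewtonPolyhedron

noncomputable section

open MvPowerSeries

/-! ### Convergent power series in the first variable -/

theorem pderiv_comm {σ : Type*} (i j : σ) (f : MvPowerSeries σ ℂ) :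
    pderiv ℂ i (pderiv ℂ j f) = pderiv ℂ j (pderiv ℂ i f) := by
  classical
  ext n
  simp only [coeff_pderiv, Finsupp.add_apply, Finsupp.single_apply]
  rcases eq_or_ne i j with rfl | h
  · rfl
  · rw [if_neg h, if_neg h.symm, add_right_comm]
    push_cast
    ring

/-- The algebra of convergent power series not involving the second variable. -/
def xSeries : Subalgebra ℂ (MvPowerSeries (Fin 2) ℂ) where
  carrier := {f | IsConvergent f ∧ pderiv ℂ 1 f = 0}
  add_mem' := fun {f g} hf hg => ⟨hf.1.add hg.1, by rw [map_add, hf.2, hg.2, add_zero]⟩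
  mul_mem' := fun {f g} hf hg => ⟨hf.1.mul hg.1, by
    rw [Derivation.leibniz, hf.2, hg.2, smul_zero, smul_zero, add_zero]⟩
  algebraMap_mem' := fun c => ⟨isConvergent_C c, pderiv_C⟩

theorem mem_xSeries {f : MvPowerSeries (Fin 2) ℂ} :
    f ∈ xSeries ↔ IsConvergent f ∧ pderiv ℂ 1 f = 0 := Iff.rfl

theorem mem_xSeries_iff {f : MvPowerSeries (Fin 2) ℂ} :
    f ∈ xSeries ↔ IsConvergent f ∧ ∀ n : Fin 2 →₀ ℕ, n 1 ≠ 0 → coeff n f = 0 := by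
  rw [mem_xSeries]
  refine and_congr_right fun _ => ?_
  constructor
  · intro h n hn
    have h1 : Finsupp.single 1 1 ≤ n := by
      rw [Finsupp.single_le_iff]; omega
    have h2 := congrArg (coeff (n - Finsupp.single 1 1)) h
    rw [coeff_pderiv, tsub_add_cancel_of_le h1] at h2
    exact (mul_eq_zero.mp h2).resolve_right (Nat.cast_add_one_ne_zero _)
  · intro h
    ext n
    rw [coeff_pderiv, h _ (by simp), zero_mul]
    rfl

/-- An additive map satisfying the Leibniz rule, as a derivation over `ℤ`. -/
def intDerivation {R : Type*} [CommRing R] (D : R →+ R)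
    (h : ∀ a b, D (a * b) = a • D b + b • D a) : Derivation ℤ R R :=
  Derivation.mk' D.toIntLinearMap h

/-- The derivation `d / dx` on convergent power series in `x`. -/
instance : Differential xSeries where
  deriv := intDerivation
    { toFun := fun f => ⟨pderiv ℂ 0 (f : MvPowerSeries (Fin 2) ℂ), f.2.1.pderiv 0, by
        rw [pderiv_comm, f.2.2, map_zero]⟩
      map_zero' := Subtype.ext (map_zero _)
      map_add' := fun f g => Subtype.ext (map_add _ _ _) }
    fun f g => Subtype.ext (Derivation.leibniz _ _ _)

theorem eq_algebraMap_of_deriv_eq_zero (f : xSeries) (h : Differential.deriv f = 0) :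
    ∃ c : ℂ, f = algebraMap ℂ xSeries c := by
  refine ⟨constantCoeff (f : MvPowerSeries (Fin 2) ℂ), Subtype.ext ?_⟩
  refine pderiv.ext (fun i => ?_) (constantCoeff_C _).symm
  have h2 : pderiv ℂ i (((algebraMap ℂ xSeries (constantCoeff (f : MvPowerSeries (Fin 2) ℂ)) :
      xSeries) : MvPowerSeries (Fin 2) ℂ)) = 0 := pderiv_C
  rw [h2]
  fin_cases i
  · exact congrArg (fun g : xSeries => (g : MvPowerSeries (Fin 2) ℂ)) h
  · exact f.2.2

/-- The constant coefficient of a convergent power series in `x`. -/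
def xConstantCoeff : xSeries →+* ℂ :=
  (constantCoeff (σ := Fin 2) (R := ℂ)).comp
    (xSeries.val : xSeries →+* MvPowerSeries (Fin 2) ℂ)

theorem xConstantCoeff_apply (f : xSeries) : xConstantCoeff f =
    constantCoeff (f : MvPowerSeries (Fin 2) ℂ) := rfl

/-- The variable `x`. -/
def xVar : xSeries := ⟨X 0, isConvergent_X 0, pderiv_X_of_ne (by decide)⟩

theorem isUnit_xSeries_iff {f : xSeries} : IsUnit f ↔ xConstantCoeff f ≠ 0 := by
  constructor
  · intro h
    exact (h.map xConstantCoeff).ne_zero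
  · intro h
    obtain ⟨g, hg, hfg⟩ := IsConvergent.exists_mul_eq_one f.2.1 h
    have h0 : pderiv ℂ 1 g = 0 := by
      have h1 := congrArg (pderiv ℂ 1) hfg
      rw [Derivation.leibniz, f.2.2, smul_zero, add_zero, Derivation.map_one_eq_zero,
        smul_eq_mul] at h1
      calc pderiv ℂ 1 g = (f * g) * pderiv ℂ 1 g := by rw [hfg, one_mul]
        _ = g * (f * pderiv ℂ 1 g) := by ring
        _ = 0 := by rw [h1, mul_zero]
    exact IsUnit.of_mul_eq_one ⟨g, hg, h0⟩ (Subtype.ext hfg)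

theorem exists_eq_xVar_pow_mul {f : xSeries} (hf : f ≠ 0) :
    ∃ (k : ℕ) (u : xSeries), xConstantCoeff u ≠ 0 ∧ f = xVar ^ k * u := by
  classical
  set F : MvPowerSeries (Fin 2) ℂ := (f : MvPowerSeries (Fin 2) ℂ) with hF
  have hF1 := (mem_xSeries_iff.mp f.2).2
  have hex : ∃ k, coeff (Finsupp.single 0 k) F ≠ 0 := by
    by_contra! h
    refine hf (Subtype.ext ?_)
    ext n
    by_cases hn : n 1 = 0
    · have : n = Finsupp.single 0 (n 0) := fin_two_ext (by simp) (by simpa using hn)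
      rw [this]
      exact h _
    · exact hF1 n hn
  let k := Nat.find hex
  have hk : coeff (Finsupp.single 0 k) F ≠ 0 := Nat.find_spec hex
  have hkmin : ∀ j < k, coeff (Finsupp.single 0 j) F = 0 := fun j hj =>
    not_not.mp (Nat.find_min hex hj)
  let u : MvPowerSeries (Fin 2) ℂ := ofCoeff fun n => coeff (n + Finsupp.single 0 k) F
  have hu : IsConvergent u := IsConvergent.of_shift (f := F) f.2.1 fun n => Or.inr rfl
  have hux : u ∈ xSeries := by
    rw [mem_xSeries_iff]
    refine ⟨hu, fun n hn => ?_⟩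
    exact hF1 _ (by simpa using hn)
  refine ⟨k, ⟨u, hux⟩, ?_, Subtype.ext ?_⟩
  · rw [xConstantCoeff_apply, ← coeff_zero_eq_constantCoeff_apply]
    change coeff (0 + Finsupp.single 0 k) F ≠ 0
    rwa [zero_add]
  · change F = X 0 ^ k * u
    ext n
    rw [X_pow_eq, coeff_monomial_mul]
    split_ifs with h
    · rw [one_mul]
      change _ = coeff (n - Finsupp.single 0 k + Finsupp.single 0 k) F
      rw [tsub_add_cancel_of_le h]
    · rw [Finsupp.single_le_iff, not_le] at h
      by_cases hn : n 1 = 0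
      · have : n = Finsupp.single 0 (n 0) := fin_two_ext (by simp) (by simpa using hn)
        rw [this]
        exact hkmin _ h
      · exact hF1 n hn

theorem irreducible_xVar : Irreducible xVar := by
  have hx : xConstantCoeff xVar = 0 := constantCoeff_X 0
  refine ⟨fun h => isUnit_xSeries_iff.mp h hx, fun {a b} hab => ?_⟩
  by_contra! h
  rw [isUnit_xSeries_iff, isUnit_xSeries_iff, not_not, not_not] at h
  have h1 : ((xVar : xSeries) : MvPowerSeries (Fin 2) ℂ) =
      ((a : xSeries) : MvPowerSeries (Fin 2) ℂ) *
        ((b : xSeries) : MvPowerSeries (Fin 2) ℂ) := by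
    rw [hab]; rfl
  have h2 : (2 : ℕ∞) ≤ (X 0 : MvPowerSeries (Fin 2) ℂ).order := by
    change (2 : ℕ∞) ≤ ((xVar : xSeries) : MvPowerSeries (Fin 2) ℂ).order
    rw [h1]
    refine le_trans ?_ le_order_mul
    have : (2 : ℕ∞) = 1 + 1 := by norm_num
    rw [this]
    exact add_le_add (one_le_order_of_constantCoeff h.1) (one_le_order_of_constantCoeff h.2)
  rw [X, order_monomial_of_ne_zero one_ne_zero] at h2
  simp at h2

instance : IsDomain xSeries := NoZeroDivisors.to_isDomain _

/-- This supplies both arithmetic inputs used below: integral closedness, for minimal polynomials,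
and factorisation of polynomials in `y` into primes. -/
instance : IsDiscreteValuationRing xSeries :=
  IsDiscreteValuationRing.ofHasUnitMulPowIrreducibleFactorization
    ⟨xVar, irreducible_xVar, fun {f} hf => by
      obtain ⟨k, u, hu, h⟩ := exists_eq_xVar_pow_mul hf
      exact ⟨k, (isUnit_xSeries_iff.mpr hu).unit, by rw [h]; rfl⟩⟩

/-! ### Polynomials in `y` with coefficients power series in `x` -/

/-- A polynomial in `y` over the convergent power series in `x`, as a power series. -/
def polyToSeries : Polynomial xSeries →ₐ[xSeries] MvPowerSeries (Fin 2) ℂ :=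
  Polynomial.aeval (X 1)

theorem coeff_polyToSeries (p : Polynomial xSeries) (n : Fin 2 →₀ ℕ) :
    coeff n (polyToSeries p) =
      coeff (Finsupp.single 0 (n 0))
        ((p.coeff (n 1) : xSeries) : MvPowerSeries (Fin 2) ℂ) := by
  induction p using Polynomial.induction_on' with
  | add p q hp hq =>
    rw [map_add, Polynomial.coeff_add]
    simpa using congrArg₂ (· + ·) hp hq
  | monomial k a =>
    have h : polyToSeries (Polynomial.monomial k a) =
        X 1 ^ k * ((a : xSeries) : MvPowerSeries (Fin 2) ℂ) := by
      rw [polyToSeries, Polynomial.aeval_monomial, mul_comm]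
      rfl
    rw [h, X_pow_eq, coeff_monomial_mul, Polynomial.coeff_monomial, one_mul]
    have ha := (mem_xSeries_iff.mp a.2).2
    rcases lt_trichotomy (n 1) k with hn | hn | hn
    · rw [if_neg (by rw [Finsupp.single_le_iff]; omega), if_neg (by omega)]
      rfl
    · rw [if_pos (by rw [Finsupp.single_le_iff]; omega), if_pos hn.symm]
      congr 2
      exact fin_two_ext (by simp) (by simp [hn])
    · rw [if_pos (by rw [Finsupp.single_le_iff]; omega), if_neg (by omega), ha]
      · rfl
      · simp only [Finsupp.tsub_apply, Finsupp.single_eq_same]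
        omega

theorem polyToSeries_injective : Function.Injective polyToSeries := by
  rw [injective_iff_map_eq_zero]
  intro p hp
  ext j : 1
  refine Subtype.ext ?_
  ext n
  by_cases hn : n 1 = 0
  · have h1 : coeff (Finsupp.single 0 (n 0) + Finsupp.single 1 j)
        (polyToSeries p) = 0 := by rw [hp]; rfl
    rw [coeff_polyToSeries] at h1
    have : n = Finsupp.single 0 (n 0) := fin_two_ext (by simp) (by simpa using hn)
    rw [this]
    simpa using h1
  · rw [(mem_xSeries_iff.mp (p.coeff j).2).2 n hn]
    rfl

theorem yQuotient_polyToSeries {p : Polynomial xSeries} {d : ℕ} (hp : p.degree < d) :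
    yQuotient d (polyToSeries p) = 0 := by
  ext n
  rw [coeff_yQuotient, coeff_polyToSeries, Polynomial.coeff_eq_zero_of_degree_lt]
  · rfl
  · refine lt_of_lt_of_le hp ?_
    rw [Finsupp.add_apply, Finsupp.single_eq_same]
    exact_mod_cast Nat.le_add_left d (n 1)

/-- Only the powers `y ^ j` with `j < d` survive, and their coefficients are convergent as shifts of
parts of `r`. Remainders of Weierstrass division thus become polynomials. -/
theorem exists_polyToSeries_eq {r : MvPowerSeries (Fin 2) ℂ} {d : ℕ} (hrc : IsConvergent r)
    (hr : yQuotient d r = 0) :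
    ∃ p : Polynomial xSeries, p.degree < d ∧ polyToSeries p = r := by
  classical
  let a : ℕ → MvPowerSeries (Fin 2) ℂ := fun j => ofCoeff fun n =>
    if n 1 = 0 then coeff (n + Finsupp.single 1 j) r else 0
  have hac : ∀ j, IsConvergent (a j) := fun j =>
    IsConvergent.of_shift (f := r) (m := Finsupp.single 1 j) hrc
      fun n => by
        simp only [a, coeff_ofCoeff]
        split_ifs
        · exact Or.inr rfl
        · exact Or.inl rfl
  let A : ℕ → xSeries := fun j => ⟨a j, by
    rw [mem_xSeries_iff]
    refine ⟨hac j, fun n hn => ?_⟩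
    simp only [a, coeff_ofCoeff, if_neg hn]⟩
  have hcoeff : ∀ j, (∑ i ∈ Finset.range d, Polynomial.monomial i (A i)).coeff j =
      if j < d then A j else 0 := by
    intro j
    simp [Polynomial.finsetSum_coeff, Polynomial.coeff_monomial]
  refine ⟨∑ i ∈ Finset.range d, Polynomial.monomial i (A i), ?_, ?_⟩
  · rw [Polynomial.degree_lt_iff_coeff_zero]
    intro m hm
    rw [hcoeff, if_neg (by omega)]
  · ext n
    rw [coeff_polyToSeries, hcoeff]
    split_ifs with h
    · change (if (Finsupp.single (0 : Fin 2) (n 0)) 1 = 0 then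
        coeff (Finsupp.single 0 (n 0) + Finsupp.single 1 (n 1)) r
          else 0) = _
      rw [if_pos (by simp)]
      congr 1
      exact congrArg _ (fin_two_ext (by simp) (by simp))
    · have h1 := congrArg (coeff (n - Finsupp.single 1 d)) hr
      rw [coeff_yQuotient, tsub_add_cancel_of_le (by rw [Finsupp.single_le_iff]; omega)] at h1
      rw [h1]
      rfl

theorem isConvergent_polyToSeries (p : Polynomial xSeries) : IsConvergent (polyToSeries p) := by
  rw [polyToSeries, Polynomial.aeval_eq_sum_range]
  refine IsConvergent.sum _ fun i _ => ?_
  rw [Algebra.smul_def]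
  exact (p.coeff i).2.1.mul ((convergentPowerSeries (Fin 2)).pow_mem (isConvergent_X 1) i)

theorem pderiv_one_polyToSeries (p : Polynomial xSeries) :
    pderiv ℂ 1 (polyToSeries p) = polyToSeries (Polynomial.derivative p) := by
  induction p using Polynomial.induction_on' with
  | add p q hp hq => rw [map_add, map_add, map_add, map_add, hp, hq]
  | monomial k a =>
    have hy : pderiv ℂ 1 (X 1 : MvPowerSeries (Fin 2) ℂ) = 1 := pderiv_X_self
    have ha : pderiv ℂ 1 (algebraMap xSeries (MvPowerSeries (Fin 2) ℂ) a) = 0 :=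
      a.2.2
    rw [Polynomial.derivative_monomial, polyToSeries, Polynomial.aeval_monomial,
      Polynomial.aeval_monomial, Derivation.leibniz, Derivation.leibniz_pow, hy, ha, map_mul,
      map_natCast]
    simp only [smul_eq_mul, nsmul_eq_mul]
    ring

theorem pderiv_zero_polyToSeries (p : Polynomial xSeries) :
    pderiv ℂ 0 (polyToSeries p) = polyToSeries (Differential.mapCoeffs p) := by
  induction p using Polynomial.induction_on' with
  | add p q hp hq => rw [map_add, map_add, map_add, map_add, hp, hq]
  | monomial k a =>
    have hy : pderiv ℂ 0 (X 1 : MvPowerSeries (Fin 2) ℂ) = 0 := pderiv_X_of_ne (by decide)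
    have ha : pderiv ℂ 0 (algebraMap xSeries (MvPowerSeries (Fin 2) ℂ) a) =
      algebraMap xSeries (MvPowerSeries (Fin 2) ℂ) (Differential.deriv a) := rfl
    rw [Differential.mapCoeffs_monomial, polyToSeries, Polynomial.aeval_monomial,
      Polynomial.aeval_monomial, Derivation.leibniz, Derivation.leibniz_pow, hy, ha]
    simp only [smul_eq_mul, nsmul_eq_mul]
    ring

end

end NewtonPolyhedron

namespace NewtonPolyhedron

noncomputable section

open MvPowerSeries

/-! ### First integrals of monic primes over differential rings -/

section FirstIntegral

open Polynomial (aeval derivative)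

variable {O : Type*} [CommRing O] [Differential O]

/-- The chain rule: differentiate the coefficients of `m`, then the argument `S`. -/
theorem mapCoeffs_aeval (m S : Polynomial O) :
    Differential.mapCoeffs (aeval S m) =
      aeval S (Differential.mapCoeffs m) + aeval S (derivative m) * Differential.mapCoeffs S := by
  induction m using Polynomial.induction_on' with
  | add p q hp hq => simp only [map_add, hp, hq]; ring
  | monomial k a =>
    rw [Differential.mapCoeffs_monomial, Polynomial.derivative_monomial, Polynomial.aeval_monomial,
      Polynomial.aeval_monomial, Polynomial.aeval_monomial, Derivation.leibniz,
      Derivation.leibniz_pow, Polynomial.algebraMap_eq, Differential.mapCoeffs_C,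
      map_mul, Polynomial.C_eq_natCast]
    simp only [smul_eq_mul, nsmul_eq_mul]
    ring

/-- Algebraic form of the fact that a function whose differential is proportional to `dh` along the
irreducible curve `h = 0` is constant there. The residue of `S` modulo `h` is integral over `O`, and
its minimal polynomial turns out to have constant coefficients. -/
theorem dvd_sub_C_of_dvd_bracket [IsDomain O] [IsIntegrallyClosed O] [CharZero O]
    {k : Type*} [Field k] [IsAlgClosed k] [Algebra k O]
    (hk : ∀ a : O, Differential.deriv a = 0 → ∃ c, a = algebraMap k O c)
    {h S : Polynomial O} (hp : Prime h) (hm : h.Monic) (hd : 0 < h.natDegree)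
    (hS : h ∣ Differential.mapCoeffs S * derivative h - derivative S * Differential.mapCoeffs h) :
    ∃ c, h ∣ S - Polynomial.C (algebraMap k O c) := by
  have := AdjoinRoot.isDomain_of_prime hp
  have := AdjoinRoot.noZeroSMulDivisors_of_prime_of_degree_ne_zero hp
    (Polynomial.natDegree_pos_iff_degree_pos.mp hd).ne'
  have := hm.finite_adjoinRoot
  set s : AdjoinRoot h := AdjoinRoot.mk h S with hs
  have hint : IsIntegral O s := Algebra.IsIntegral.isIntegral s
  have haeval : ∀ p : Polynomial O, aeval s p = AdjoinRoot.mk h (aeval S p) := fun p => by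
    exact Polynomial.aeval_algHom_apply (AdjoinRoot.mkₐ h) S p
  set m := minpoly O s with hmdef
  have h1 : h ∣ aeval S m := by
    rw [← AdjoinRoot.mk_eq_zero, ← haeval, minpoly.aeval]
  -- Write `m(S) = h * T` and differentiate in both directions. Eliminating the derivatives leaves,
  -- modulo `h`, only a multiple of the bracket.
  have h2 : h ∣ aeval S (Differential.mapCoeffs m) * derivative h := by
    obtain ⟨T, hT⟩ := h1
    have e1 := mapCoeffs_aeval m S
    have e2 : derivative (aeval S m) = aeval S (derivative m) * derivative S := by
      rw [← Polynomial.comp_eq_aeval, Polynomial.derivative_comp, Polynomial.comp_eq_aeval,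
        mul_comm]
    rw [hT, Derivation.leibniz, smul_eq_mul, smul_eq_mul] at e1
    rw [hT, Polynomial.derivative_mul] at e2
    have e3 : aeval S (Differential.mapCoeffs m) * derivative h =
        h * (Differential.mapCoeffs T * derivative h - derivative T * Differential.mapCoeffs h) -
        aeval S (derivative m) * (Differential.mapCoeffs S * derivative h -
          derivative S * Differential.mapCoeffs h) := by
      linear_combination -(derivative h) * e1 + Differential.mapCoeffs h * e2
    rw [e3]
    exact dvd_sub (dvd_mul_right _ _) (hS.mul_left _)
  have h3 : ¬ h ∣ derivative h := by
    intro h3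
    have h4 := Polynomial.degree_derivative_lt hm.ne_zero
    have h5 := Polynomial.eq_zero_of_dvd_of_degree_lt h3 h4
    exact hd.ne' (Polynomial.derivative_eq_zero.mp h5)
  -- As `m` is monic, differentiating its coefficients lowers the degree; the result still
  -- annihilates `s`, so minimality forces it to vanish.
  have h4 : Differential.mapCoeffs m = 0 := by
    by_contra h0
    have h5 : aeval s (Differential.mapCoeffs m) = 0 := by
      rw [haeval, AdjoinRoot.mk_eq_zero]
      exact (hp.dvd_or_dvd h2).resolve_right h3
    have h6 := minpoly.IsIntegrallyClosed.degree_le_of_ne_zero h0 h5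
    refine absurd h6 (not_le.mpr ?_)
    rw [Polynomial.degree_eq_natDegree (minpoly.ne_zero hint), Polynomial.degree_lt_iff_coeff_zero]
    intro j hj
    rw [Differential.coeff_mapCoeffs]
    rcases hj.eq_or_lt with rfl | hj
    · rw [Polynomial.coeff_natDegree, (minpoly.monic hint).leadingCoeff,
        Derivation.map_one_eq_zero]
    · rw [Polynomial.coeff_eq_zero_of_natDegree_lt hj, map_zero]
  have h5 : m ∈ Polynomial.lifts (algebraMap k O) := by
    rw [Polynomial.lifts_iff_coeff_lifts]
    intro j
    obtain ⟨c, hc⟩ := hk (m.coeff j) (by rw [← Differential.coeff_mapCoeffs, h4]; rfl)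
    exact ⟨c, hc.symm⟩
  -- Over the algebraically closed field `m` splits, so `h` divides a product of factors `S - c`,
  -- and primality selects one.
  obtain ⟨m0, hm0, -, hmon⟩ := Polynomial.lifts_and_degree_eq_and_monic h5 (minpoly.monic hint)
  rw [← hm0, (IsAlgClosed.splits m0).eq_prod_roots_of_monic hmon, Polynomial.map_multiset_prod,
    map_multiset_prod, Multiset.map_map, Multiset.map_map] at h1
  obtain ⟨c, -, hc⟩ := hp.exists_mem_multiset_map_dvd h1
  refine ⟨c, ?_⟩
  simpa using hc

end FirstIntegral

/-! ### Regularity in the second variable -/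

theorem exists_isYRegular_or (f : MvPowerSeries (Fin 2) ℂ) :
    (∃ d, IsYRegular f d) ∨ ∀ j, coeff (Finsupp.single 1 j) f = 0 := by
  classical
  by_cases h : ∃ d, coeff (Finsupp.single 1 d) f ≠ 0
  · exact Or.inl ⟨Nat.find h, fun j hj => not_not.mp (Nat.find_min h hj), Nat.find_spec h⟩
  · push Not at h
    exact Or.inr h

theorem IsConvergent.exists_X_zero_mul {f : MvPowerSeries (Fin 2) ℂ} (hf : IsConvergent f)
    (h : ∀ j, coeff (Finsupp.single 1 j) f = 0) : ∃ a, IsConvergent a ∧ f = X 0 * a := by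
  classical
  let a : MvPowerSeries (Fin 2) ℂ := ofCoeff fun n => coeff (n + Finsupp.single 0 1) f
  refine ⟨a, hf.of_shift fun n => Or.inr rfl, ?_⟩
  ext n
  rw [X, coeff_monomial_mul]
  split_ifs with hn
  · rw [one_mul]
    change _ = coeff (n - Finsupp.single 0 1 + Finsupp.single 0 1) f
    rw [tsub_add_cancel_of_le hn]
  · have : n = Finsupp.single 1 (n 1) :=
      fin_two_ext (by rw [Finsupp.single_le_iff] at hn; simp; omega) (by simp)
    rw [this]
    exact h _

/-- The restriction of a power series to a coordinate axis. -/
def restrictAxis {σ : Type*} (i : σ) : MvPowerSeries σ ℂ →+* PowerSeries ℂ where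
  toFun f := PowerSeries.mk fun j => coeff (Finsupp.single i j) f
  map_zero' := by ext; simp
  map_one' := by
    classical
    ext j
    rw [PowerSeries.coeff_mk, PowerSeries.coeff_one, coeff_one]
    simp
  map_add' f g := by ext; simp
  map_mul' f g := by
    classical
    ext j
    rw [PowerSeries.coeff_mk, PowerSeries.coeff_mul, coeff_mul, Finsupp.antidiagonal_single,
      Finset.sum_map]
    refine Finset.sum_congr rfl fun p _ => ?_
    simp

theorem coeff_restrictAxis {σ : Type*} (i : σ) (f : MvPowerSeries σ ℂ) (j : ℕ) :
    PowerSeries.coeff j (restrictAxis i f) = coeff (Finsupp.single i j) f :=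
  PowerSeries.coeff_mk j fun j => coeff (Finsupp.single i j) f

theorem restrictAxis_polyToSeries (p : Polynomial xSeries) :
    restrictAxis 1 (polyToSeries p) = (p.map xConstantCoeff : Polynomial ℂ) := by
  ext j
  rw [coeff_restrictAxis, coeff_polyToSeries, Polynomial.coeff_coe, Polynomial.coeff_map,
    xConstantCoeff_apply]
  simp

theorem isYRegular_iff {f : MvPowerSeries (Fin 2) ℂ} {d : ℕ} :
    IsYRegular f d ↔ ∃ u, IsUnit u ∧ restrictAxis 1 f = PowerSeries.X ^ d * u := by
  constructor
  · rintro ⟨h1, h2⟩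
    obtain ⟨u, hu⟩ := PowerSeries.X_pow_dvd_iff.mpr fun j hj =>
      (coeff_restrictAxis 1 f j).trans (h1 j hj)
    refine ⟨u, ?_, hu⟩
    rw [PowerSeries.isUnit_iff_constantCoeff, isUnit_iff_ne_zero,
      ← PowerSeries.coeff_zero_eq_constantCoeff_apply]
    rw [← coeff_restrictAxis, hu, PowerSeries.coeff_X_pow_mul', if_pos le_rfl, tsub_self] at h2
    exact h2
  · rintro ⟨u, hu, h⟩
    rw [PowerSeries.isUnit_iff_constantCoeff, isUnit_iff_ne_zero,
      ← PowerSeries.coeff_zero_eq_constantCoeff_apply] at hu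
    refine ⟨fun j hj => ?_, ?_⟩
    · rw [← coeff_restrictAxis, h, PowerSeries.coeff_X_pow_mul', if_neg (by omega)]
    · rwa [← coeff_restrictAxis, h, PowerSeries.coeff_X_pow_mul', if_pos le_rfl, tsub_self]

theorem polyToSeries_sub (p q : Polynomial xSeries) :
    polyToSeries (p - q) = polyToSeries p - polyToSeries q :=
  map_sub polyToSeries p q

/-- Weierstrass preparation. -/
theorem IsYRegular.exists_preparation {P : MvPowerSeries (Fin 2) ℂ} {d : ℕ}
    (hP : IsYRegular P d) (hc : IsConvergent P) :
    ∃ (W : Polynomial xSeries) (q v : MvPowerSeries (Fin 2) ℂ), W.Monic ∧ W.natDegree = d ∧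
      W.map xConstantCoeff = Polynomial.X ^ d ∧ IsConvergent q ∧ IsConvergent v ∧ q * v = 1 ∧
      polyToSeries W = q * P := by
  obtain ⟨q, r, hq, hr, hqr, hrd⟩ := hP.exists_division hc (g := X 1 ^ d)
    ((convergentPowerSeries (Fin 2)).pow_mem (isConvergent_X 1) d)
  obtain ⟨ρ, hρ, hρr⟩ := exists_polyToSeries_eq hr hrd
  have hX : polyToSeries (Polynomial.X ^ d) = X 1 ^ d := by
    rw [map_pow, polyToSeries, Polynomial.aeval_X]
  have hW : polyToSeries (Polynomial.X ^ d - ρ) = q * P := by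
    rw [polyToSeries_sub, hρr, hX, hqr, add_sub_cancel_right]
  obtain ⟨u, hu, hPu⟩ := isYRegular_iff.mp hP
  have hXd : restrictAxis (1 : Fin 2) (X 1 ^ d) = PowerSeries.X ^ d := by
    rw [← hX, restrictAxis_polyToSeries]
    simp
  -- On the `y`-axis `r = y ^ d - q * P` is divisible by `y ^ d`, although `r` contains only lower
  -- powers of `y`.
  have hr0 : restrictAxis 1 r = 0 := by
    have h1 : (PowerSeries.X : PowerSeries ℂ) ^ d ∣ restrictAxis 1 r := by
      have h2 : r = X 1 ^ d - q * P := by rw [hqr]; ring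
      rw [h2, map_sub, map_mul, hXd, hPu]
      exact dvd_sub dvd_rfl ((dvd_mul_right _ _).mul_left _)
    ext j
    rw [map_zero]
    by_cases hj : j < d
    · exact PowerSeries.X_pow_dvd_iff.mp h1 j hj
    · have h2 := congrArg (coeff (Finsupp.single 1 (j - d))) hrd
      rw [coeff_yQuotient, ← Finsupp.single_add, Nat.sub_add_cancel (by omega)] at h2
      rw [coeff_restrictAxis, h2, map_zero]
  have hmap : (Polynomial.X ^ d - ρ).map xConstantCoeff = Polynomial.X ^ d := by
    rw [← Polynomial.coe_inj, ← restrictAxis_polyToSeries, polyToSeries_sub, hX, hρr, map_sub, hr0,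
      hXd, sub_zero]
    simp
  -- On the `y`-axis `W = q * P` reads `y ^ d = q * y ^ d * u`; cancelling `y ^ d` shows that `q` is
  -- a unit.
  have hqu : restrictAxis 1 q * u = 1 := by
    have h1 : (PowerSeries.X : PowerSeries ℂ) ^ d ≠ 0 := pow_ne_zero _ PowerSeries.X_ne_zero
    apply mul_left_cancel₀ h1
    have h2 := congrArg (restrictAxis 1) hW
    rw [restrictAxis_polyToSeries, hmap, map_mul, hPu] at h2
    rw [mul_one, mul_left_comm, ← h2]
    simp
  have hq0 : constantCoeff q ≠ 0 := by
    have h1 := IsUnit.of_mul_eq_one _ hqu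
    rw [PowerSeries.isUnit_iff_constantCoeff, isUnit_iff_ne_zero,
      ← PowerSeries.coeff_zero_eq_constantCoeff_apply, coeff_restrictAxis, Finsupp.single_zero] at h1
    rwa [← coeff_zero_eq_constantCoeff_apply]
  obtain ⟨v, hv, hqv⟩ := hq.exists_mul_eq_one hq0
  have hdeg : ρ.degree < (Polynomial.X ^ d : Polynomial xSeries).degree := by
    rwa [Polynomial.degree_X_pow]
  refine ⟨Polynomial.X ^ d - ρ, q, v, (Polynomial.monic_X_pow d).sub_of_left hdeg, ?_, hmap, hq, hv,
    hqv, hW⟩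
  rw [Polynomial.natDegree_eq_of_degree_eq (Polynomial.degree_sub_eq_left_of_degree_lt hdeg),
    Polynomial.natDegree_X_pow]

/-! ### Common factors of the partial derivatives, and powers of the variables in the Jacobian ideal
-/

theorem pderiv_mul' (i : Fin 2) (f g : MvPowerSeries (Fin 2) ℂ) :
    pderiv ℂ i (f * g) = f * pderiv ℂ i g + g * pderiv ℂ i f :=
  Derivation.leibniz _ _ _

/-- The polynomial remainder of `b` modulo `h` is also a multiple of `h` as a series, so uniqueness
of Weierstrass division makes it vanish. -/
theorem polyToSeries_dvd {h b : Polynomial xSeries} {z : MvPowerSeries (Fin 2) ℂ} (hm : h.Monic)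
    (hr : IsYRegular (polyToSeries h) h.natDegree) (hz : polyToSeries b = polyToSeries h * z) :
    h ∣ b := by
  rw [← Polynomial.modByMonic_eq_zero_iff_dvd hm]
  have h1 : polyToSeries (b %ₘ h) = (z - polyToSeries (b /ₘ h)) * polyToSeries h := by
    have h2 : polyToSeries (b %ₘ h) + polyToSeries h * polyToSeries (b /ₘ h) = polyToSeries b := by
      rw [← map_mul, ← map_add, Polynomial.modByMonic_add_div]
    linear_combination h2 + hz
  have hlt : (b %ₘ h).degree < h.natDegree := by
    rw [← Polynomial.degree_eq_natDegree hm.ne_zero]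
    exact Polynomial.degree_modByMonic_lt _ hm
  have h3 := hr.eq_zero_of_yQuotient_mul (isConvergent_polyToSeries h)
    (q := z - polyToSeries (b /ₘ h)) (by rw [← h1]; exact yQuotient_polyToSeries hlt)
  rw [h3, zero_mul] at h1
  exact polyToSeries_injective (h1.trans (map_zero _).symm)

instance : CharZero xSeries :=
  charZero_of_injective_algebraMap (algebraMap ℂ xSeries).injective

/-- If `h` divided both partial derivatives, `f` would be constant on `h = 0`; since `f` vanishes at
the origin, `h` would divide `f` too, and every zero of `h` near the origin would be singular. -/
theorem not_prime_dvd_pderiv {f : convergentPowerSeries (Fin 2)}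
    (hf : DefinesIsolatedSingularity f) {h : Polynomial xSeries} (hp : Prime h) (hm : h.Monic)
    (hx : h.map xConstantCoeff = Polynomial.X ^ h.natDegree) {b : Fin 2 → MvPowerSeries (Fin 2) ℂ}
    (hb : ∀ i, IsConvergent (b i)) : ¬ ∀ i, pderiv ℂ i (f : MvPowerSeries (Fin 2) ℂ) =
      polyToSeries h * b i := by
  intro hfb
  set H := polyToSeries h with hH
  have hHc : IsConvergent H := isConvergent_polyToSeries h
  have hHr : restrictAxis 1 H = PowerSeries.X ^ h.natDegree := by
    rw [hH, restrictAxis_polyToSeries, hx]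
    simp
  have hreg : IsYRegular H h.natDegree := isYRegular_iff.mpr ⟨1, isUnit_one, by rw [hHr, mul_one]⟩
  have hd : 0 < h.natDegree := by
    refine Nat.pos_of_ne_zero fun h0 => hp.not_isUnit ?_
    rw [(hm.natDegree_eq_zero).mp h0]
    exact isUnit_one
  have hH0 : constantCoeff H = 0 := by
    rw [← coeff_zero_eq_constantCoeff_apply, ← Finsupp.single_zero (1 : Fin 2)]
    exact hreg.1 0 hd
  obtain ⟨a, S, ha, hS, hfa, hSd⟩ := hreg.exists_division hHc f.2
  obtain ⟨s, hs, hsS⟩ := exists_polyToSeries_eq hS hSd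
  have hfi : ∀ i, pderiv ℂ i S = H * b i - a * pderiv ℂ i H - H * pderiv ℂ i a := fun i => by
    rw [← hfb, hfa, map_add, pderiv_mul']
    ring
  -- Modulo `H`, the gradient of the remainder `S` is `-a` times that of `H`, so their Jacobian
  -- determinant is divisible by `H`.
  have hbr : h ∣ Differential.mapCoeffs s * Polynomial.derivative h -
      Polynomial.derivative s * Differential.mapCoeffs h := by
    refine polyToSeries_dvd hm hreg
      (z := (b 0 - pderiv ℂ 0 a) * pderiv ℂ 1 H - (b 1 - pderiv ℂ 1 a) * pderiv ℂ 0 H) ?_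
    rw [polyToSeries_sub, map_mul, map_mul, ← pderiv_zero_polyToSeries, ← pderiv_zero_polyToSeries,
      ← pderiv_one_polyToSeries, ← pderiv_one_polyToSeries, hsS, ← hH, hfi, hfi]
    ring
  obtain ⟨c, t, ht⟩ := dvd_sub_C_of_dvd_bracket (k := ℂ) eq_algebraMap_of_deriv_eq_zero hp hm hd hbr
  have hSt : S = H * polyToSeries t + C c := by
    have h1 := congrArg polyToSeries ht
    rw [polyToSeries_sub, hsS, map_mul, ← hH] at h1
    rw [← h1]
    have h2 : polyToSeries (Polynomial.C (algebraMap ℂ xSeries c)) = C c := by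
      rw [polyToSeries, Polynomial.aeval_C]
      rfl
    rw [h2, sub_add_cancel]
  -- Evaluation at the origin, where both `f` and `H` vanish.
  have hc : c = 0 := by
    have h1 := hf.1
    rw [hfa, hSt] at h1
    simpa [hH0] using h1
  refine eventually_evalAt_ne_zero_of_isolated hf hHc (ha.add (isConvergent_polyToSeries t)) ?_ hb
    hfb hH0
  rw [hfa, hSt, hc, map_zero]
  ring

/-- Elimination of `y`. Replace `P` by its Weierstrass polynomial `W` and `Q` by its remainder `ρ`.
These have no common prime factor, so the ideal they generate contains a non-zero series in `x`,
which is a power of `x` times a unit. -/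
theorem exists_pow_eq_of_isYRegular {f : convergentPowerSeries (Fin 2)}
    (hf : DefinesIsolatedSingularity f) {i j : Fin 2} (hij : ∀ k, k = i ∨ k = j) {d : ℕ}
    (hP : IsYRegular (pderiv ℂ i (f : MvPowerSeries (Fin 2) ℂ)) d) :
    ∃ (k : ℕ) (α β : MvPowerSeries (Fin 2) ℂ), IsConvergent α ∧ IsConvergent β ∧
      X 0 ^ k = α * pderiv ℂ i (f : MvPowerSeries (Fin 2) ℂ) +
        β * pderiv ℂ j (f : MvPowerSeries (Fin 2) ℂ) := by
  set P := pderiv ℂ i (f : MvPowerSeries (Fin 2) ℂ) with hPdef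
  set Q := pderiv ℂ j (f : MvPowerSeries (Fin 2) ℂ) with hQdef
  have hPc : IsConvergent P := IsConvergent.pderiv f.2 i
  have hQc : IsConvergent Q := IsConvergent.pderiv f.2 j
  obtain ⟨W, q, v, hWm, hWd, hWx, hq, hv, hqv, hW⟩ := hP.exists_preparation hPc
  obtain ⟨q2, r, hq2, hr, hQr, hrd⟩ := hP.exists_division hPc hQc
  obtain ⟨ρ, hρ, hρr⟩ := exists_polyToSeries_eq hr hrd
  have hno : ∀ ⦃h : Polynomial xSeries⦄, h ∣ W → h ∣ ρ → ¬ Prime h := by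
    intro h0 h1 h2 hp0
    obtain ⟨h, hm, hp, ⟨W', hW'⟩, ⟨ρ', hρ'⟩⟩ : ∃ h : Polynomial xSeries, h.Monic ∧ Prime h ∧
        h ∣ W ∧ h ∣ ρ := by
      obtain ⟨W', hW'⟩ := h1
      -- Divisors of a monic polynomial have unit leading coefficients, so the common prime factor
      -- can be made monic.
      have hu : IsUnit h0.leadingCoeff := by
        refine IsUnit.of_mul_eq_one W'.leadingCoeff ?_
        rw [← Polynomial.leadingCoeff_mul, ← hW', hWm.leadingCoeff]
      obtain ⟨c, hc⟩ := hu.exists_right_inv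
      have hcu : IsUnit (Polynomial.C c) := (IsUnit.of_mul_eq_one_right _ hc).map _
      have hass : Associated h0 (h0 * Polynomial.C c) := ⟨hcu.unit, rfl⟩
      refine ⟨h0 * Polynomial.C c, ?_, hass.prime hp0, hass.dvd_iff_dvd_left.mp ⟨W', hW'⟩,
        hass.dvd_iff_dvd_left.mp h2⟩
      rw [Polynomial.Monic, Polynomial.leadingCoeff_mul, Polynomial.leadingCoeff_C, hc]
    -- Modulo `x` the factor `h` divides `y ^ d`; being monic it reduces to a power of `y`, as a
    -- Weierstrass polynomial must.
    have hx : h.map xConstantCoeff = Polynomial.X ^ h.natDegree := by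
      have h3 : h.map xConstantCoeff ∣ Polynomial.X ^ d := by
        rw [← hWx, hW', Polynomial.map_mul]
        exact dvd_mul_right _ _
      obtain ⟨e, -, he⟩ := (dvd_prime_pow Polynomial.prime_X d).mp h3
      have h4 := Polynomial.eq_of_monic_of_associated (hm.map _) (Polynomial.monic_X_pow e) he
      rw [h4, ← hm.natDegree_map xConstantCoeff, h4, Polynomial.natDegree_X_pow]
    have hP' : P = polyToSeries h * (v * polyToSeries W') := by
      rw [← mul_left_comm, ← map_mul, ← hW', hW, ← mul_assoc, mul_comm v, hqv, one_mul]
    have hQ' : Q = polyToSeries h * (q2 * (v * polyToSeries W') + polyToSeries ρ') := by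
      have h5 : r = polyToSeries h * polyToSeries ρ' := by rw [← hρr, hρ', map_mul]
      rw [hQr, h5]
      linear_combination q2 * hP'
    have h6 : ∀ k, ∃ b, IsConvergent b ∧ pderiv ℂ k (f : MvPowerSeries (Fin 2) ℂ) =
        polyToSeries h * b := by
      intro k
      rcases hij k with rfl | rfl
      · exact ⟨_, hv.mul (isConvergent_polyToSeries _), hP'⟩
      · exact ⟨_, (hq2.mul (hv.mul (isConvergent_polyToSeries _))).add
          (isConvergent_polyToSeries _), hQ'⟩
    choose b hb1 hb2 using h6
    exact not_prime_dvd_pderiv hf hp hm hx hb1 hb2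
  have := hWm.finite_adjoinRoot
  have hint : IsIntegral xSeries (AdjoinRoot.mk W ρ) := Algebra.IsIntegral.isIntegral _
  obtain ⟨p, hpm, hp0⟩ := hint
  -- Multiplication by `ρ` is injective modulo `W` because there is no common prime factor. A monic
  -- equation for `ρ` therefore has a non-zero coefficient in the ideal generated by `ρ`.
  obtain ⟨l, hl, hlm⟩ := Ideal.exists_coeff_ne_zero_mem_comap_of_non_zero_divisor_root_mem
    (I := Ideal.span {AdjoinRoot.mk W ρ}) (r := AdjoinRoot.mk W ρ) (fun {x} hx => by
      induction x using AdjoinRoot.induction_on with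
      | ih t =>
        rw [← map_mul, AdjoinRoot.mk_eq_zero] at hx
        rw [AdjoinRoot.mk_eq_zero]
        exact UniqueFactorizationMonoid.dvd_of_dvd_mul_left_of_no_prime_factors hWm.ne_zero hno hx)
    (Ideal.mem_span_singleton_self _) hpm.ne_zero hp0
  rw [Ideal.mem_comap, Ideal.mem_span_singleton] at hlm
  obtain ⟨t, ht⟩ := hlm
  obtain ⟨t, rfl⟩ := AdjoinRoot.mk_surjective t
  have h1 : W ∣ Polynomial.C (p.coeff l) - ρ * t := by
    rw [← AdjoinRoot.mk_eq_zero, map_sub, map_mul, ← ht]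
    exact sub_self _
  obtain ⟨s, hs⟩ := h1
  obtain ⟨k, u, hu, hku⟩ := exists_eq_xVar_pow_mul hl
  obtain ⟨u', hu'⟩ := (isUnit_xSeries_iff.mpr hu).exists_right_inv
  have h2 : (p.coeff l : MvPowerSeries (Fin 2) ℂ) = q * P * polyToSeries s + r * polyToSeries t := by
    have h3 := congrArg polyToSeries hs
    rw [polyToSeries_sub, map_mul, map_mul, hW, hρr] at h3
    have h4 : polyToSeries (Polynomial.C (p.coeff l)) = (p.coeff l : MvPowerSeries (Fin 2) ℂ) := by
      rw [polyToSeries, Polynomial.aeval_C]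
      rfl
    rw [h4] at h3
    linear_combination h3
  have h3 : (X 0 : MvPowerSeries (Fin 2) ℂ) ^ k = (p.coeff l : MvPowerSeries (Fin 2) ℂ) * u' := by
    have h4 : (xVar : xSeries) ^ k = p.coeff l * u' := by rw [hku, mul_assoc, hu', mul_one]
    exact congrArg Subtype.val h4
  refine ⟨k, u' * (q * polyToSeries s - q2 * polyToSeries t), u' * polyToSeries t,
    u'.2.1.mul ((hq.mul (isConvergent_polyToSeries s)).sub (hq2.mul (isConvergent_polyToSeries t))),
    u'.2.1.mul (isConvergent_polyToSeries t), ?_⟩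
  rw [h3, h2]
  linear_combination -(u' : MvPowerSeries (Fin 2) ℂ) * polyToSeries t * hQr

/-- The Jacobian ideal of an isolated singularity contains powers of the variables. -/
theorem exists_pow_eq_sum_pderiv {f : convergentPowerSeries (Fin 2)}
    (hf : DefinesIsolatedSingularity f) :
    ∃ (K : ℕ) (α : Fin 2 → Fin 2 → MvPowerSeries (Fin 2) ℂ), (∀ i j, IsConvergent (α i j)) ∧
      ∀ i, X i ^ K = ∑ j, α i j * pderiv ℂ j (f : MvPowerSeries (Fin 2) ℂ) := by
  set F : Fin 2 → convergentPowerSeries (Fin 2) := fun j =>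
    ⟨pderiv ℂ j (f : MvPowerSeries (Fin 2) ℂ), IsConvergent.pderiv f.2 j⟩ with hF
  set J : Ideal (convergentPowerSeries (Fin 2)) := Ideal.span (Set.range F) with hJ
  have hFJ : ∀ j, F j ∈ J := fun j => Ideal.subset_span ⟨j, rfl⟩
  set x : Fin 2 → convergentPowerSeries (Fin 2) := fun i => ⟨X i, isConvergent_X i⟩ with hx
  suffices h : ∃ K, ∀ i, x i ^ K ∈ J by
    obtain ⟨K, hK⟩ := h
    have h1 : ∀ i, ∃ α : Fin 2 → convergentPowerSeries (Fin 2), ∑ j, α j * F j = x i ^ K :=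
      fun i => Ideal.mem_span_range_iff_exists_fun.mp (hK i)
    choose α hα using h1
    refine ⟨K, fun i j => α i j, fun i j => (α i j).2, fun i => ?_⟩
    have h2 := congrArg (convergentPowerSeries (Fin 2)).val (hα i)
    rw [map_sum] at h2
    exact h2.symm
  -- If neither partial derivative were `y`-regular, both would be divisible by `x`; since `f(0) =
  -- 0`, so would `f` be, and all of `x = 0` would be singular.
  obtain ⟨i, d, hd⟩ : ∃ i d, IsYRegular (pderiv ℂ i (f : MvPowerSeries (Fin 2) ℂ)) d := by
    by_contra! hcon
    have h1 : ∀ i j, coeff (Finsupp.single 1 j) (pderiv ℂ i (f : MvPowerSeries (Fin 2) ℂ)) = 0 :=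
      fun i => (exists_isYRegular_or _).resolve_left fun ⟨d, hd⟩ => hcon i d hd
    have h2 : ∀ j, coeff (Finsupp.single 1 j) (f : MvPowerSeries (Fin 2) ℂ) = 0 := by
      intro j
      rcases j with _ | j
      · rw [Finsupp.single_zero, coeff_zero_eq_constantCoeff_apply]
        exact hf.1
      · have h3 := h1 1 j
        rw [coeff_pderiv, ← Finsupp.single_add] at h3
        exact (mul_eq_zero.mp h3).resolve_right (Nat.cast_add_one_ne_zero _)
    obtain ⟨a, ha, hfa⟩ := IsConvergent.exists_X_zero_mul f.2 h2
    choose b hb hfb using fun i => IsConvergent.exists_X_zero_mul (IsConvergent.pderiv f.2 i) (h1 i)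
    exact eventually_evalAt_ne_zero_of_isolated hf (isConvergent_X 0) ha hfa hb hfb
      (constantCoeff_X 0)
  obtain ⟨k, α, β, hα, hβ, hk⟩ := exists_pow_eq_of_isYRegular hf (i := i) (j := 1 - i)
    (fun k => by fin_cases i <;> fin_cases k <;> simp) hd
  have hk' : x 0 ^ k ∈ J := by
    have h1 : x 0 ^ k = (⟨α, hα⟩ : convergentPowerSeries (Fin 2)) * F i +
      (⟨β, hβ⟩ : convergentPowerSeries (Fin 2)) * F (1 - i) := Subtype.ext hk
    rw [h1]
    exact J.add_mem (J.mul_mem_left _ (hFJ _)) (J.mul_mem_left _ (hFJ _))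
  obtain ⟨W, q, v, hWm, hWd, hWx, hq, hv, hqv, hW⟩ :=
    hd.exists_preparation (IsConvergent.pderiv f.2 i)
  obtain ⟨a, ha, hya⟩ := IsConvergent.exists_X_zero_mul (f := X 1 ^ d - q * pderiv ℂ i (f :
      MvPowerSeries (Fin 2) ℂ)) (((convergentPowerSeries (Fin 2)).pow_mem (isConvergent_X 1) d).sub
      (hq.mul (IsConvergent.pderiv f.2 i))) fun j => by
    have h1 : restrictAxis (1 : Fin 2) (X 1) = PowerSeries.X := by
      have h2 := restrictAxis_polyToSeries Polynomial.X
      rw [polyToSeries, Polynomial.aeval_X] at h2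
      rw [h2]
      simp
    rw [← coeff_restrictAxis, map_sub, ← hW, restrictAxis_polyToSeries, hWx, map_pow, h1]
    simp
  have hy : x 1 ^ d = (⟨q, hq⟩ : convergentPowerSeries (Fin 2)) * F i + x 0 * ⟨a, ha⟩ :=
    Subtype.ext (eq_add_of_sub_eq' hya)
  -- Preparation gives `y ^ d = q * P + x * a`, so modulo `J` the `k`-th power of `y ^ d` is a
  -- multiple of `x ^ k`.
  have hyk : x 1 ^ (d * k) ∈ J := by
    rw [pow_mul, hy]
    have h1 := sub_dvd_pow_sub_pow ((⟨q, hq⟩ : convergentPowerSeries (Fin 2)) * F i +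
      x 0 * ⟨a, ha⟩) (x 0 * ⟨a, ha⟩) k
    rw [add_sub_cancel_right] at h1
    have h2 := J.mem_of_dvd h1 (J.mul_mem_left _ (hFJ i))
    have h3 : (x 0 * ⟨a, ha⟩) ^ k ∈ J := by
      rw [mul_pow]
      exact J.mul_mem_right _ hk'
    exact (J.sub_mem_iff_left h3).mp h2
  refine ⟨k + d * k, fun l => ?_⟩
  rw [pow_add]
  fin_cases l
  · exact J.mul_mem_right _ hk'
  · exact J.mul_mem_left _ hyk

end

end NewtonPolyhedron

namespace NewtonPolyhedron

noncomputable section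

open MvPowerSeries

/-! ### Prime elements -/

theorem X_dvd_iff_restrictAxis {i j : Fin 2} (hij : i ≠ j) {f : MvPowerSeries (Fin 2) ℂ} :
    X i ∣ f ↔ restrictAxis j f = 0 := by
  rw [X_dvd_iff, PowerSeries.ext_iff]
  constructor
  · intro h k
    rw [coeff_restrictAxis, h _ (Finsupp.single_eq_of_ne hij), map_zero]
  · intro h m hm
    have h1 : m = Finsupp.single j (m j) := by
      ext k
      by_cases hk : k = j
      · subst hk; simp
      · rw [Finsupp.single_eq_of_ne hk]
        have : k = i := by omega
        rw [this, hm]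
    rw [h1, ← coeff_restrictAxis, h, map_zero]

/-- Restriction to the other axis has kernel generated by `X i` and takes values in a domain. -/
theorem prime_X_fin_two (i : Fin 2) : Prime (X i : MvPowerSeries (Fin 2) ℂ) := by
  have hij : i ≠ 1 - i := by fin_cases i <;> simp
  refine ⟨fun h => ?_, fun h => ?_, fun a b h => ?_⟩
  · have h1 := coeff_index_single_self_X (R := ℂ) i
    rw [h, map_zero] at h1
    exact zero_ne_one h1
  · rw [isUnit_iff_constantCoeff, constantCoeff_X] at h
    exact not_isUnit_zero h
  · rw [X_dvd_iff_restrictAxis hij, map_mul] at h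
    rw [X_dvd_iff_restrictAxis hij, X_dvd_iff_restrictAxis hij]
    exact mul_eq_zero.mp h

/-! ### Weighted substitutions -/

/-- The substitution `x_k ↦ X ^ w_k * v_k`, where the `v_k` are power series over `ℂ[t]`. -/
def weightedSubst (w : Fin 2 → ℕ) (v : Fin 2 → PowerSeries (Polynomial ℂ))
    (f : MvPowerSeries (Fin 2) ℂ) : PowerSeries (Polynomial ℂ) :=
  MvPowerSeries.subst (fun k => (PowerSeries.X ^ w k * v k : PowerSeries (Polynomial ℂ))) f

theorem hasSubst_weighted {w : Fin 2 → ℕ} (hw : ∀ k, w k ≠ 0)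
    (v : Fin 2 → PowerSeries (Polynomial ℂ)) :
    HasSubst (fun k => (PowerSeries.X ^ w k * v k : PowerSeries (Polynomial ℂ))) :=
  hasSubst_of_constantCoeff_zero fun k => by
    change PowerSeries.constantCoeff (PowerSeries.X ^ w k * v k) = 0
    simp [hw k]

theorem prod_weighted (w : Fin 2 → ℕ) (v : Fin 2 → PowerSeries (Polynomial ℂ)) (d : Fin 2 →₀ ℕ) :
    (d.prod fun k e => (PowerSeries.X ^ w k * v k : PowerSeries (Polynomial ℂ)) ^ e) =
      PowerSeries.X ^ Finsupp.weight w d * ∏ k, v k ^ d k := by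
  rw [Finsupp.prod_fintype _ _ fun k => pow_zero _, weight_fin_two, Fin.prod_univ_two,
    Fin.prod_univ_two]
  ring

theorem coeff_weightedSubst {w : Fin 2 → ℕ} (hw : ∀ k, w k ≠ 0)
    (v : Fin 2 → PowerSeries (Polynomial ℂ)) (f : MvPowerSeries (Fin 2) ℂ) (p : ℕ) :
    PowerSeries.coeff p (weightedSubst w v f) = finsum fun d => coeff d f •
      PowerSeries.coeff p (PowerSeries.X ^ Finsupp.weight w d * ∏ k, v k ^ d k) := by
  rw [weightedSubst, PowerSeries.coeff, coeff_subst (hasSubst_weighted hw v)]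
  simp only [prod_weighted]

theorem coeff_weightedSubst_finite {w : Fin 2 → ℕ} (hw : ∀ k, w k ≠ 0)
    (v : Fin 2 → PowerSeries (Polynomial ℂ)) (f : MvPowerSeries (Fin 2) ℂ) (p : ℕ) :
    (fun d => coeff d f • PowerSeries.coeff p
      (PowerSeries.X ^ Finsupp.weight w d * ∏ k, v k ^ d k)).HasFiniteSupport := by
  have h := coeff_subst_finite (hasSubst_weighted hw v) f (Finsupp.single () p)
  simp only [prod_weighted] at h
  exact h

theorem coeff_weightedSubst_eq_zero {w : Fin 2 → ℕ} (hw : ∀ k, w k ≠ 0)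
    (v : Fin 2 → PowerSeries (Polynomial ℂ)) {f : MvPowerSeries (Fin 2) ℂ} {p q : ℕ}
    (hf : ∀ d, Finsupp.weight w d < p → coeff d f = 0) (hq : q < p) :
    PowerSeries.coeff q (weightedSubst w v f) = 0 := by
  rw [coeff_weightedSubst hw]
  refine finsum_eq_zero_of_forall_eq_zero fun d => ?_
  rcases lt_or_ge (Finsupp.weight w d) p with h | h
  · rw [hf d h, zero_smul]
  · rw [PowerSeries.coeff_X_pow_mul', if_neg (by omega), smul_zero]

/-- The lowest coefficient of a weighted substitution depends only on the constant terms of the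
series substituted. -/
theorem coeff_weightedSubst_congr {w : Fin 2 → ℕ} (hw : ∀ k, w k ≠ 0)
    {v v' : Fin 2 → PowerSeries (Polynomial ℂ)}
    (hv : ∀ k, PowerSeries.constantCoeff (v k) = PowerSeries.constantCoeff (v' k))
    {f : MvPowerSeries (Fin 2) ℂ} {p : ℕ}
    (hf : ∀ d, Finsupp.weight w d < p → coeff d f = 0) :
    PowerSeries.coeff p (weightedSubst w v f) = PowerSeries.coeff p (weightedSubst w v' f) := by
  rw [coeff_weightedSubst hw, coeff_weightedSubst hw]
  refine finsum_congr fun d => ?_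
  rcases lt_trichotomy (Finsupp.weight w d) p with h | h | h
  · rw [hf d h, zero_smul, zero_smul]
  · rw [PowerSeries.coeff_X_pow_mul', PowerSeries.coeff_X_pow_mul', if_pos h.le, if_pos h.le, h,
      tsub_self, PowerSeries.coeff_zero_eq_constantCoeff_apply,
      PowerSeries.coeff_zero_eq_constantCoeff_apply, map_prod, map_prod]
    simp only [map_pow, hv]
  · rw [PowerSeries.coeff_X_pow_mul', PowerSeries.coeff_X_pow_mul', if_neg (by omega),
      if_neg (by omega)]

/-- The lowest coefficient of the substitution `x_k ↦ X ^ w_k * e_k` for series of weighted order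
at least `p`. -/
def initForm (w : Fin 2 → ℕ) (e : Fin 2 → Polynomial ℂ) (p : ℕ) (f : MvPowerSeries (Fin 2) ℂ) :
    Polynomial ℂ :=
  PowerSeries.coeff p (weightedSubst w (fun k => PowerSeries.C (e k)) f)

theorem coeff_X_pow_mul_C_prod (w : Fin 2 → ℕ) (e : Fin 2 → Polynomial ℂ) (p : ℕ)
    (d : Fin 2 →₀ ℕ) :
    PowerSeries.coeff p (PowerSeries.X ^ Finsupp.weight w d * ∏ k, PowerSeries.C (e k) ^ d k) =
      if Finsupp.weight w d = p then ∏ k, e k ^ d k else 0 := by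
  have h : ∏ k, PowerSeries.C (e k) ^ d k = PowerSeries.C (∏ k, e k ^ d k) := by
    simp only [map_prod, map_pow]
  rw [h, PowerSeries.coeff_X_pow_mul', PowerSeries.coeff_C]
  split_ifs <;> first | rfl | omega

theorem initForm_eq {w : Fin 2 → ℕ} (hw : ∀ k, w k ≠ 0) (e : Fin 2 → Polynomial ℂ) (p : ℕ)
    (f : MvPowerSeries (Fin 2) ℂ) :
    initForm w e p f = finsum fun d => coeff d f •
      if Finsupp.weight w d = p then ∏ k, e k ^ d k else 0 := by
  rw [initForm, coeff_weightedSubst hw]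
  simp only [coeff_X_pow_mul_C_prod]

theorem initForm_finite {w : Fin 2 → ℕ} (hw : ∀ k, w k ≠ 0) (e : Fin 2 → Polynomial ℂ) (p : ℕ)
    (f : MvPowerSeries (Fin 2) ℂ) :
    (fun d => coeff d f •
      if Finsupp.weight w d = p then ∏ k, e k ^ d k else 0).HasFiniteSupport := by
  have h := coeff_weightedSubst_finite hw (fun k => PowerSeries.C (e k)) f p
  simpa only [coeff_X_pow_mul_C_prod] using h

theorem initForm_congr {w : Fin 2 → ℕ} (hw : ∀ k, w k ≠ 0) (e : Fin 2 → Polynomial ℂ) {p : ℕ}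
    {f g : MvPowerSeries (Fin 2) ℂ}
    (h : ∀ d, Finsupp.weight w d = p → coeff d f = coeff d g) :
    initForm w e p f = initForm w e p g := by
  rw [initForm_eq hw, initForm_eq hw]
  refine finsum_congr fun d => ?_
  split_ifs with hd
  · rw [h d hd]
  · simp

theorem map_initForm {w : Fin 2 → ℕ} (hw : ∀ k, w k ≠ 0) (e : Fin 2 → Polynomial ℂ) (p : ℕ)
    (f : MvPowerSeries (Fin 2) ℂ) (ev : Polynomial ℂ →ₐ[ℂ] Polynomial ℂ) :
    ev (initForm w e p f) = initForm w (fun k => ev (e k)) p f := by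
  rw [initForm_eq hw, initForm_eq hw]
  refine (ev.toLinearMap.toAddMonoidHom.map_finsum (initForm_finite hw e p f)).trans
    (finsum_congr fun d => ?_)
  change ev _ = _
  rw [map_smul]
  split_ifs
  · simp only [map_prod, map_pow]
  · rw [map_zero]

theorem coeff_initForm_eq {w : Fin 2 → ℕ} (hw : ∀ k, w k ≠ 0) (e : Fin 2 → Polynomial ℂ) (p r : ℕ)
    (f : MvPowerSeries (Fin 2) ℂ) :
    (initForm w e p f).coeff r = finsum fun d => coeff d f *
      if Finsupp.weight w d = p then (∏ k, e k ^ d k).coeff r else 0 := by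
  rw [initForm_eq hw]
  refine ((Polynomial.lcoeff ℂ r).toAddMonoidHom.map_finsum (initForm_finite hw e p f)).trans
    (finsum_congr fun d => ?_)
  change (coeff d f • _ : Polynomial ℂ).coeff r = _
  rw [Polynomial.coeff_smul, smul_eq_mul]
  split_ifs <;> simp

theorem prod_fin_two_eq {i j : Fin 2} (hij : i ≠ j) {M : Type*} [CommMonoid M] (e : Fin 2 → M) :
    ∏ k, e k = e i * e j := by
  rw [Fin.prod_univ_two]
  obtain ⟨rfl, rfl⟩ | ⟨rfl, rfl⟩ : (i = 0 ∧ j = 1) ∨ (i = 1 ∧ j = 0) := by omega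
  · rfl
  · exact mul_comm _ _

theorem fin_two_ext' {i j : Fin 2} (hij : i ≠ j) {m n : Fin 2 →₀ ℕ} (hi : m i = n i)
    (hj : m j = n j) : m = n := by
  obtain ⟨rfl, rfl⟩ | ⟨rfl, rfl⟩ : (i = 0 ∧ j = 1) ∨ (i = 1 ∧ j = 0) := by omega
  · exact fin_two_ext hi hj
  · exact fin_two_ext hj hi

theorem weight_eq {i j : Fin 2} (hij : i ≠ j) (w : Fin 2 → ℕ) (n : Fin 2 →₀ ℕ) :
    Finsupp.weight w n = n i * w i + n j * w j := by
  rw [weight_fin_two]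
  obtain ⟨rfl, rfl⟩ | ⟨rfl, rfl⟩ : (i = 0 ∧ j = 1) ∨ (i = 1 ∧ j = 0) := by omega
  · rfl
  · exact add_comm _ _

/-- The weight together with the exponent of `x_i` determines the monomial, so no two monomials of
the same weight collide when `x_j` is set to 1. -/
theorem coeff_initForm {w : Fin 2 → ℕ} (hw : ∀ k, w k ≠ 0) {i j : Fin 2} (hij : i ≠ j)
    {e : Fin 2 → Polynomial ℂ} (hi : e i = Polynomial.X) (hj : e j = 1)
    (f : MvPowerSeries (Fin 2) ℂ) (d : Fin 2 →₀ ℕ) :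
    (initForm w e (Finsupp.weight w d) f).coeff (d i) = coeff d f := by
  have h : ∀ d' : Fin 2 →₀ ℕ, (∏ k, e k ^ d' k).coeff (d i) = if d i = d' i then 1 else 0 := by
    intro d'
    rw [prod_fin_two_eq hij, hi, hj, one_pow, mul_one, Polynomial.coeff_X_pow]
  rw [coeff_initForm_eq hw, finsum_eq_single _ d]
  · rw [if_pos rfl, h, if_pos rfl, mul_one]
  · intro d' hd'
    rw [h]
    split_ifs with h1 h2
    · refine absurd ?_ hd'
      rw [weight_eq hij, weight_eq hij, h2] at h1
      exact fin_two_ext' hij h2.symm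
        (Nat.eq_of_mul_eq_mul_right (Nat.pos_of_ne_zero (hw j)) (by omega))
    · rw [mul_zero]
    · rw [mul_zero]

theorem weightedSubst_injective {w : Fin 2 → ℕ} (hw : ∀ k, w k ≠ 0) {i j : Fin 2} (hij : i ≠ j)
    {e : Fin 2 → Polynomial ℂ} (hi : e i = Polynomial.X) (hj : e j = 1) :
    Function.Injective (weightedSubst w fun k => PowerSeries.C (e k)) := by
  intro f g h
  ext d
  rw [← coeff_initForm hw hij hi hj, ← coeff_initForm hw hij hi hj, initForm, initForm, h]

end

end NewtonPolyhedron

namespace NewtonPolyhedron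

noncomputable section

open MvPowerSeries

/-! ### Shears -/

/-- A power series in one variable, as a power series in the variable `x_j`. -/
def axisSeries {σ : Type*} (j : σ) (c : PowerSeries ℂ) : MvPowerSeries σ ℂ :=
  PowerSeries.subst (X j : MvPowerSeries σ ℂ) c

theorem axisSeries_add {σ : Type*} (j : σ) (c c' : PowerSeries ℂ) :
    axisSeries j (c + c') = axisSeries j c + axisSeries j c' :=
  PowerSeries.subst_add (PowerSeries.HasSubst.X j) c c'

theorem subst_axisSeries {σ τ S : Type*} [CommRing S] [Algebra ℂ S] {a : σ → MvPowerSeries τ S}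
    (ha : HasSubst a) (j : σ) (c : PowerSeries ℂ) :
    subst a (axisSeries j c) = PowerSeries.subst (a j) c := by
  rw [axisSeries, PowerSeries.subst, subst_comp_subst_apply
    (PowerSeries.HasSubst.const (PowerSeries.HasSubst.X j)) ha, subst_X ha]
  rfl

theorem constantCoeff_axisSeries {σ : Type*} (j : σ) {c : PowerSeries ℂ}
    (hc : PowerSeries.constantCoeff c = 0) : constantCoeff (axisSeries j c) = 0 :=
  PowerSeries.constantCoeff_subst_eq_zero (constantCoeff_X j) c hc

/-- The images of the variables under the shear `x_i ↦ x_i + c(x_j)`. -/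
def shearFun {σ : Type*} [DecidableEq σ] (i j : σ) (c : PowerSeries ℂ) : σ → MvPowerSeries σ ℂ :=
  Function.update X i (X i + axisSeries j c)

section Shear

variable {σ : Type*} [DecidableEq σ] {i j : σ} {c c' : PowerSeries ℂ}

theorem constantCoeff_shearFun (hc : PowerSeries.constantCoeff c = 0) (k : σ) :
    constantCoeff (shearFun i j c k) = 0 := by
  rw [shearFun]
  rcases eq_or_ne k i with rfl | hk
  · rw [Function.update_self, map_add, constantCoeff_X, constantCoeff_axisSeries j hc, add_zero]
  · rw [Function.update_of_ne hk, constantCoeff_X]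

theorem shearFun_zero : shearFun i j 0 = X := by
  have h : axisSeries j 0 = 0 := by
    rw [axisSeries, ← PowerSeries.coe_substAlgHom (PowerSeries.HasSubst.X j), map_zero]
  rw [shearFun, h, add_zero, Function.update_eq_self]

variable [Finite σ]

theorem hasSubst_shearFun (hc : PowerSeries.constantCoeff c = 0) : HasSubst (shearFun i j c) :=
  hasSubst_of_constantCoeff_zero (constantCoeff_shearFun hc)

theorem subst_shearFun_shearFun (hij : i ≠ j) (hc : PowerSeries.constantCoeff c = 0)
    (hc' : PowerSeries.constantCoeff c' = 0) (f : MvPowerSeries σ ℂ) :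
    subst (shearFun i j c) (subst (shearFun i j c') f) = subst (shearFun i j (c + c')) f := by
  rw [subst_comp_eq (constantCoeff_shearFun hc') (constantCoeff_shearFun hc)]
  congr 1
  funext k
  have ha := hasSubst_shearFun (i := i) (j := j) hc
  rcases eq_or_ne k i with rfl | hk
  · have h1 : shearFun k j c' k = X k + axisSeries j c' := Function.update_self ..
    have h2 : shearFun k j c k = X k + axisSeries j c := Function.update_self ..
    have h3 : shearFun k j (c + c') k = X k + axisSeries j (c + c') := Function.update_self ..
    have h4 : shearFun k j c j = X j := Function.update_of_ne hij.symm ..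
    rw [h1, h3, subst_add ha, subst_X ha, subst_axisSeries ha, h2, h4, axisSeries_add, add_assoc]
    rfl
  · have h1 : ∀ c, shearFun i j c k = X k := fun c => Function.update_of_ne hk ..
    rw [h1, h1, subst_X ha, h1]

/-- The automorphism `x_i ↦ x_i + c(x_j)`. -/
def shear (hij : i ≠ j) (hc : PowerSeries.constantCoeff c = 0) :
    MvPowerSeries σ ℂ ≃ₐ[ℂ] MvPowerSeries σ ℂ :=
  AlgEquiv.ofAlgHom (substAlgHom (hasSubst_shearFun (i := i) (j := j) hc))
    (substAlgHom (hasSubst_shearFun (i := i) (j := j) (c := -c) (by rw [map_neg, hc, neg_zero])))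
    (AlgHom.ext fun f => by
      rw [AlgHom.comp_apply, coe_substAlgHom, coe_substAlgHom, subst_shearFun_shearFun hij hc
        (by rw [map_neg, hc, neg_zero]), add_neg_cancel, shearFun_zero, subst_X_eq]
      rfl)
    (AlgHom.ext fun f => by
      rw [AlgHom.comp_apply, coe_substAlgHom, coe_substAlgHom, subst_shearFun_shearFun hij
        (by rw [map_neg, hc, neg_zero]) hc, neg_add_cancel, shearFun_zero, subst_X_eq]
      rfl)

theorem shear_apply (hij : i ≠ j) (hc : PowerSeries.constantCoeff c = 0) (f : MvPowerSeries σ ℂ) :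
    shear hij hc f = subst (shearFun i j c) f := by
  rw [← coe_substAlgHom (hasSubst_shearFun (i := i) (j := j) hc)]
  rfl

theorem shear_shear (hij : i ≠ j) (hc : PowerSeries.constantCoeff c = 0)
    (hc' : PowerSeries.constantCoeff c' = 0) (hcc : PowerSeries.constantCoeff (c + c') = 0)
    (f : MvPowerSeries σ ℂ) : shear hij hc (shear hij hc' f) = shear hij hcc f := by
  rw [shear_apply, shear_apply, shear_apply, subst_shearFun_shearFun hij hc hc']

theorem shear_neg_shear (hij : i ≠ j) (hc : PowerSeries.constantCoeff c = 0)
    (hc' : PowerSeries.constantCoeff (-c) = 0) (f : MvPowerSeries σ ℂ) :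
    shear hij hc' (shear hij hc f) = f := by
  rw [shear_shear hij hc' hc (by rw [neg_add_cancel, map_zero]), shear_apply]
  simp only [neg_add_cancel]
  rw [shearFun_zero, subst_X_eq]

theorem shear_X_self (hij : i ≠ j) (hc : PowerSeries.constantCoeff c = 0) :
    shear hij hc (X i) = X i + axisSeries j c := by
  rw [shear_apply, subst_X (hasSubst_shearFun hc)]
  exact Function.update_self ..

theorem order_shear (hij : i ≠ j) (hc : PowerSeries.constantCoeff c = 0) (f : MvPowerSeries σ ℂ) :
    (shear hij hc f).order = f.order := by
  have h : ∀ {c : PowerSeries ℂ} (hc : PowerSeries.constantCoeff c = 0) (f : MvPowerSeries σ ℂ),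
      f.order ≤ (shear hij hc f).order := fun hc f => by
    rw [shear_apply]
    exact order_le_order_subst (constantCoeff_shearFun hc) f
  refine le_antisymm ?_ (h hc f)
  have hc' : PowerSeries.constantCoeff (-c) = 0 := by rw [map_neg, hc, neg_zero]
  have h1 := h hc' (shear hij hc f)
  rwa [shear_neg_shear] at h1

end Shear

/-! ### Initial forms of sheared series -/

section InitShear

variable {i j : Fin 2} {c : PowerSeries ℂ}

/-- The weight with value `n` at `i` and `1` elsewhere. -/
def axisWeight (i : Fin 2) (n : ℕ) : Fin 2 → ℕ := Function.update 1 i n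

/-- The polynomials with value `t` at `i` and `1` elsewhere. -/
def axisVar (i : Fin 2) : Fin 2 → Polynomial ℂ := Function.update 1 i Polynomial.X

/-- Composing the two substitutions: the added term `x_j ^ n * c₁(x_j)` has weight at least `w j *
n`, so the factor `X ^ w i` can still be extracted from the image of `x_i`. -/
theorem weightedSubst_shear (hij : i ≠ j) {w : Fin 2 → ℕ} (hw : ∀ k, w k ≠ 0)
    (e : Fin 2 → Polynomial ℂ) (c₁ : PowerSeries ℂ) {n : ℕ} (hn : w i ≤ w j * n)
    (hc : PowerSeries.constantCoeff (PowerSeries.X ^ n * c₁) = 0) (f : MvPowerSeries (Fin 2) ℂ) :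
    weightedSubst w (fun k => PowerSeries.C (e k)) (shear hij hc f) =
      weightedSubst w (Function.update (fun k => PowerSeries.C (e k)) i (PowerSeries.C (e i) +
        PowerSeries.X ^ (w j * n - w i) * PowerSeries.C (e j) ^ n *
          PowerSeries.subst (PowerSeries.X ^ w j * PowerSeries.C (e j) :
            PowerSeries (Polynomial ℂ)) c₁)) f := by
  have ha := hasSubst_weighted hw fun k => PowerSeries.C (e k)
  rw [shear_apply, weightedSubst, weightedSubst, subst_comp_subst_apply (hasSubst_shearFun hc) ha]
  congr 1
  funext k
  rcases eq_or_ne k i with rfl | hk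
  · have h1 : shearFun k j (PowerSeries.X ^ n * c₁) k = X k + axisSeries j (PowerSeries.X ^ n * c₁) :=
      Function.update_self ..
    rw [h1, subst_add ha, subst_X ha, subst_axisSeries ha, Function.update_self]
    have hs : PowerSeries.HasSubst (PowerSeries.X ^ w j * PowerSeries.C (e j) :
        PowerSeries (Polynomial ℂ)) := ha.const_coeff j
    rw [PowerSeries.subst_mul hs, PowerSeries.subst_pow hs, PowerSeries.subst_X hs, mul_add,
      mul_pow, ← pow_mul, ← Nat.add_sub_cancel' hn, pow_add, Nat.add_sub_cancel' hn]
    ring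
  · have h1 : shearFun i j (PowerSeries.X ^ n * c₁) k = X k := Function.update_of_ne hk ..
    rw [h1, subst_X ha, Function.update_of_ne hk]

theorem constantCoeff_subst_eq_C {a : PowerSeries (Polynomial ℂ)}
    (ha : PowerSeries.constantCoeff a = 0) (c : PowerSeries ℂ) :
    PowerSeries.constantCoeff (PowerSeries.subst a c : PowerSeries (Polynomial ℂ)) =
      Polynomial.C (PowerSeries.constantCoeff c) := by
  have hs : PowerSeries.HasSubst a := PowerSeries.HasSubst.of_constantCoeff_zero' ha
  obtain ⟨b, hb⟩ := PowerSeries.X_dvd_iff.mpr (show PowerSeries.constantCoeff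
    (c - algebraMap ℂ (PowerSeries ℂ) (PowerSeries.constantCoeff c)) = 0 by
      rw [map_sub]
      exact sub_self _)
  conv_lhs => rw [eq_add_of_sub_eq hb]
  rw [PowerSeries.subst_add hs, PowerSeries.subst_mul hs,
    PowerSeries.subst_X hs, ← PowerSeries.coe_substAlgHom hs, AlgHom.commutes, map_add, map_mul, ha,
    zero_mul, zero_add, MvPowerSeries.algebraMap_apply]
  exact MvPowerSeries.constantCoeff_C (algebraMap ℂ (Polynomial ℂ) (PowerSeries.constantCoeff c))

/-- Only the part of the shear having exactly the weight of `x_i` reaches the initial form: the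
constant term of `c₁` if `w i = w j * n`, and nothing otherwise. -/
theorem initForm_shear (hij : i ≠ j) {w : Fin 2 → ℕ} (hw : ∀ k, w k ≠ 0)
    (e : Fin 2 → Polynomial ℂ) {c₁ : PowerSeries ℂ} {n : ℕ} (hn : w i ≤ w j * n)
    (hc : PowerSeries.constantCoeff (PowerSeries.X ^ n * c₁) = 0) {f : MvPowerSeries (Fin 2) ℂ}
    {p : ℕ} (hf : ∀ d, Finsupp.weight w d < p → coeff d f = 0) :
    initForm w e p (shear hij hc f) = initForm w (Function.update e i (e i +
      if w i = w j * n then e j ^ n * Polynomial.C (PowerSeries.constantCoeff c₁) else 0)) p f := by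
  rw [initForm, initForm, weightedSubst_shear hij hw e c₁ hn hc]
  refine coeff_weightedSubst_congr hw (fun k => ?_) hf
  rcases eq_or_ne k i with rfl | hk
  · rw [Function.update_self, PowerSeries.constantCoeff_C, Function.update_self, map_add, map_mul,
      constantCoeff_subst_eq_C (by simp [hw j])]
    split_ifs with h
    · simp [h]
    · have h1 : w j * n - w k ≠ 0 := by omega
      simp [h1]
  · rw [Function.update_of_ne hk, Function.update_of_ne hk]

theorem axisVar_self (i : Fin 2) : axisVar i i = Polynomial.X := Function.update_self ..

theorem axisVar_of_ne {i j : Fin 2} (hij : i ≠ j) : axisVar i j = 1 :=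
  Function.update_of_ne hij.symm ..

theorem axisWeight_self (i : Fin 2) (n : ℕ) : axisWeight i n i = n := Function.update_self ..

theorem axisWeight_of_ne {i j : Fin 2} (hij : i ≠ j) (n : ℕ) : axisWeight i n j = 1 :=
  Function.update_of_ne hij.symm ..

theorem axisWeight_ne_zero (i : Fin 2) {n : ℕ} (hn : n ≠ 0) (k : Fin 2) : axisWeight i n k ≠ 0 := by
  rcases eq_or_ne i k with rfl | hk
  · rwa [axisWeight_self]
  · rw [axisWeight_of_ne hk]
    exact one_ne_zero

theorem coeff_shear_eq_zero (hij : i ≠ j) {w : Fin 2 → ℕ} (hw : ∀ k, w k ≠ 0)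
    {c₁ : PowerSeries ℂ} {n : ℕ} (hn : w i ≤ w j * n)
    (hc : PowerSeries.constantCoeff (PowerSeries.X ^ n * c₁) = 0) {f : MvPowerSeries (Fin 2) ℂ}
    {p : ℕ} (hf : ∀ d, Finsupp.weight w d < p → coeff d f = 0) {d : Fin 2 →₀ ℕ}
    (hd : Finsupp.weight w d < p) : coeff d (shear hij hc f) = 0 := by
  rw [← coeff_initForm hw hij (axisVar_self i) (axisVar_of_ne hij), initForm,
    weightedSubst_shear hij hw _ c₁ hn hc, coeff_weightedSubst_eq_zero hw _ hf hd,
    Polynomial.coeff_zero]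

theorem coeff_eq_zero_of_shear (hij : i ≠ j) {w : Fin 2 → ℕ} (hw : ∀ k, w k ≠ 0)
    {c₁ : PowerSeries ℂ} {n : ℕ} (hn : w i ≤ w j * n)
    (hc : PowerSeries.constantCoeff (PowerSeries.X ^ n * c₁) = 0) {f : MvPowerSeries (Fin 2) ℂ}
    {p : ℕ} (hf : ∀ d, Finsupp.weight w d < p → coeff d (shear hij hc f) = 0) {d : Fin 2 →₀ ℕ}
    (hd : Finsupp.weight w d < p) : coeff d f = 0 := by
  have h0 : PowerSeries.X ^ n * -c₁ = -(PowerSeries.X ^ n * c₁) := mul_neg _ _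
  have hc' : PowerSeries.constantCoeff (PowerSeries.X ^ n * -c₁) = 0 := by
    rw [h0, map_neg, hc, neg_zero]
  have h1 := coeff_shear_eq_zero hij hw hn hc' hf hd
  rw [shear_shear hij hc' hc (by rw [h0, neg_add_cancel, map_zero])] at h1
  rw [shear_apply] at h1
  simp only [h0, neg_add_cancel] at h1
  rwa [shearFun_zero, subst_X_eq] at h1

/-! ### Balanced series -/

/-- Among the factors of the leading term of `f` of the form `x_i - c * x_j ^ n`, none has a
larger multiplicity than `x_i`. -/
def IsBalanced (i : Fin 2) (n : ℕ) (f : MvPowerSeries (Fin 2) ℂ) : Prop :=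
  ∀ p, (∀ d, Finsupp.weight (axisWeight i n) d < p → coeff d f = 0) → ∀ c,
    (initForm (axisWeight i n) (axisVar i) p f).rootMultiplicity c ≤
      (initForm (axisWeight i n) (axisVar i) p f).rootMultiplicity 0

theorem update_axisVar (i : Fin 2) (q : Polynomial ℂ) :
    Function.update (axisVar i) i q = Function.update (1 : Fin 2 → Polynomial ℂ) i q := by
  rw [axisVar, Function.update_idem]

theorem comp_initForm_axisVar {w : Fin 2 → ℕ} (hw : ∀ k, w k ≠ 0) (i : Fin 2) (p : ℕ)
    (f : MvPowerSeries (Fin 2) ℂ) (q : Polynomial ℂ) :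
    (initForm w (axisVar i) p f).comp q = initForm w (Function.update 1 i q) p f := by
  have h := map_initForm hw (axisVar i) p f (Polynomial.aeval q)
  rw [Polynomial.comp_eq_aeval, h]
  congr 1
  funext k
  rcases eq_or_ne i k with rfl | hk
  · rw [axisVar_self, Function.update_self, Polynomial.aeval_X]
  · rw [axisVar_of_ne hk, Function.update_of_ne hk.symm, map_one, Pi.one_apply]

theorem initForm_axis_shear (hij : i ≠ j) {n : ℕ} (hn : n ≠ 0) {c₁ : PowerSeries ℂ}
    (hc : PowerSeries.constantCoeff (PowerSeries.X ^ n * c₁) = 0) {f : MvPowerSeries (Fin 2) ℂ}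
    {p : ℕ} (hf : ∀ d, Finsupp.weight (axisWeight i n) d < p → coeff d f = 0) :
    initForm (axisWeight i n) (axisVar i) p (shear hij hc f) =
      (initForm (axisWeight i n) (axisVar i) p f).comp
        (Polynomial.X + Polynomial.C (PowerSeries.constantCoeff c₁)) := by
  have hw := axisWeight_ne_zero i hn
  have h1 : axisWeight i n i = axisWeight i n j * n := by
    rw [axisWeight_self, axisWeight_of_ne hij, one_mul]
  rw [initForm_shear hij hw _ h1.le hc hf, if_pos h1, comp_initForm_axisVar hw, update_axisVar,
    axisVar_self, axisVar_of_ne hij, one_pow, one_mul]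

theorem rootMultiplicity_comp_X_add_C (P : Polynomial ℂ) (a c : ℂ) :
    (P.comp (Polynomial.X + Polynomial.C a)).rootMultiplicity c = P.rootMultiplicity (c + a) := by
  rw [Polynomial.rootMultiplicity_eq_rootMultiplicity (t := c),
    Polynomial.rootMultiplicity_eq_rootMultiplicity (t := c + a), Polynomial.comp_assoc]
  simp [add_assoc]

/-- The shear starts beyond exponent `n`, so it translates the roots at weight `n` by 0. -/
theorem IsBalanced.shear_self (hij : i ≠ j) {n : ℕ} (hn : n ≠ 0) {c₁ : PowerSeries ℂ}
    (hc : PowerSeries.constantCoeff (PowerSeries.X ^ n * c₁) = 0)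
    (hc₁ : PowerSeries.constantCoeff c₁ = 0) {f : MvPowerSeries (Fin 2) ℂ}
    (hf : IsBalanced i n f) : IsBalanced i n (shear hij hc f) := by
  intro p hp
  have h1 : axisWeight i n i = axisWeight i n j * n := by
    rw [axisWeight_self, axisWeight_of_ne hij, one_mul]
  have hp' : ∀ d, Finsupp.weight (axisWeight i n) d < p → coeff d f = 0 := fun d =>
    coeff_eq_zero_of_shear hij (axisWeight_ne_zero i hn) h1.le hc hp
  rw [initForm_axis_shear hij hn hc hp', hc₁, map_zero, add_zero, Polynomial.comp_X]
  exact hf p hp'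

/-- For the weight `m` at `j`, the added term has weight at least `m * n`, exceeding the weight 1 of
`x_i`; the initial form is unchanged. -/
theorem IsBalanced.shear_of_ne (hij : i ≠ j) {m n : ℕ} (hm : m ≠ 0) (hmn : 1 < m * n)
    {c₁ : PowerSeries ℂ} (hc : PowerSeries.constantCoeff (PowerSeries.X ^ n * c₁) = 0)
    {f : MvPowerSeries (Fin 2) ℂ} (hf : IsBalanced j m f) : IsBalanced j m (shear hij hc f) := by
  intro p hp
  have hw := axisWeight_ne_zero j hm
  have h1 : axisWeight j m i < axisWeight j m j * n := by
    rwa [axisWeight_self, axisWeight_of_ne hij.symm]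
  have hp' : ∀ d, Finsupp.weight (axisWeight j m) d < p → coeff d f = 0 := fun d =>
    coeff_eq_zero_of_shear hij hw h1.le hc hp
  rw [initForm_shear hij hw _ h1.le hc hp', if_neg h1.ne, add_zero, Function.update_eq_self]
  exact hf p hp'

/-- Only the true weighted order needs checking: below it the initial form is the zero polynomial,
whose root multiplicities are 0 by convention, and no larger `p` satisfies the vanishing condition.
-/
theorem isBalanced_of_rootMultiplicity_le {n p : ℕ} (hn : n ≠ 0)
    {f : MvPowerSeries (Fin 2) ℂ}
    (hf : ∀ d, Finsupp.weight (axisWeight i n) d < p → coeff d f = 0)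
    (hf' : ∃ d, Finsupp.weight (axisWeight i n) d = p ∧ coeff d f ≠ 0)
    (h : ∀ c, (initForm (axisWeight i n) (axisVar i) p f).rootMultiplicity c ≤
      (initForm (axisWeight i n) (axisVar i) p f).rootMultiplicity 0) : IsBalanced i n f := by
  intro q hq c
  obtain ⟨d, hd, hd0⟩ := hf'
  rcases lt_trichotomy q p with hqp | rfl | hqp
  · have h1 : initForm (axisWeight i n) (axisVar i) q f = 0 :=
      coeff_weightedSubst_eq_zero (axisWeight_ne_zero i hn) _ hf hqp
    rw [h1, Polynomial.rootMultiplicity_zero, Polynomial.rootMultiplicity_zero]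
  · exact h c
  · exact absurd (hq d (hd.trans_lt hqp)) hd0

theorem exists_weight_eq_of_ne_zero (w : Fin 2 → ℕ) {f : MvPowerSeries (Fin 2) ℂ} (hf : f ≠ 0) :
    ∃ p, (∀ d, Finsupp.weight w d < p → coeff d f = 0) ∧
      ∃ d, Finsupp.weight w d = p ∧ coeff d f ≠ 0 := by
  classical
  have h : ∃ p, ∃ d, Finsupp.weight w d = p ∧ coeff d f ≠ 0 := by
    by_contra! h
    refine hf (MvPowerSeries.ext fun d => ?_)
    exact h _ d rfl
  exact ⟨Nat.find h, fun d hd => by_contra fun hd0 => Nat.find_min h hd ⟨d, rfl, hd0⟩,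
    Nat.find_spec h⟩

theorem exists_rootMultiplicity_le (P : Polynomial ℂ) :
    ∃ a, ∀ c, P.rootMultiplicity c ≤ P.rootMultiplicity a := by
  have h : BddAbove (Set.range fun c => P.rootMultiplicity c) := by
    refine ⟨P.roots.card, ?_⟩
    rintro _ ⟨c, rfl⟩
    classical
    change P.rootMultiplicity c ≤ _
    rw [← Polynomial.count_roots]
    exact Multiset.count_le_card _ _
  obtain ⟨a, ha⟩ := Nat.sSup_mem (Set.range_nonempty _) h
  exact ⟨a, fun c => (le_csSup h ⟨c, rfl⟩).trans ha.ge⟩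

/-- The number `a` is a root of maximal multiplicity of the dehomogenised leading term, and the
shear moves it to 0. The higher coefficients of `c₁` remain arbitrary, which the recursive
construction needs. -/
theorem exists_isBalanced_shear (hij : i ≠ j) {n : ℕ} (hn : n ≠ 0)
    (f : MvPowerSeries (Fin 2) ℂ) (hf0 : f ≠ 0) :
    ∃ a, ∀ (c₁ : PowerSeries ℂ) (hc : PowerSeries.constantCoeff (PowerSeries.X ^ n * c₁) = 0),
      PowerSeries.constantCoeff c₁ = a → IsBalanced i n (shear hij hc f) := by
  obtain ⟨p, hp, d, hd, hd0⟩ := exists_weight_eq_of_ne_zero (axisWeight i n) hf0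
  obtain ⟨a, ha⟩ := exists_rootMultiplicity_le (initForm (axisWeight i n) (axisVar i) p f)
  refine ⟨a, fun c₁ hc hc₁ => ?_⟩
  have hw := axisWeight_ne_zero i hn
  have h1 : axisWeight i n i = axisWeight i n j * n := by
    rw [axisWeight_self, axisWeight_of_ne hij, one_mul]
  refine isBalanced_of_rootMultiplicity_le hn (p := p) (fun d hd => coeff_shear_eq_zero hij hw h1.le hc hp hd) ?_ ?_
  · by_contra! hcon
    refine hd0 (coeff_eq_zero_of_shear hij hw h1.le hc (p := p + 1) (fun d hd => ?_) (by omega))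
    rcases Nat.lt_succ_iff_lt_or_eq.mp hd with hd | hd
    · exact coeff_shear_eq_zero hij hw h1.le hc hp hd
    · exact hcon d hd
  · intro c
    rw [initForm_axis_shear hij hn hc hp, rootMultiplicity_comp_X_add_C,
      rootMultiplicity_comp_X_add_C, hc₁, zero_add]
    exact ha _

end InitShear

end

end NewtonPolyhedron

namespace NewtonPolyhedron

noncomputable section

open MvPowerSeries

/-! ### Automorphisms approximated by convergent automorphisms -/

/-- An order preserving automorphism of the algebra of formal power series that can be approximated
to any order by order preserving automorphisms respecting convergence. -/
def IsApproximable {σ : Type*} (Φ : MvPowerSeries σ ℂ ≃ₐ[ℂ] MvPowerSeries σ ℂ) : Prop :=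
  (∀ f, (Φ f).order = f.order) ∧ ∀ M : ℕ, ∃ Ψ : MvPowerSeries σ ℂ ≃ₐ[ℂ] MvPowerSeries σ ℂ,
    (∀ f, IsConvergent (Ψ f) ↔ IsConvergent f) ∧ (∀ f, (Ψ f).order = f.order) ∧
      ∀ f, (M : ℕ∞) ≤ (Ψ f - Φ f).order

theorem IsApproximable.refl {σ : Type*} :
    IsApproximable (AlgEquiv.refl : MvPowerSeries σ ℂ ≃ₐ[ℂ] MvPowerSeries σ ℂ) :=
  ⟨fun _ => rfl, fun M => ⟨AlgEquiv.refl, fun _ => Iff.rfl, fun _ => rfl, fun f => by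
    rw [sub_self, order_zero]
    exact le_top⟩⟩

/-- The first approximation error passes through `Ψ₂` without loss because `Ψ₂` preserves orders. -/
theorem IsApproximable.trans {σ : Type*} {Φ₁ Φ₂ : MvPowerSeries σ ℂ ≃ₐ[ℂ] MvPowerSeries σ ℂ}
    (h₁ : IsApproximable Φ₁) (h₂ : IsApproximable Φ₂) : IsApproximable (Φ₁.trans Φ₂) := by
  refine ⟨fun f => (h₂.1 _).trans (h₁.1 f), fun M => ?_⟩
  obtain ⟨Ψ₁, hc₁, ho₁, hΨ₁⟩ := h₁.2 M
  obtain ⟨Ψ₂, hc₂, ho₂, hΨ₂⟩ := h₂.2 M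
  refine ⟨Ψ₁.trans Ψ₂, fun f => (hc₂ _).trans (hc₁ f), fun f => (ho₂ _).trans (ho₁ f), fun f => ?_⟩
  have h : Ψ₂ (Ψ₁ f) - Φ₂ (Φ₁ f) = Ψ₂ (Ψ₁ f - Φ₁ f) + (Ψ₂ (Φ₁ f) - Φ₂ (Φ₁ f)) := by
    rw [map_sub]; ring
  change (M : ℕ∞) ≤ (Ψ₂ (Ψ₁ f) - Φ₂ (Φ₁ f)).order
  rw [h]
  refine le_trans (le_min ?_ (hΨ₂ _)) min_order_le_add
  rw [ho₂]
  exact hΨ₁ f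

theorem isConvergent_axisSeries_coe {σ : Type*} [Finite σ] (j : σ) (q : Polynomial ℂ) :
    IsConvergent (axisSeries j (q : PowerSeries ℂ)) := by
  rw [axisSeries, PowerSeries.subst_coe (PowerSeries.HasSubst.X j), Polynomial.aeval_eq_sum_range]
  refine IsConvergent.sum _ fun k _ => ?_
  exact (convergentPowerSeries σ).smul_mem
    ((convergentPowerSeries σ).pow_mem (isConvergent_X j) k) _

section Shear

variable {σ : Type*} [DecidableEq σ] {i j : σ}

theorem isConvergent_shear_coe [Finite σ] (hij : i ≠ j) {q : Polynomial ℂ}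
    (hq : PowerSeries.constantCoeff (q : PowerSeries ℂ) = 0) {f : MvPowerSeries σ ℂ}
    (hf : IsConvergent f) : IsConvergent (shear hij hq f) := by
  rw [shear_apply]
  refine IsConvergent.subst (fun k => ?_) (constantCoeff_shearFun hq) hf
  rw [shearFun]
  rcases eq_or_ne k i with rfl | hk
  · rw [Function.update_self]
    exact (isConvergent_X k).add (isConvergent_axisSeries_coe j q)
  · rw [Function.update_of_ne hk]
    exact isConvergent_X k

/-- A monomial and its image under the shear agree modulo `e(x_j)`, whose order is at least `M`. -/
theorem le_order_shear_sub [Finite σ] (hij : i ≠ j) {e : PowerSeries ℂ}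
    (he : PowerSeries.constantCoeff e = 0) {M : ℕ} (hM : PowerSeries.X ^ M ∣ e)
    (f : MvPowerSeries σ ℂ) : (M : ℕ∞) ≤ (shear hij he f - f).order := by
  have hax : (M : ℕ∞) ≤ (axisSeries j e).order := by
    obtain ⟨e', rfl⟩ := hM
    rw [axisSeries, PowerSeries.subst_mul (PowerSeries.HasSubst.X j),
      PowerSeries.subst_pow (PowerSeries.HasSubst.X j),
      PowerSeries.subst_X (PowerSeries.HasSubst.X j)]
    refine le_trans ?_ le_order_mul
    refine le_trans ?_ le_self_add
    rw [X_pow_eq, order_monomial_of_ne_zero one_ne_zero, Finsupp.degree_single]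
  refine le_order_sub_of_coeff fun m hm => ?_
  rw [shear_apply, coeff_subst (hasSubst_shearFun he)]
  conv_rhs => rw [← subst_X_eq f, coeff_subst (hasSubst_of_constantCoeff_zero fun k =>
    constantCoeff_X k)]
  refine finsum_congr fun d => ?_
  congr 1
  have h : Ideal.Quotient.mk (Ideal.span {axisSeries j e}) (d.prod fun k n => shearFun i j e k ^ n) =
      Ideal.Quotient.mk (Ideal.span {axisSeries j e}) (d.prod fun k n => X k ^ n) := by
    rw [map_finsuppProd, map_finsuppProd]
    refine Finsupp.prod_congr fun k _ => ?_
    rw [map_pow, map_pow]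
    congr 1
    rw [Ideal.Quotient.eq, Ideal.mem_span_singleton, shearFun]
    rcases eq_or_ne k i with rfl | hk
    · rw [Function.update_self, add_sub_cancel_left]
    · rw [Function.update_of_ne hk, sub_self]
      exact dvd_zero _
  rw [Ideal.Quotient.eq, Ideal.mem_span_singleton] at h
  obtain ⟨z, hz⟩ := h
  refine sub_eq_zero.mp ?_
  rw [← map_sub, hz]
  refine coeff_of_lt_order ?_
  refine lt_of_lt_of_le ?_ le_order_mul
  refine lt_of_lt_of_le ?_ (hax.trans le_self_add)
  exact_mod_cast hm

/-- Truncating `c` gives a polynomial shear, which preserves convergence together with its inverse.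
It differs from the original by a shear with a series divisible by `X ^ M`. -/
theorem isApproximable_shear [Finite σ] (hij : i ≠ j) {c : PowerSeries ℂ}
    (hc : PowerSeries.constantCoeff c = 0) : IsApproximable (shear hij hc) := by
  refine ⟨order_shear hij hc, fun M => ?_⟩
  set q := PowerSeries.trunc (M + 1) c with hq
  have hq0 : PowerSeries.constantCoeff (q : PowerSeries ℂ) = 0 := by
    rw [← PowerSeries.coeff_zero_eq_constantCoeff_apply, Polynomial.coeff_coe, hq,
      PowerSeries.coeff_trunc, if_pos (by omega), PowerSeries.coeff_zero_eq_constantCoeff_apply, hc]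
  have hqn : PowerSeries.constantCoeff ((-q : Polynomial ℂ) : PowerSeries ℂ) = 0 := by
    rw [Polynomial.coe_neg, map_neg, hq0, neg_zero]
  have he : PowerSeries.constantCoeff ((q : PowerSeries ℂ) - c) = 0 := by
    rw [map_sub, hq0, hc, sub_zero]
  refine ⟨shear hij hq0, fun f => ⟨fun h => ?_, isConvergent_shear_coe hij hq0⟩,
    order_shear hij hq0, fun f => ?_⟩
  · have h1 := isConvergent_shear_coe hij hqn h
    have h2 : shear hij hqn (shear hij hq0 f) = f := by
      rw [shear_shear hij hqn hq0 (by rw [map_add, hqn, hq0, add_zero]), shear_apply]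
      simp only [Polynomial.coe_neg, neg_add_cancel]
      rw [shearFun_zero, subst_X_eq]
    rwa [h2] at h1
  · have h1 : shear hij hq0 f = shear hij hc (shear hij he f) := by
      rw [shear_shear hij hc he (by rw [add_sub_cancel, hq0]), shear_apply, shear_apply,
        add_sub_cancel]
    rw [h1, ← map_sub, order_shear]
    refine le_order_shear_sub hij he ?_ f
    rw [PowerSeries.X_pow_dvd_iff]
    intro m hm
    rw [map_sub, Polynomial.coeff_coe, hq, PowerSeries.coeff_trunc, if_pos (by omega), sub_self]

end Shear

/-! ### Balancing by shears -/

section Balance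

variable {i j : Fin 2}

theorem weight_axisWeight_one (i : Fin 2) (d : Fin 2 →₀ ℕ) :
    Finsupp.weight (axisWeight i 1) d = d.degree := by
  rw [axisWeight, ← Pi.one_apply (M := fun _ => ℕ) i, Function.update_eq_self]
  exact (DFunLike.congr_fun Finsupp.degree_eq_weight_one d).symm

/-- The hypothesis says that `x_i ^ k` divides the initial form; replacing `x_j` leaves that factor
intact. -/
theorem X_pow_dvd_initForm_update {w : Fin 2 → ℕ} (hw : ∀ k, w k ≠ 0) (hij : i ≠ j) {k p : ℕ}
    {f : MvPowerSeries (Fin 2) ℂ} (h : Polynomial.X ^ k ∣ initForm w (axisVar i) p f)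
    (u : Polynomial ℂ) :
    Polynomial.X ^ k ∣ initForm w (Function.update (axisVar i) j u) p f := by
  rw [initForm_eq hw]
  refine finsum_induction (fun q => Polynomial.X ^ k ∣ q) (dvd_zero _) (fun _ _ => dvd_add)
    fun d => ?_
  rcases eq_or_ne (Finsupp.weight w d) p with rfl | hd
  · rw [if_pos rfl]
    rcases lt_or_ge (d i) k with hk | hk
    · rw [← coeff_initForm hw hij (axisVar_self i) (axisVar_of_ne hij),
        Polynomial.X_pow_dvd_iff.mp h _ hk, zero_smul]
      exact dvd_zero _
    · refine dvd_smul_of_dvd _ ?_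
      rw [prod_fin_two_eq hij, Function.update_of_ne hij, axisVar_self]
      exact (pow_dvd_pow _ hk).mul_right _
  · rw [if_neg hd, smul_zero]
    exact dvd_zero _

theorem shear_congr {c c' : PowerSeries ℂ} (h : c = c') (hij : i ≠ j)
    (hc : PowerSeries.constantCoeff c = 0) (hc' : PowerSeries.constantCoeff c' = 0)
    (f : MvPowerSeries (Fin 2) ℂ) : shear hij hc f = shear hij hc' f := by
  subst h
  rfl

theorem exists_max_nat {P : ℕ → Prop} {B : ℕ} (h0 : ∃ k, P k) (hB : ∀ k, P k → k ≤ B) :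
    ∃ k, P k ∧ ∀ l, P l → l ≤ k := by
  have hbdd : BddAbove {k | P k} := ⟨B, fun k hk => hB k hk⟩
  exact ⟨sSup {k | P k}, Nat.sSup_mem h0 hbdd, fun l hl => le_csSup hbdd hl⟩

/-- Here both variables use the ordinary degree, so balancing one could spoil the other. Extremality
over all approximable automorphisms avoids this: any root of larger multiplicity could be sheared to
0, contradicting a maximum. -/
theorem exists_isApproximable_isBalanced_one (hij : i ≠ j) {f : MvPowerSeries (Fin 2) ℂ}
    (hf : f ≠ 0) : ∃ Φ : MvPowerSeries (Fin 2) ℂ ≃ₐ[ℂ] MvPowerSeries (Fin 2) ℂ,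
      IsApproximable Φ ∧ IsBalanced i 1 (Φ f) ∧ IsBalanced j 1 (Φ f) := by
  obtain ⟨p, hp⟩ := ENat.ne_top_iff_exists.mp (ne_zero_iff_order_finite.mp hf |> fun h => by
    rw [← h]; exact ENat.natCast_ne_top _ : f.order ≠ ⊤)
  have hw : ∀ i k, axisWeight i 1 k ≠ 0 := fun i => axisWeight_ne_zero i one_ne_zero
  have hlow : ∀ {Φ : MvPowerSeries (Fin 2) ℂ ≃ₐ[ℂ] MvPowerSeries (Fin 2) ℂ}, IsApproximable Φ →
      ∀ i d, Finsupp.weight (axisWeight i 1) d < p → coeff d (Φ f) = 0 := by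
    intro Φ hΦ i d hd
    rw [weight_axisWeight_one] at hd
    refine coeff_of_lt_order ?_
    rw [hΦ.1, ← hp]
    exact_mod_cast hd
  have hex : ∀ {Φ : MvPowerSeries (Fin 2) ℂ ≃ₐ[ℂ] MvPowerSeries (Fin 2) ℂ}, IsApproximable Φ →
      ∀ i, ∃ d, Finsupp.weight (axisWeight i 1) d = p ∧ coeff d (Φ f) ≠ 0 := by
    intro Φ hΦ i
    obtain ⟨d, hd0, hd⟩ := exists_coeff_ne_zero_and_order (f := Φ f) (by rw [hΦ.1, ← hp]; rfl)
    refine ⟨d, ?_, hd0⟩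
    rw [weight_axisWeight_one]
    rw [hΦ.1, ← hp] at hd
    exact_mod_cast hd
  set F : Fin 2 → (MvPowerSeries (Fin 2) ℂ ≃ₐ[ℂ] MvPowerSeries (Fin 2) ℂ) → Polynomial ℂ :=
    fun i Φ => initForm (axisWeight i 1) (axisVar i) p (Φ f) with hF
  have hF0 : ∀ {i j}, i ≠ j → ∀ {Φ}, IsApproximable Φ → ∃ r ≤ p, (F i Φ).coeff r ≠ 0 := by
    intro i j hij Φ hΦ
    obtain ⟨d, rfl, hd0⟩ := hex hΦ i
    refine ⟨d i, ?_, ?_⟩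
    · rw [weight_axisWeight_one]
      exact Finsupp.le_degree i d
    · rwa [hF, coeff_initForm (hw i) hij (axisVar_self i) (axisVar_of_ne hij)]
  have hbd : ∀ {i j}, i ≠ j → ∀ {Φ}, IsApproximable Φ → ∀ k, Polynomial.X ^ k ∣ F i Φ → k ≤ p := by
    intro i j hij Φ hΦ k hk
    obtain ⟨r, hr, hr0⟩ := hF0 hij hΦ
    by_contra! hcon
    exact hr0 (Polynomial.X_pow_dvd_iff.mp hk r (by omega))
  have hshear : ∀ {i j} (hij : i ≠ j) {Φ}, IsApproximable Φ → ∀ a : ℂ,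
      ∃ Φ', IsApproximable Φ' ∧ F i Φ' = (F i Φ).comp (Polynomial.X + Polynomial.C a) ∧
        ∀ k, Polynomial.X ^ k ∣ F j Φ → Polynomial.X ^ k ∣ F j Φ' := by
    intro i j hij Φ hΦ a
    have hc : PowerSeries.constantCoeff (PowerSeries.X ^ 1 * PowerSeries.C a) = 0 := by simp
    refine ⟨Φ.trans (shear hij hc), hΦ.trans (isApproximable_shear hij hc), ?_, fun k hk => ?_⟩
    · have h1 := initForm_axis_shear hij one_ne_zero hc (hlow hΦ i)
      rwa [PowerSeries.constantCoeff_C] at h1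
    · have h2 := initForm_shear hij (hw j) (axisVar j) (n := 1) (by
        rw [axisWeight_self, axisWeight_of_ne hij.symm]) hc (hlow hΦ j)
      change Polynomial.X ^ k ∣ initForm (axisWeight j 1) (axisVar j) p (shear hij hc (Φ f))
      rw [h2]
      exact X_pow_dvd_initForm_update (hw j) hij.symm hk _
  have hroot : ∀ (P : Polynomial ℂ) (c : ℂ), Polynomial.X ^ P.rootMultiplicity c ∣
      P.comp (Polynomial.X + Polynomial.C c) := by
    intro P c
    have h1 := Polynomial.pow_rootMultiplicity_dvd (P.comp (Polynomial.X + Polynomial.C c)) 0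
    rwa [rootMultiplicity_comp_X_add_C, zero_add, map_zero, sub_zero] at h1
  have hbal : ∀ {i j}, i ≠ j → ∀ {Φ}, IsApproximable Φ → ∀ {k}, Polynomial.X ^ k ∣ F i Φ →
      (∀ c, (F i Φ).rootMultiplicity c ≤ k) → IsBalanced i 1 (Φ f) := by
    intro i j hij Φ hΦ k hk h
    refine isBalanced_of_rootMultiplicity_le one_ne_zero (hlow hΦ i) (hex hΦ i) fun c => ?_
    refine (h c).trans ?_
    rw [Polynomial.le_rootMultiplicity_iff, map_zero, sub_zero]
    · exact hk
    · obtain ⟨r, -, hr⟩ := hF0 hij hΦ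
      intro h0
      apply hr
      rw [show F i Φ = 0 from h0, Polynomial.coeff_zero]
  obtain ⟨M₁, ⟨Φ₁, hΦ₁, hM₁⟩, hmax₁⟩ := exists_max_nat
    (P := fun k => ∃ Φ, IsApproximable Φ ∧ Polynomial.X ^ k ∣ F i Φ) (B := p)
    ⟨0, AlgEquiv.refl, IsApproximable.refl, by simp⟩ fun k ⟨Φ, hΦ, hk⟩ => hbd hij hΦ k hk
  -- The second maximum is taken only over automorphisms that already attain the first; shears in
  -- `x_j` preserve this property because they leave `x_i` fixed.
  obtain ⟨M₂, ⟨Φ, hΦ, hM₁', hM₂⟩, hmax₂⟩ := exists_max_nat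
    (P := fun k => ∃ Φ, IsApproximable Φ ∧ Polynomial.X ^ M₁ ∣ F i Φ ∧ Polynomial.X ^ k ∣ F j Φ)
    (B := p) ⟨0, Φ₁, hΦ₁, hM₁, by simp⟩ fun k ⟨Φ, hΦ, _, hk⟩ => hbd hij.symm hΦ k hk
  refine ⟨Φ, hΦ, hbal hij hΦ hM₁' fun c => ?_, hbal hij.symm hΦ hM₂ fun c => ?_⟩
  · obtain ⟨Φ', hΦ', h1, -⟩ := hshear hij hΦ c
    exact hmax₁ _ ⟨Φ', hΦ', by rw [h1]; exact hroot _ c⟩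
  · obtain ⟨Φ', hΦ', h1, h2⟩ := hshear hij.symm hΦ c
    exact hmax₂ _ ⟨Φ', hΦ', h2 _ hM₁', by rw [h1]; exact hroot _ c⟩

/-- Recursive choice in which each term depends on all earlier ones, padded by zeros. -/
theorem exists_seq_of_prefix {α : Type*} [Zero α] {Q : ℕ → (ℕ → α) → α → Prop}
    (h : ∀ n g, ∃ a, Q n g a) : ∃ c : ℕ → α, ∀ n, Q n (fun k => if k < n then c k else 0) (c n) := by
  choose F hF using h
  let c : ℕ → α := fun n => WellFounded.fix (C := fun _ => α) (measure (id : ℕ → ℕ)).wf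
    (fun n ih => F n fun k => if hk : k < n then ih k hk else 0) n
  have hc : ∀ n, c n = F n fun k => if k < n then c k else 0 := fun n => by
    have h1 := WellFounded.fix_eq (C := fun _ => α) (measure (id : ℕ → ℕ)).wf
      (fun n ih => F n fun k => if hk : k < n then ih k hk else 0) n
    refine h1.trans ?_
    congr 1
  exact ⟨c, fun n => by rw [hc n]; exact hF n _⟩

/-- The power series with coefficients `g k`, omitting those with `k < 2`. -/
def tailSeries (g : ℕ → ℂ) : PowerSeries ℂ := PowerSeries.mk fun k => if 2 ≤ k then g k else 0

theorem constantCoeff_tailSeries (g : ℕ → ℂ) : PowerSeries.constantCoeff (tailSeries g) = 0 := by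
  rw [← PowerSeries.coeff_zero_eq_constantCoeff_apply, tailSeries, PowerSeries.coeff_mk,
    if_neg (by omega)]

/-- One shear serves all `n`: its coefficient at `n` is chosen after the preceding ones have been
applied, and the subsequent ones do not affect weight `n`. -/
theorem exists_shear_isBalanced (hij : i ≠ j) {f : MvPowerSeries (Fin 2) ℂ} (hf : f ≠ 0)
    (h1 : IsBalanced i 1 f) : ∃ g : ℕ → ℂ, ∀ n, n ≠ 0 →
      IsBalanced i n (shear hij (constantCoeff_tailSeries g) f) := by
  -- The requirement on `a` quantifies over all continuations `c₁` with constant term `a`, so later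
  -- choices cannot invalidate it.
  obtain ⟨g, hg⟩ := exists_seq_of_prefix (Q := fun n g a => 2 ≤ n →
    ∀ (c₁ : PowerSeries ℂ) (hc : PowerSeries.constantCoeff (PowerSeries.X ^ n * c₁) = 0),
      PowerSeries.constantCoeff c₁ = a →
        IsBalanced i n (shear hij hc (shear hij (constantCoeff_tailSeries g) f))) fun n g => by
    rcases eq_or_ne n 0 with rfl | hn
    · exact ⟨0, fun h => absurd h (by omega)⟩
    · obtain ⟨a, ha⟩ := exists_isBalanced_shear hij hn
        (shear hij (constantCoeff_tailSeries g) f) (by simpa using hf)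
      exact ⟨a, fun _ => ha⟩
  refine ⟨g, fun n hn => ?_⟩
  have key : ∀ n ≥ 1, ∃ c₁ : PowerSeries ℂ, PowerSeries.constantCoeff c₁ =
      (if 2 ≤ n then g n else 0) ∧ tailSeries g = PowerSeries.X ^ n * c₁ +
        tailSeries fun k => if k < n then g k else 0 := by
    intro n hn
    refine ⟨PowerSeries.mk fun k => if 2 ≤ k + n then g (k + n) else 0, ?_, ?_⟩
    · rw [← PowerSeries.coeff_zero_eq_constantCoeff_apply, PowerSeries.coeff_mk, zero_add]
    · ext k
      rw [map_add, PowerSeries.coeff_X_pow_mul', tailSeries, tailSeries, PowerSeries.coeff_mk]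
      by_cases hk : n ≤ k
      · rw [if_pos hk, PowerSeries.coeff_mk, PowerSeries.coeff_mk, Nat.sub_add_cancel hk,
          if_neg (by omega : ¬ k < n)]
        simp
      · rw [if_neg hk, zero_add, PowerSeries.coeff_mk, if_pos (by omega : k < n)]
  obtain ⟨c₁, hc₁, hg₁⟩ := key n (by omega)
  have hc : PowerSeries.constantCoeff (PowerSeries.X ^ n * c₁) = 0 := by simp [hn]
  have heq : shear hij (constantCoeff_tailSeries g) f = shear hij hc
      (shear hij (constantCoeff_tailSeries fun k => if k < n then g k else 0) f) := by
    rw [shear_shear hij hc _ (by rw [← hg₁]; exact constantCoeff_tailSeries g)]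
    exact shear_congr hg₁ hij _ _ f
  rw [heq]
  by_cases h2 : 2 ≤ n
  · exact hg n h2 c₁ hc (by rw [hc₁, if_pos h2])
  -- For `n = 1` the prefix is empty and the series has no linear term, so the balance assumed at
  -- the start persists.
  · obtain rfl : n = 1 := by omega
    have h3 : (tailSeries fun k => if k < 1 then g k else 0) = 0 := by
      ext k
      rw [tailSeries, PowerSeries.coeff_mk, map_zero]
      split_ifs <;> first | rfl | omega
    have h4 : shear hij (constantCoeff_tailSeries fun k => if k < 1 then g k else 0) f = f := by
      rw [shear_congr h3 hij _ (map_zero _), shear_apply, shearFun_zero, subst_X_eq]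
    rw [h4]
    exact h1.shear_self hij one_ne_zero hc (by rw [hc₁, if_neg h2])

theorem IsBalanced.shear_tailSeries (hij : i ≠ j) (g : ℕ → ℂ) {m : ℕ} (hm : m ≠ 0)
    {f : MvPowerSeries (Fin 2) ℂ} (hf : IsBalanced j m f) :
    IsBalanced j m (shear hij (constantCoeff_tailSeries g) f) := by
  obtain ⟨c₁, hc₁⟩ : PowerSeries.X ^ 2 ∣ tailSeries g := by
    rw [PowerSeries.X_pow_dvd_iff]
    intro k hk
    rw [tailSeries, PowerSeries.coeff_mk, if_neg (by omega)]
  rw [shear_congr hc₁ hij _ (by rw [← hc₁]; exact constantCoeff_tailSeries g)]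
  exact hf.shear_of_ne hij hm (by omega) _

/-- Both variables are balanced at weight 1, then `x_0` and then `x_1` at all weights. The later
shears start in degree 2, so they preserve the balance already obtained in the other variable. -/
theorem exists_isApproximable_isBalanced {f : MvPowerSeries (Fin 2) ℂ} (hf : f ≠ 0) :
    ∃ Φ : MvPowerSeries (Fin 2) ℂ ≃ₐ[ℂ] MvPowerSeries (Fin 2) ℂ, IsApproximable Φ ∧
      ∀ i n, n ≠ 0 → IsBalanced i n (Φ f) := by
  have h01 : (0 : Fin 2) ≠ 1 := by decide
  obtain ⟨Φ, hΦ, h0, h1⟩ := exists_isApproximable_isBalanced_one h01 hf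
  have hf₁ : Φ f ≠ 0 := by simpa using hf
  obtain ⟨g, hg⟩ := exists_shear_isBalanced h01 hf₁ h0
  have h1' := h1.shear_tailSeries h01 g one_ne_zero
  set S := shear h01 (constantCoeff_tailSeries g) with hS
  have hf₂ : S (Φ f) ≠ 0 := by simpa using hf
  obtain ⟨g', hg'⟩ := exists_shear_isBalanced h01.symm hf₂ h1'
  refine ⟨(Φ.trans S).trans (shear h01.symm (constantCoeff_tailSeries g')),
    (hΦ.trans (isApproximable_shear _ _)).trans (isApproximable_shear _ _), fun i n hn => ?_⟩
  fin_cases i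
  · exact (hg n hn).shear_tailSeries h01.symm g' hn
  · exact hg' n hn

end Balance

end

end NewtonPolyhedron

namespace NewtonPolyhedron

noncomputable section

open MvPowerSeries

/-! ### Factorization of weighted homogeneous series -/

/-- Each prime `p` in the product divides either `q`, and is then associated to it, or the cofactor,
and then cancels. Only the primality of the listed factors is used. -/
theorem exists_mem_associated_of_dvd_prod {R : Type*} [CommRing R] [IsDomain R] {q : R}
    (hq : Irreducible q) {s : Multiset R} (hs : ∀ p ∈ s, Prime p) (h : q ∣ s.prod) :
    ∃ p ∈ s, Associated q p := by
  induction s using Multiset.induction with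
  | empty => exact absurd (isUnit_of_dvd_one (by simpa using h)) hq.not_isUnit
  | cons p s ih =>
    have hp := hs p (Multiset.mem_cons_self p s)
    rw [Multiset.prod_cons] at h
    obtain ⟨z, hz⟩ := h
    rcases hp.dvd_or_dvd ⟨s.prod, hz.symm⟩ with h1 | ⟨z', rfl⟩
    · exact ⟨p, Multiset.mem_cons_self p s, (hp.irreducible.associated_of_dvd hq h1).symm⟩
    · rw [mul_left_comm] at hz
      obtain ⟨r, hr, hqr⟩ := ih (fun r hr => hs r (Multiset.mem_cons_of_mem hr))
        ⟨z', mul_left_cancel₀ hp.ne_zero hz⟩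
      exact ⟨r, Multiset.mem_cons_of_mem hr, hqr⟩

section Factor

variable {i j : Fin 2} {n : ℕ}

theorem axisSeries_X_pow_mul_C (j : Fin 2) (n : ℕ) (c : ℂ) :
    axisSeries j (PowerSeries.X ^ n * PowerSeries.C c) = X j ^ n * C c := by
  have h := PowerSeries.HasSubst.X (S := ℂ) j
  rw [axisSeries, PowerSeries.subst_mul h, PowerSeries.subst_pow h, PowerSeries.subst_X h,
    PowerSeries.subst_C]

/-- A shear is an automorphism carrying the prime `x_i` to this element. -/
theorem prime_X_sub (hij : i ≠ j) (hn : n ≠ 0) (c : ℂ) :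
    Prime (X i - C c * X j ^ n : MvPowerSeries (Fin 2) ℂ) := by
  have hc : PowerSeries.constantCoeff (PowerSeries.X ^ n * PowerSeries.C (-c)) = 0 := by simp [hn]
  have h : shear hij hc (X i) = X i - C c * X j ^ n := by
    rw [shear_X_self, axisSeries_X_pow_mul_C, map_neg]
    ring
  rw [← h]
  exact (MulEquiv.prime_iff (shear hij hc).toMulEquiv).mpr (prime_X_fin_two i)

/-- The substitution `x_i ↦ X ^ n * t`, `x_j ↦ X`. -/
def axisSubst (i : Fin 2) (hn : n ≠ 0) :
    MvPowerSeries (Fin 2) ℂ →ₐ[ℂ] PowerSeries (Polynomial ℂ) :=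
  substAlgHom (hasSubst_weighted (axisWeight_ne_zero i hn) fun k => PowerSeries.C (axisVar i k))

theorem axisSubst_apply (hn : n ≠ 0) (f : MvPowerSeries (Fin 2) ℂ) : axisSubst i hn f =
    weightedSubst (axisWeight i n) (fun k => PowerSeries.C (axisVar i k)) f := by
  rw [axisSubst, coe_substAlgHom]
  rfl

theorem axisSubst_X_self (hn : n ≠ 0) :
    axisSubst i hn (X i) = PowerSeries.X ^ n * PowerSeries.C Polynomial.X := by
  rw [axisSubst_apply, weightedSubst, subst_X (hasSubst_weighted (axisWeight_ne_zero i hn) _),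
    axisWeight_self, axisVar_self]

theorem axisSubst_X_of_ne (hij : i ≠ j) (hn : n ≠ 0) : axisSubst i hn (X j) = PowerSeries.X := by
  rw [axisSubst_apply, weightedSubst, subst_X (hasSubst_weighted (axisWeight_ne_zero i hn) _),
    axisWeight_of_ne hij, axisVar_of_ne hij, pow_one, map_one, mul_one]

theorem axisSubst_C (hn : n ≠ 0) (c : ℂ) :
    axisSubst i hn (C c) = PowerSeries.C (Polynomial.C c) :=
  ((axisSubst i hn).commutes c).trans MvPowerSeries.algebraMap_apply

theorem axisSubst_X_sub (hij : i ≠ j) (hn : n ≠ 0) (c : ℂ) :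
    axisSubst i hn (X i - C c * X j ^ n) =
      PowerSeries.X ^ n * PowerSeries.C (Polynomial.X - Polynomial.C c) := by
  rw [map_sub, map_mul, map_pow, axisSubst_X_self, axisSubst_C, axisSubst_X_of_ne hij, map_sub]
  ring

theorem initForm_eq_zero {w : Fin 2 → ℕ} (hw : ∀ k, w k ≠ 0) (e : Fin 2 → Polynomial ℂ) {p : ℕ}
    {f : MvPowerSeries (Fin 2) ℂ} (h : ∀ d, Finsupp.weight w d = p → coeff d f = 0) :
    initForm w e p f = 0 := by
  rw [initForm_eq hw]
  refine finsum_eq_zero_of_forall_eq_zero fun d => ?_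
  split_ifs with hd
  · rw [h d hd, zero_smul]
  · rw [smul_zero]

variable {G : MvPowerSeries (Fin 2) ℂ} {p : ℕ}

theorem axisSubst_of_homogeneous (hn : n ≠ 0)
    (hG : ∀ d, Finsupp.weight (axisWeight i n) d ≠ p → coeff d G = 0) :
    axisSubst i hn G =
      PowerSeries.X ^ p * PowerSeries.C (initForm (axisWeight i n) (axisVar i) p G) := by
  ext1 q
  rw [PowerSeries.coeff_X_pow_mul', PowerSeries.coeff_C, axisSubst_apply]
  rcases eq_or_ne q p with rfl | hq
  · rw [if_pos le_rfl, if_pos (tsub_self _)]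
    rfl
  · have h : initForm (axisWeight i n) (axisVar i) q G = 0 :=
      initForm_eq_zero (axisWeight_ne_zero i hn) _ fun d hd => hG d (hd ▸ hq)
    refine Eq.trans h ?_
    split_ifs <;> first | rfl | omega

/-- A monomial of weight `p` containing `x_i ^ s` needs `s * n ≤ p`; this makes the exponent of
`x_j` in the factorization a genuine natural number. -/
theorem natDegree_initForm_mul_le (hij : i ≠ j) (hn : n ≠ 0) :
    (initForm (axisWeight i n) (axisVar i) p G).natDegree * n ≤ p := by
  have hw := axisWeight_ne_zero i hn
  set P := initForm (axisWeight i n) (axisVar i) p G with hP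
  by_cases hP0 : P = 0
  · rw [hP0]
    simp
  have h1 : ∀ s, p < s * n → P.coeff s = 0 := by
    intro s hs
    rw [hP, coeff_initForm_eq hw]
    refine finsum_eq_zero_of_forall_eq_zero fun d => ?_
    split_ifs with hd
    · rw [prod_fin_two_eq hij, axisVar_self, axisVar_of_ne hij, one_pow, mul_one,
        Polynomial.coeff_X_pow, if_neg, mul_zero]
      rintro rfl
      rw [weight_eq hij, axisWeight_self] at hd
      omega
    · rw [mul_zero]
  by_contra! hcon
  exact hP0 (Polynomial.leadingCoeff_eq_zero.mp (h1 _ hcon))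

/-- The substitution `x_i ↦ X ^ n * t`, `x_j ↦ X` is injective and sends `G` to `X ^ p` times a
polynomial in `t`. Splitting that polynomial over `ℂ` and matching images of linear factors gives
the identity upstairs. -/
theorem exists_factorization (hij : i ≠ j) (hn : n ≠ 0)
    (hG : ∀ d, Finsupp.weight (axisWeight i n) d ≠ p → coeff d G = 0) :
    ∃ r, G = C (initForm (axisWeight i n) (axisVar i) p G).leadingCoeff * (X j ^ r *
      ((initForm (axisWeight i n) (axisVar i) p G).roots.map fun c => X i - C c * X j ^ n).prod) := by
  set P := initForm (axisWeight i n) (axisVar i) p G with hP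
  have hinj : Function.Injective (axisSubst i hn) := by
    intro f g h
    rw [axisSubst_apply, axisSubst_apply] at h
    exact weightedSubst_injective (axisWeight_ne_zero i hn) hij (axisVar_self i)
      (axisVar_of_ne hij) h
  refine ⟨p - P.natDegree * n, hinj ?_⟩
  have hsplit := IsAlgClosed.splits P
  have h1 : ∀ s : Multiset ℂ, axisSubst i hn (s.map fun c => X i - C c * X j ^ n).prod =
      PowerSeries.X ^ (s.card * n) *
        PowerSeries.C (s.map fun c => Polynomial.X - Polynomial.C c).prod := by
    intro s
    induction s using Multiset.induction with
    | empty => simp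
    | cons c s ih =>
      rw [Multiset.map_cons, Multiset.prod_cons, map_mul, axisSubst_X_sub hij, ih,
        Multiset.card_cons, Multiset.map_cons, Multiset.prod_cons, map_mul]
      ring
  rw [axisSubst_of_homogeneous hn hG, map_mul, map_mul, map_pow, axisSubst_X_of_ne hij, h1,
    axisSubst_C, ← hP, ← hsplit.natDegree_eq_card_roots]
  conv_lhs => rw [hsplit.eq_prod_roots]
  conv_lhs => rw [← Nat.sub_add_cancel (natDegree_initForm_mul_le (G := G) (p := p) hij hn)]
  rw [map_mul, pow_add]
  ring

/-- By the factorization, for `k > 0` the irreducible `q` is associated to some `x_i - c * x_j ^ n`,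
so `k` is at most the multiplicity of the root `c`, hence of the root 0. -/
theorem X_pow_dvd_of_irreducible_pow_dvd (hij : i ≠ j) (hn : n ≠ 0)
    (hG : ∀ d, Finsupp.weight (axisWeight i n) d ≠ p → coeff d G = 0) (hG0 : G ≠ 0)
    (hbal : ∀ c, (initForm (axisWeight i n) (axisVar i) p G).rootMultiplicity c ≤
      (initForm (axisWeight i n) (axisVar i) p G).rootMultiplicity 0)
    {q : MvPowerSeries (Fin 2) ℂ} (hq : Irreducible q) (hqj : ¬ Associated q (X j)) {k : ℕ}
    (hqk : q ^ k ∣ G) : X i ^ k ∣ G := by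
  have hw := axisWeight_ne_zero i hn
  rcases eq_or_ne k 0 with rfl | hk
  · rw [pow_zero]
    exact one_dvd _
  set P := initForm (axisWeight i n) (axisVar i) p G with hP
  have hP0 : P ≠ 0 := by
    intro h0
    refine hG0 (MvPowerSeries.ext fun d => ?_)
    by_cases hd : Finsupp.weight (axisWeight i n) d = p
    · rw [← coeff_initForm hw hij (axisVar_self i) (axisVar_of_ne hij) G d, hd, ← hP, h0]
      rfl
    · rw [hG d hd, map_zero]
  have hqG : q ∣ G := (dvd_pow_self q hk).trans hqk
  obtain ⟨r, hr⟩ := exists_factorization hij hn hG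
  rw [← hP] at hr
  have hu : IsUnit (C P.leadingCoeff : MvPowerSeries (Fin 2) ℂ) :=
    (isUnit_iff_ne_zero.mpr (by simpa using hP0)).map C
  have hdvd : q ∣ (Multiset.replicate r (X j : MvPowerSeries (Fin 2) ℂ) +
      P.roots.map fun c => X i - C c * X j ^ n).prod := by
    rw [Multiset.prod_add, Multiset.prod_replicate]
    rw [hr] at hqG
    exact hu.dvd_mul_left.mp hqG
  have : IsDomain (MvPowerSeries (Fin 2) ℂ) := NoZeroDivisors.to_isDomain _
  obtain ⟨L, hL, hqL⟩ := exists_mem_associated_of_dvd_prod hq (fun L hL => by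
    rcases Multiset.mem_add.mp hL with hL | hL
    · rw [Multiset.eq_of_mem_replicate hL]
      exact prime_X_fin_two j
    · obtain ⟨c, -, rfl⟩ := Multiset.mem_map.mp hL
      exact prime_X_sub hij hn c) hdvd
  rcases Multiset.mem_add.mp hL with hL | hL
  · rw [Multiset.eq_of_mem_replicate hL] at hqL
    exact absurd hqL hqj
  obtain ⟨c, -, rfl⟩ := Multiset.mem_map.mp hL
  obtain ⟨Z, hZ⟩ := ((hqL.pow_pow (n := k)).dvd_iff_dvd_left).mp hqk
  -- The substitution sends the factor to `X ^ n * (t - c)`; comparing coefficients of `X ^ p`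
  -- exhibits the power of `t - c`.
  have hroot : (Polynomial.X - Polynomial.C c) ^ k ∣ P := by
    have h1 := axisSubst_of_homogeneous hn hG
    rw [hZ, map_mul, map_pow, axisSubst_X_sub hij, ← hZ, ← hP] at h1
    have h2 := congrArg (PowerSeries.coeff p) h1
    rw [PowerSeries.coeff_X_pow_mul', if_pos le_rfl, tsub_self, PowerSeries.coeff_zero_C, mul_pow,
      mul_right_comm, ← map_pow, PowerSeries.coeff_mul_C] at h2
    exact ⟨_, h2.symm.trans (mul_comm _ _)⟩
  have hk0 : k ≤ P.rootMultiplicity 0 :=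
    ((Polynomial.le_rootMultiplicity_iff hP0).mpr hroot).trans (hbal c)
  rw [Polynomial.le_rootMultiplicity_iff hP0, map_zero, sub_zero, Polynomial.X_pow_dvd_iff] at hk0
  rw [X_pow_dvd_iff]
  intro d hd
  by_cases hdp : Finsupp.weight (axisWeight i n) d = p
  · rw [← coeff_initForm hw hij (axisVar_self i) (axisVar_of_ne hij) G d, hdp]
    exact hk0 _ hd
  · exact hG d hdp

end Factor

/-! ### Multiplicities of factors of leading terms -/

theorem finiteMultiplicity_X {σ : Type*} (i : σ) {G : MvPowerSeries σ ℂ} (hG : G ≠ 0) :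
    FiniteMultiplicity (X i) G := by
  obtain ⟨d, hd⟩ : ∃ d, coeff d G ≠ 0 := by
    by_contra! h
    exact hG (MvPowerSeries.ext h)
  exact ⟨d i, fun h => hd (X_pow_dvd_iff.mp h d (Nat.lt_succ_self _))⟩

theorem not_X_dvd_saturation {σ : Type*} [Finite σ] (i : σ) {G : MvPowerSeries σ ℂ} (hG : G ≠ 0) :
    ¬ X i ∣ saturation G := by
  classical
  intro h
  refine (finiteMultiplicity_X i hG).not_pow_dvd_of_multiplicity_lt (Nat.lt_succ_self _) ?_
  rw [pow_succ]
  conv_rhs => rw [← monomial_mul_saturation G]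
  refine mul_dvd_mul ?_ h
  rw [X_pow_dvd_iff]
  intro m hm
  rw [coeff_monomial, if_neg]
  rintro rfl
  exact lt_irrefl _ hm

/-- Saturation removes `x_j`, so the exceptional irreducibles associated to `x_j` do not divide it;
any other `q` is controlled by the power of `x_i` in `G`. -/
theorem maxMultiplicity_saturation_le {i j : Fin 2} {G : MvPowerSeries (Fin 2) ℂ} (hG : G ≠ 0)
    (h : ∀ q : MvPowerSeries (Fin 2) ℂ, Irreducible q → ¬ Associated q (X j) →
      ∀ k, q ^ k ∣ G → X i ^ k ∣ G) :
    maxMultiplicity (saturation G) ≤ (monomialExponent G i : ℕ) := by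
  refine iSup_le fun ⟨q, hq⟩ => ?_
  refine Order.le_of_lt_add_one ?_
  have h1 : ((monomialExponent G i : ℕ∞) + 1) = ((monomialExponent G i + 1 : ℕ) : ℕ∞) := by
    push_cast
    rfl
  rw [h1, emultiplicity_lt_iff_not_dvd]
  intro hdvd
  have hsat : saturation G ∣ G := ⟨_, by
    rw [mul_comm]
    exact (monomial_mul_saturation G).symm⟩
  have h2 := h q hq (fun ha => not_X_dvd_saturation j hG (ha.symm.dvd.trans
    ((dvd_pow_self q (Nat.succ_ne_zero _)).trans hdvd))) _ (hdvd.trans hsat)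
  have h3 := (finiteMultiplicity_X i hG).le_multiplicity_of_pow_dvd h2
  exact absurd h3 (not_le.mpr (Nat.lt_succ_self _))

theorem coeff_leadingTerm {σ : Type*} (w : σ → ℕ) (f : MvPowerSeries σ ℂ) (d : σ →₀ ℕ) :
    coeff d (leadingTerm w f) =
      if Finsupp.weight w d = (f.weightedOrder w).toNat then coeff d f else 0 :=
  coeff_weightedHomogeneousComponent w _ d f

/-- The leading term has the same initial form as `f` at the weighted order, so balance applies to
its factorization. -/
theorem IsBalanced.maxMultiplicity_le {i j : Fin 2} (hij : i ≠ j) {n : ℕ} (hn : n ≠ 0)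
    {f : MvPowerSeries (Fin 2) ℂ} (hf : IsBalanced i n f) (hf0 : f ≠ 0) :
    maxMultiplicity (saturation (leadingTerm (axisWeight i n) f)) ≤
      (monomialExponent (leadingTerm (axisWeight i n) f) i : ℕ) := by
  have hw := axisWeight_ne_zero i hn
  set w := axisWeight i n with hwdef
  set p := (f.weightedOrder w).toNat with hp
  have hG : ∀ d, Finsupp.weight w d ≠ p → coeff d (leadingTerm w f) = 0 := fun d hd => by
    rw [coeff_leadingTerm, if_neg hd]
  have hpo : (p : ℕ∞) = f.weightedOrder w := ENat.natCast_toNat ((ne_zero_iff_weightedOrder_finite w).mp hf0 |> fun h => by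
    rw [← h]; exact ENat.natCast_ne_top _)
  have hG0 : leadingTerm w f ≠ 0 := weightedHomogeneousComponent_of_weightedOrder hpo
  refine maxMultiplicity_saturation_le (j := j) hG0 fun q hq hqj k hqk =>
    X_pow_dvd_of_irreducible_pow_dvd hij hn hG hG0 ?_ hq hqj hqk
  have h1 : initForm w (axisVar i) p (leadingTerm w f) = initForm w (axisVar i) p f :=
    initForm_congr hw _ fun d hd => by rw [coeff_leadingTerm, if_pos hd]
  rw [h1]
  refine hf p fun d hd => coeff_eq_zero_of_lt_weightedOrder w ?_
  rw [← hpo]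
  exact_mod_cast hd

end

end NewtonPolyhedron

namespace NewtonPolyhedron

noncomputable section

open MvPowerSeries

/-! ### Normal vectors of compact facets -/

theorem add_mem_newtonPolyhedron {σ : Type*} {f : MvPowerSeries σ ℂ} {x u : σ → ℝ}
    (hx : x ∈ newtonPolyhedron f) (hu : ∀ i, 0 ≤ u i) : x + u ∈ newtonPolyhedron f := by
  have h1 : Convex ℝ ((fun z => z + u) ⁻¹' newtonPolyhedron f) :=
    (convex_convexHull ℝ _).translate_preimage_left u
  refine convexHull_min ?_ h1 hx
  intro v hv
  refine subset_convexHull ℝ _ ?_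
  simp only [Set.mem_iUnion] at hv ⊢
  obtain ⟨n, hn, hv⟩ := hv
  exact ⟨n, hn, fun i => (hv i).trans (le_add_of_nonneg_right (hu i))⟩

theorem coe_mem_newtonPolyhedron {σ : Type*} {f : MvPowerSeries σ ℂ} {n : σ →₀ ℕ}
    (hn : coeff n f ≠ 0) : (fun i => (n i : ℝ)) ∈ newtonPolyhedron f := by
  refine subset_convexHull ℝ _ ?_
  simp only [Set.mem_iUnion]
  exact ⟨n, hn, fun i => le_rfl⟩

/-- A face on which a positive linear functional is minimal and which has two distinct points
contains two distinct lattice points. -/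
theorem exists_ne_lattice_points {f : MvPowerSeries (Fin 2) ℂ} {A : (Fin 2 → ℝ) →ₗ[ℝ] ℝ}
    {α : Fin 2 → ℝ} (hα : ∀ i, 0 < α i) (hA : ∀ v, A v = α 0 * v 0 + α 1 * v 1) {m : ℝ}
    (hmin : ∀ v ∈ newtonPolyhedron f, m ≤ A v) {x y : Fin 2 → ℝ} (hx : x ∈ newtonPolyhedron f)
    (hy : y ∈ newtonPolyhedron f) (hxm : A x = m) (hym : A y = m) (hxy : x ≠ y) :
    ∃ n n' : Fin 2 →₀ ℕ, n ≠ n' ∧ A (fun i => n i) = m ∧ A (fun i => n' i) = m := by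
  by_contra! hcon
  set T : Set (Fin 2 → ℝ) := {v | A v = m ∧ ∃ n : Fin 2 →₀ ℕ, v = fun i => (n i : ℝ)} with hT
  have hTs : T.Subsingleton := by
    rintro _ ⟨h1, n, rfl⟩ _ ⟨h2, n', rfl⟩
    by_contra hne
    exact hcon n n' (fun h => hne (by rw [h])) h1 h2
  -- If a convex combination is minimal for `A`, every endpoint with non-zero coefficient is
  -- minimal, hence in `T`; and `T` has at most one point.
  have hK : Convex ℝ ({v | m < A v} ∪ T) := by
    have hge : ∀ v ∈ {v | m < A v} ∪ T, m ≤ A v := by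
      rintro v (hv | hv)
      · exact le_of_lt hv
      · exact hv.1.ge
    intro u hu v hv a b ha hb hab
    by_cases hlt : m < A (a • u + b • v)
    · exact Or.inl hlt
    rw [map_add, map_smul, map_smul, smul_eq_mul, smul_eq_mul] at hlt
    have hu' := hge u hu
    have hv' := hge v hv
    have h1 : a * (A u - m) + b * (A v - m) ≤ 0 := by
      have : m = a * m + b * m := by rw [← add_mul, hab, one_mul]
      linarith
    have h2 : a * (A u - m) = 0 := le_antisymm
      (by linarith [mul_nonneg hb (sub_nonneg.mpr hv')]) (mul_nonneg ha (sub_nonneg.mpr hu'))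
    have h3 : b * (A v - m) = 0 := le_antisymm
      (by linarith [mul_nonneg ha (sub_nonneg.mpr hu')]) (mul_nonneg hb (sub_nonneg.mpr hv'))
    rcases mul_eq_zero.mp h2 with rfl | h2
    · rw [zero_add] at hab
      rwa [hab, zero_smul, one_smul, zero_add]
    rcases mul_eq_zero.mp h3 with rfl | h3
    · rw [add_zero] at hab
      rwa [hab, zero_smul, one_smul, add_zero]
    have hu2 : u ∈ T := hu.resolve_left fun h => by
      have : m < A u := h
      linarith
    have hv2 : v ∈ T := hv.resolve_left fun h => by
      have : m < A v := h
      linarith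
    rw [hTs hv2 hu2, ← add_smul, hab, one_smul]
    exact Or.inr hu2
  -- Positivity of the coefficients of `A` leaves the vertex as the only possible minimal point in
  -- each translated orthant.
  have hN : newtonPolyhedron f ⊆ {v | m < A v} ∪ T := by
    refine convexHull_min ?_ hK
    intro v hv
    simp only [Set.mem_iUnion] at hv
    obtain ⟨n, hn, hv⟩ := hv
    by_cases hlt : m < A v
    · exact Or.inl hlt
    have h1 := hmin _ (coe_mem_newtonPolyhedron hn)
    rw [hA] at h1 hlt
    have h2 := mul_nonneg (hα 0).le (sub_nonneg.mpr (hv 0))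
    have h3 := mul_nonneg (hα 1).le (sub_nonneg.mpr (hv 1))
    have h4 : α 0 * (v 0 - n 0) = 0 := by linarith
    have h5 : α 1 * (v 1 - n 1) = 0 := by linarith
    have h6 := (mul_eq_zero.mp h4).resolve_left (hα 0).ne'
    have h7 := (mul_eq_zero.mp h5).resolve_left (hα 1).ne'
    refine Or.inr ⟨by rw [hA]; linarith, n, ?_⟩
    funext i
    fin_cases i
    · exact sub_eq_zero.mp h6
    · exact sub_eq_zero.mp h7
  refine hxy (hTs ((hN hx).resolve_left fun h => ?_) ((hN hy).resolve_left fun h => ?_))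
  · exact absurd hxm (ne_of_gt h)
  · exact absurd hym (ne_of_gt h)

/-- A functional exposing the face is non-negative because the polyhedron is stable under adding the
positive orthant, and strictly positive because the face is bounded. Two lattice points on its line
of minima make the ratio of its coefficients rational. -/
theorem exists_isPrimitiveNormal {f : MvPowerSeries (Fin 2) ℂ} {Δ : Set (Fin 2 → ℝ)}
    (hΔ : IsFacet (newtonPolyhedron f) Δ) (hc : IsCompact Δ) :
    ∃ w : Fin 2 → ℕ, (∀ k, w k ≠ 0) ∧ IsPrimitiveNormal w Δ := by
  obtain ⟨hne, hexp, hdim⟩ := hΔ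
  obtain ⟨l, hl⟩ := hexp hne
  obtain ⟨x, hx⟩ := hne
  set A : (Fin 2 → ℝ) →ₗ[ℝ] ℝ := -(l : (Fin 2 → ℝ) →ₗ[ℝ] ℝ) with hAdef
  have hΔ : ∀ v, v ∈ Δ ↔ v ∈ newtonPolyhedron f ∧ ∀ u ∈ newtonPolyhedron f, A v ≤ A u := by
    intro v
    conv_lhs => rw [hl]
    simp [hAdef]
  set α : Fin 2 → ℝ := fun i => A (Pi.single i 1) with hαdef
  have hA : ∀ v, A v = α 0 * v 0 + α 1 * v 1 := by
    intro v
    have h1 : v = v 0 • Pi.single 0 1 + v 1 • Pi.single 1 1 := by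
      funext k
      fin_cases k <;> simp
    conv_lhs => rw [h1]
    rw [map_add, map_smul, map_smul, smul_eq_mul, smul_eq_mul]
    simp only [hαdef]
    ring
  have hxN := ((hΔ x).mp hx).1
  have hmin := ((hΔ x).mp hx).2
  have hα : ∀ i, 0 < α i := by
    intro i
    have hs : ∀ s : ℝ, 0 ≤ s → x + Pi.single i s ∈ newtonPolyhedron f ∧
        A (x + Pi.single i s) = A x + s * α i := by
      intro s hs
      refine ⟨add_mem_newtonPolyhedron hxN fun k => ?_, ?_⟩
      · rcases eq_or_ne k i with rfl | hk
        · simpa using hs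
        · simp [hk]
      · have h1 : (Pi.single i s : Fin 2 → ℝ) = s • Pi.single i 1 := by
          rw [← Pi.single_smul, smul_eq_mul, mul_one]
        rw [map_add, h1, map_smul, smul_eq_mul]
    have h1 : 0 ≤ α i := by
      obtain ⟨h2, h3⟩ := hs 1 zero_le_one
      have h4 := hmin _ h2
      rw [h3] at h4
      linarith
    refine lt_of_le_of_ne h1 fun h0 => ?_
    obtain ⟨B, hB⟩ := hc.isBounded.exists_norm_le
    have hB0 : 0 ≤ B := (norm_nonneg x).trans (hB x hx)
    -- A vanishing coefficient would put a whole ray in the face; this length pushes the `i`-th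
    -- coordinate to at least `B + 1`.
    obtain ⟨h2, h3⟩ := hs (B + 1 + |x i|) (by positivity)
    rw [← h0, mul_zero, add_zero] at h3
    have h4 : x + Pi.single i (B + 1 + |x i|) ∈ Δ :=
      (hΔ _).mpr ⟨h2, fun u hu => h3.trans_le (hmin u hu)⟩
    have h5 := (norm_le_pi_norm (x + Pi.single i (B + 1 + |x i|)) i).trans (hB _ h4)
    rw [Pi.add_apply, Pi.single_eq_same, Real.norm_eq_abs] at h5
    have h6 := le_abs_self (x i + (B + 1 + |x i|))
    have h7 := neg_abs_le (x i)
    linarith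
  have hconst : ∀ v ∈ Δ, A v = A x := fun v hv =>
    le_antisymm (((hΔ v).mp hv).2 x hxN) (hmin v ((hΔ v).mp hv).1)
  obtain ⟨y, hy, hxy⟩ : ∃ y ∈ Δ, x ≠ y := by
    by_contra! hcon
    have h1 : Δ.Subsingleton := fun u hu v hv => (hcon u hu).symm.trans (hcon v hv)
    rw [vectorSpan_of_subsingleton ℝ h1] at hdim
    simp at hdim
  obtain ⟨n, n', hnn, hn, hn'⟩ := exists_ne_lattice_points hα hA hmin hxN ((hΔ y).mp hy).1 rfl
    (hconst y hy) hxy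
  set D : Fin 2 → ℕ := fun i => ((n i : ℤ) - n' i).natAbs with hD
  have hDr : ∀ i, (D i : ℝ) = |(n i : ℝ) - n' i| := fun i => by
    simp only [hD]
    rw [Nat.cast_natAbs]
    push_cast
    rfl
  have hrel : α 0 * D 0 = α 1 * D 1 := by
    rw [hA] at hn hn'
    have h0 : ∀ i, α i * D i = |α i * ((n i : ℝ) - n' i)| := fun i => by
      rw [hDr, abs_mul, abs_of_pos (hα i)]
    rw [h0, h0]
    have h1 : α 0 * ((n 0 : ℝ) - n' 0) = -(α 1 * ((n 1 : ℝ) - n' 1)) := by linarith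
    rw [h1, abs_neg]
  have hD0 : D 0 ≠ 0 ∧ D 1 ≠ 0 := by
    have h0 : D 0 = 0 ↔ D 1 = 0 := by
      constructor
      · intro h
        rw [h, Nat.cast_zero, mul_zero] at hrel
        exact_mod_cast (mul_eq_zero.mp hrel.symm).resolve_left (hα 1).ne'
      · intro h
        rw [h, Nat.cast_zero, mul_zero] at hrel
        exact_mod_cast (mul_eq_zero.mp hrel).resolve_left (hα 0).ne'
    have h2 : ¬ (D 0 = 0 ∧ D 1 = 0) := by
      rintro ⟨h2, h3⟩
      simp only [hD] at h2 h3
      exact hnn (fin_two_ext (by omega) (by omega))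
    tauto
  -- By `hrel` the pair `(D 1, D 0)` is proportional to the coefficients of `A`; dividing by the gcd
  -- makes it primitive.
  obtain ⟨a, b, hab, ha, hb⟩ := Nat.exists_coprime (D 1) (D 0)
  have hg : (D 1).gcd (D 0) ≠ 0 := fun h => hD0.1 (by rw [hb, h, mul_zero])
  have hab' : α 0 * b = α 1 * a := by
    have h1 : ((D 1).gcd (D 0) : ℝ) ≠ 0 := by exact_mod_cast hg
    apply mul_right_cancel₀ h1
    rw [mul_assoc, mul_assoc]
    have h2 : (D 0 : ℝ) = b * ((D 1).gcd (D 0) : ℝ) := by exact_mod_cast hb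
    have h3 : (D 1 : ℝ) = a * ((D 1).gcd (D 0) : ℝ) := by exact_mod_cast ha
    rw [← h2, ← h3, hrel]
  refine ⟨![a, b], fun k => ?_, hab, fun u hu v hv => ?_⟩
  · fin_cases k
    · rintro (rfl : a = 0)
      exact hD0.2 (by rw [ha, zero_mul])
    · rintro (rfl : b = 0)
      exact hD0.1 (by rw [hb, zero_mul])
  · have h1 : A u = A v := (hconst u hu).trans (hconst v hv).symm
    rw [hA, hA] at h1
    rw [Fin.sum_univ_two]
    change (a : ℝ) * (u 0 - v 0) + (b : ℝ) * (u 1 - v 1) = 0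
    have h2 : α 0 * ((a : ℝ) * (u 0 - v 0) + (b : ℝ) * (u 1 - v 1)) = 0 := by
      linear_combination (u 1 - v 1) * hab' + (a : ℝ) * h1
    exact (mul_eq_zero.mp h2).resolve_left (hα 0).ne'

/-! ### Normalised series -/

/-- If one entry of the normal vector is 1, the weight is one of those for which balance is known.
If both are 1, both variables give a bound, which yields the minimum; if neither is, nothing is
required. -/
theorem isNormalisedAtCompactFacets_of_isBalanced {f : MvPowerSeries (Fin 2) ℂ}
    (h : f ≠ 0 → ∀ i n, n ≠ 0 → IsBalanced i n f) : IsNormalisedAtCompactFacets f := by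
  intro Δ hΔ hc
  have hf0 : f ≠ 0 := by
    rintro rfl
    obtain ⟨x, hx⟩ := hΔ.1
    have h1 : x ∈ newtonPolyhedron (0 : MvPowerSeries (Fin 2) ℂ) := hΔ.2.1.subset hx
    simp [newtonPolyhedron] at h1
  obtain ⟨w, hw, hwn⟩ := exists_isPrimitiveNormal hΔ hc
  refine ⟨w, hwn, Or.inr ?_⟩
  have key : ∀ i j, i ≠ j → w j = 1 →
      maxMultiplicity (saturation (leadingTerm w f)) ≤ (monomialExponent (leadingTerm w f) i : ℕ) := by
    intro i j hij hj
    have h1 : w = axisWeight i (w i) := by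
      funext k
      rcases eq_or_ne i k with rfl | hk
      · rw [axisWeight_self]
      · rw [axisWeight_of_ne hk]
        have : k = j := by omega
        rw [this, hj]
    rw [h1]
    exact (h hf0 i (w i) (hw i)).maxMultiplicity_le hij (hw i) hf0
  rcases (Nat.one_le_iff_ne_zero.mpr (hw 0)).eq_or_lt with h0 | h0 <;>
    rcases (Nat.one_le_iff_ne_zero.mpr (hw 1)).eq_or_lt with h1 | h1
  · refine Or.inl ⟨h0.symm, h1.symm, ?_⟩
    rcases min_choice (monomialExponent (leadingTerm w f) 0) (monomialExponent (leadingTerm w f) 1)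
      with h2 | h2 <;> rw [h2]
    · exact key 0 1 (by decide) h1.symm
    · exact key 1 0 (by decide) h0.symm
  · exact Or.inr (Or.inl ⟨h0.symm, h1, key 1 0 (by decide) h0.symm⟩)
  · exact Or.inr (Or.inr (Or.inl ⟨h0, h1.symm, key 0 1 (by decide) h1.symm⟩))
  · exact Or.inr (Or.inr (Or.inr ⟨h0, h1⟩))

/-! ### Truncation and the convergent case -/

/-- The bound is uniform in `n`. Take an exponent `D` of `g` with minimal `x_i`-exponent. Any
exponent of `g` whose weight does not exceed that of `D` has at least this `x_i`-exponent, and as `n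
≥ 1` its degree is at most `D.degree`. Truncation beyond that degree changes no leading term. -/
theorem exists_isBalanced_of_coeff_eq {g : MvPowerSeries (Fin 2) ℂ} (hg : g ≠ 0)
    {i j : Fin 2} (hij : i ≠ j) :
    ∃ M₀, ∀ M ≥ M₀, ∀ g' : MvPowerSeries (Fin 2) ℂ,
      (∀ d, coeff d g' = if d.degree ≤ M then coeff d g else 0) →
        ∀ n, n ≠ 0 → IsBalanced i n g → IsBalanced i n g' := by
  classical
  have hex : ∃ k, ∃ d : Fin 2 →₀ ℕ, d i = k ∧ coeff d g ≠ 0 := by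
    by_contra! h
    exact hg (MvPowerSeries.ext fun d => h _ d rfl)
  obtain ⟨D, hDk, hD0⟩ := Nat.find_spec hex
  have hmin : ∀ d, coeff d g ≠ 0 → D i ≤ d i := fun d hd => by
    rw [hDk]
    exact Nat.find_min' hex ⟨d, rfl, hd⟩
  refine ⟨D.degree, fun M hM g' hg' n hn hbal p hp => ?_⟩
  have hdeg : ∀ d : Fin 2 →₀ ℕ, d.degree = d i + d j := fun d => by
    rw [← weight_axisWeight_one i, weight_eq hij, axisWeight_self, axisWeight_of_ne hij, mul_one,
      mul_one]
  have hpD : p ≤ Finsupp.weight (axisWeight i n) D := by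
    by_contra! hlt
    have h1 := hp D hlt
    rw [hg', if_pos hM] at h1
    exact hD0 h1
  have heq : ∀ d, Finsupp.weight (axisWeight i n) d ≤ p → coeff d g' = coeff d g := by
    intro d hd
    rw [hg']
    split_ifs with hdM
    · rfl
    · by_contra h0
      have h1 := hmin d (Ne.symm h0)
      have h2 := hd.trans hpD
      rw [weight_eq hij, weight_eq hij, axisWeight_self, axisWeight_of_ne hij] at h2
      apply hdM
      refine le_trans ?_ hM
      rw [hdeg, hdeg]
      obtain ⟨s, hs⟩ := Nat.exists_eq_add_of_le h1
      obtain ⟨n, rfl⟩ := Nat.exists_eq_succ_of_ne_zero hn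
      rw [hs] at h2 ⊢
      nlinarith [Nat.zero_le (s * n)]
  rw [initForm_congr (axisWeight_ne_zero i hn) (axisVar i) fun d hd => heq d hd.le]
  exact hbal p fun d hd => by rw [← heq d hd.le, hp d hd]

/-- An automorphism of the algebra of formal power series that respects convergence, restricted to
the algebra of convergent power series. -/
def restrictConvergent {σ : Type*} (Ψ : MvPowerSeries σ ℂ ≃ₐ[ℂ] MvPowerSeries σ ℂ)
    (h : ∀ f, IsConvergent (Ψ f) ↔ IsConvergent f) :
    convergentPowerSeries σ ≃ₐ[ℂ] convergentPowerSeries σ where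
  toFun f := ⟨Ψ f, (h _).mpr f.2⟩
  invFun f := ⟨Ψ.symm f, (h _).mp (by rw [AlgEquiv.apply_symm_apply]; exact f.2)⟩
  left_inv f := Subtype.ext (Ψ.symm_apply_apply _)
  right_inv f := Subtype.ext (Ψ.apply_symm_apply _)
  map_mul' f g := Subtype.ext (map_mul Ψ _ _)
  map_add' f g := Subtype.ext (map_add Ψ _ _)
  commutes' c := Subtype.ext (Ψ.commutes c)

theorem ne_zero_of_definesIsolatedSingularity {f : convergentPowerSeries (Fin 2)}
    (hf : DefinesIsolatedSingularity f) : (f : MvPowerSeries (Fin 2) ℂ) ≠ 0 := by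
  intro h0
  have hz : IsConvergent (0 : MvPowerSeries (Fin 2) ℂ) := (convergentPowerSeries (Fin 2)).zero_mem
  refine eventually_evalAt_ne_zero_of_isolated hf (isConvergent_X 0) hz ?_ (b := fun _ => 0)
    (fun _ => hz) (fun i => ?_) (constantCoeff_X 0)
  · rw [h0, mul_zero]
  · rw [h0, map_zero, mul_zero]

/-- Pulling the truncated normal form back by a convergent approximation gives a convergent series
close to `f`. Determinacy makes it right equivalent to `f`, and the approximation carries it to the
polynomial. -/
theorem exists_rightEquivalent_normalised {f : convergentPowerSeries (Fin 2)}
    (hf : DefinesIsolatedSingularity f) : ∃ g : convergentPowerSeries (Fin 2),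
      RightEquivalent f g ∧ (∃ p : MvPolynomial (Fin 2) ℂ,
        (p : MvPowerSeries (Fin 2) ℂ) = (g : MvPowerSeries (Fin 2) ℂ)) ∧
      IsNormalisedAtCompactFacets (g : MvPowerSeries (Fin 2) ℂ) := by
  obtain ⟨K, α, hα, hJ⟩ := exists_pow_eq_sum_pderiv hf
  obtain ⟨N, hN⟩ := exists_determinacy f K α hα hJ
  have hf0 := ne_zero_of_definesIsolatedSingularity hf
  obtain ⟨Φ, hΦ, hbal⟩ := exists_isApproximable_isBalanced hf0
  have hg0 : Φ (f : MvPowerSeries (Fin 2) ℂ) ≠ 0 := by simpa using hf0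
  obtain ⟨M₀, hM₀⟩ := exists_isBalanced_of_coeff_eq hg0 (show (0 : Fin 2) ≠ 1 by decide)
  obtain ⟨M₁, hM₁⟩ := exists_isBalanced_of_coeff_eq hg0 (show (1 : Fin 2) ≠ 0 by decide)
  set M := max N (max M₀ M₁) with hM
  set p : MvPolynomial (Fin 2) ℂ := truncTotal (M + 1) (Φ (f : MvPowerSeries (Fin 2) ℂ)) with hp
  have hcoeff : ∀ d, coeff d (p : MvPowerSeries (Fin 2) ℂ) =
      if d.degree ≤ M then coeff d (Φ (f : MvPowerSeries (Fin 2) ℂ)) else 0 := by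
    intro d
    rw [MvPolynomial.coeff_coe, hp, coeff_truncTotal_eq_ite]
    simp only [Nat.lt_succ_iff]
  obtain ⟨Ψ, hΨc, hΨo, hΨ⟩ := hΦ.2 (M + 1)
  set q : MvPowerSeries (Fin 2) ℂ := Ψ.symm p with hq
  have hΨq : Ψ q = p := Ψ.apply_symm_apply _
  have hqc : IsConvergent q := (hΨc q).mp (by rw [hΨq]; exact isConvergent_coe p)
  -- Since `Ψ` preserves orders, it is enough to compare `p` with `Ψ f`; both agree with `Φ f`
  -- through degree `M`.
  have hqo : ((M + 1 : ℕ) : ℕ∞) ≤ (q - f).order := by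
    rw [← hΨo, map_sub, hΨq]
    have h1 : (p : MvPowerSeries (Fin 2) ℂ) - Ψ f = (p - Φ f) + -(Ψ f - Φ f) := by ring
    rw [h1]
    refine le_trans (le_min ?_ ?_) min_order_le_add
    · refine le_order_sub_of_coeff fun d hd => ?_
      rw [hcoeff, if_pos (by omega)]
    · rw [order_neg]
      exact hΨ _
  obtain ⟨Φ', hΦ'⟩ := hN ⟨q, hqc⟩ fun d hd =>
    coeff_eq_of_le_order_sub hqo (by omega)
  refine ⟨⟨p, isConvergent_coe p⟩, ⟨Φ'.trans (restrictConvergent Ψ hΨc), ?_⟩, ⟨p, rfl⟩, ?_⟩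
  · rw [AlgEquiv.trans_apply, hΦ']
    exact Subtype.ext hΨq
  · refine isNormalisedAtCompactFacets_of_isBalanced fun _ i n hn => ?_
    fin_cases i
    · exact hM₀ M (by omega) _ hcoeff n hn (hbal 0 n hn)
    · exact hM₁ M (by omega) _ hcoeff n hn (hbal 1 n hn)

theorem exists_formallyRightEquivalent_normalised (f : MvPowerSeries (Fin 2) ℂ) :
    ∃ g : MvPowerSeries (Fin 2) ℂ, FormallyRightEquivalent f g ∧
      IsNormalisedAtCompactFacets g := by
  by_cases hf : f = 0
  · exact ⟨f, ⟨AlgEquiv.refl, rfl⟩, isNormalisedAtCompactFacets_of_isBalanced fun h => absurd hf h⟩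
  · obtain ⟨Φ, -, hbal⟩ := exists_isApproximable_isBalanced hf
    exact ⟨Φ f, ⟨Φ, rfl⟩, isNormalisedAtCompactFacets_of_isBalanced fun _ => hbal⟩

end

end NewtonPolyhedron


theorem mainTheorem4 :
    (∀ f : MvPowerSeries (Fin 2) ℂ, ∃ g : MvPowerSeries (Fin 2) ℂ,
      NewtonPolyhedron.FormallyRightEquivalent f g ∧
        NewtonPolyhedron.IsNormalisedAtCompactFacets g) ∧
    (∀ f : NewtonPolyhedron.convergentPowerSeries (Fin 2),
      NewtonPolyhedron.DefinesIsolatedSingularity f →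
        ∃ g : NewtonPolyhedron.convergentPowerSeries (Fin 2),
          NewtonPolyhedron.RightEquivalent f g ∧
          (∃ p : MvPolynomial (Fin 2) ℂ,
            (p : MvPowerSeries (Fin 2) ℂ) = (g : MvPowerSeries (Fin 2) ℂ)) ∧
          NewtonPolyhedron.IsNormalisedAtCompactFacets
            (g : MvPowerSeries (Fin 2) ℂ)) :=
  ⟨NewtonPolyhedron.exists_formallyRightEquivalent_normalised,
    fun _ hf => NewtonPolyhedron.exists_rightEquivalent_normalised hf⟩
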